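/- Let $k\ge 1$ and let $X$ be a connected CW-complex with finite $k$-skeleton, with universal cover $p\colon\widetilde X\to X$ and fundamental group $G=\pi_1(X)$, acting on $\widetilde X$ by deck transformations. For a commutative ring $S$ and a multiplicative homomorphism $G\to S^\times$ (equivalently, a ring map $\mathbb{Z}G\to S$), let $H_i(X,S)$ be the $i$-th homology of the complex $S\otimes_{\mathbb{Z}G}C_\bullet(\widetilde X,\mathbb{Z})$, where $C_\bullet(\widetilde X,\mathbb{Z})$ is the cellular chain complex of $\widetilde X$ with the cell structure lifted from $X$. For a character $\rho\colon G\to\mathbb{C}^\times$ let $\mathbb{C}_\rho$ be $\mathbb{C}$ with $G$ acting through $\rho$, and let $$\mathcal V^i_1(X,\mathbb{C})=\{\rho\in\mathrm{Hom}(G,\mathbb{C}^\times)\mid \dim_{\mathbb{C}}H_i(X,\mathbb{C}_\rho)\ge 1\}.$$ For $W\subseteq\mathrm{Hom}(G,\mathbb{C}^\times)$ let $\tau_1(W)$ be the set of all $z\in\mathrm{Hom}(G,\mathbb{C})$ such that $\exp(tz)\in W$ for all $t\in\mathbb{C}$, and let $\tau_1^{\mathbb{R}}(W)=\tau_1(W)\cap\mathrm{Hom}(G,\mathbb{R})$.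 For a non-zero homomorphism $\chi\colon G\to\mathbb{R}$ let $\Gamma=\chi(G)\subset\mathbb{R}$, and call $f=\sum_\gamma n_\gamma\gamma\in\mathbb{Z}\Gamma$ monic if the greatest element of its support is $0$ and $n_0=1$. The rational Novikov ring $\mathcal R\Gamma$ is the localization of $\mathbb{Z}\Gamma$ at the multiplicative set of monic elements. With $G$ acting on $\mathcal R\Gamma$ through $G\to\Gamma\subset\mathcal R\Gamma$, the Novikov Betti numbers of $X$ are $b_i(X,\chi)=\operatorname{rank}_{\mathcal R\Gamma}H_i(X,\mathcal R\Gamma)$. Theorem. Let $\chi\colon G\to\mathbb{R}$ be a non-zero homomorphism. Then, for each $0\le q\le k$, $$\chi\notin\tau_1^{\mathbb{R}}\Big(\bigcup_{i\le q}\mathcal V^i_1(X,\mathbb{C})\Big)\iff b_i(X,\chi)=0\ \text{ for all } i\le q.$$ -/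

import Mathlib

open CategoryTheory Limits AlgebraicTopology TensorProduct Topology

universe u v w

noncomputable section

namespace NovikovTau

/-! ### Relative singular homology and the cellular chain groups of a filtered space -/

/-- The integral singular chain complex of a topological space. -/
abbrev singularChains : TopCat.{u} ⥤ ChainComplex (ModuleCat.{u} ℤ) ℕ :=
  (singularChainComplexFunctor (ModuleCat.{u} ℤ)).obj (ModuleCat.of ℤ (ULift.{u} ℤ))

/-- `S(A) ⟶ S(B) ⟶ S(B, A) = S(B) / S(A)` for a map `f : A ⟶ B`. -/
abbrev pairSeq {A B : TopCat.{u}} (f : A ⟶ B) :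
    ShortComplex (ChainComplex (ModuleCat.{u} ℤ) ℕ) :=
  ShortComplex.mk (singularChains.map f) (cokernel.π (singularChains.map f))
    (cokernel.condition _)

lemma pairSeq_shortExact {A B : TopCat.{u}} (f : A ⟶ B) [Mono f] :
    (pairSeq f).ShortExact where
  exact := ShortComplex.exact_cokernel (singularChains.map f)
  mono_f := by
    have : HasLimitsOfSize.{0, 0} (ModuleCat.{u} ℤ) := inferInstance
    have : HasPullbacks (ModuleCat.{u} ℤ) := inferInstance
    have : singularChains.{u}.PreservesMonomorphisms := inferInstance
    exact Functor.map_mono singularChains.{u} f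
  epi_g := inferInstanceAs (Epi (cokernel.π (singularChains.map f)))

/-- The inclusion of consecutive terms of a filtered space `F 0 ⊆ F 1 ⊆ F 2 ⊆ …`, where the term
`F n` plays the role of the `(n - 1)`-skeleton. -/
def stepMap (F : ℕ ⥤ TopCat.{u}) (n : ℕ) : F.obj n ⟶ F.obj (n + 1) :=
  F.map (homOfLE n.le_succ)

lemma singularChains_stepMap {F F' : ℕ ⥤ TopCat.{u}} (τ : F ⟶ F') (n : ℕ) :
    singularChains.map (stepMap F n) ≫ singularChains.map (τ.app (n + 1)) =
      singularChains.map (τ.app n) ≫ singularChains.map (stepMap F' n) := by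
  rw [← Functor.map_comp, ← Functor.map_comp, stepMap, stepMap, τ.naturality]

/-- The morphism of pair sequences induced by a map of filtered spaces. -/
def pairSeqMap {F F' : ℕ ⥤ TopCat.{u}} (τ : F ⟶ F') (n : ℕ) :
    pairSeq (stepMap F n) ⟶ pairSeq (stepMap F' n) where
  τ₁ := singularChains.map (τ.app n)
  τ₂ := singularChains.map (τ.app (n + 1))
  τ₃ := cokernel.map _ _ (singularChains.map (τ.app n)) (singularChains.map (τ.app (n + 1)))
    (singularChains_stepMap τ n)
  comm₁₂ := (singularChains_stepMap τ n).symm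
  comm₂₃ := (cokernel.π_desc _ _ _).symm

/-- The `n`-th cellular chain group `H_n(F (n + 1), F n; ℤ)`. -/
def cellChain (F : ℕ ⥤ TopCat.{u}) (n : ℕ) : ModuleCat.{u} ℤ :=
  (pairSeq (stepMap F n)).X₃.homology n

/-- Functoriality of the cellular chain groups. -/
def cellChainMap {F F' : ℕ ⥤ TopCat.{u}} (τ : F ⟶ F') (n : ℕ) :
    cellChain F n ⟶ cellChain F' n :=
  HomologicalComplex.homologyMap (pairSeqMap τ n).τ₃ n

lemma pairSeqMap_id (F : ℕ ⥤ TopCat.{u}) (n : ℕ) :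
    (pairSeqMap (𝟙 F) n).τ₃ = 𝟙 _ := by
  refine coequalizer.hom_ext ?_
  refine (cokernel.π_desc _ _ _).trans ?_
  rw [NatTrans.id_app, CategoryTheory.Functor.map_id, Category.id_comp]
  exact (Category.comp_id _).symm

lemma pairSeqMap_comp {F F' F'' : ℕ ⥤ TopCat.{u}} (τ : F ⟶ F') (σ : F' ⟶ F'') (n : ℕ) :
    (pairSeqMap (τ ≫ σ) n).τ₃ = (pairSeqMap τ n).τ₃ ≫ (pairSeqMap σ n).τ₃ := by
  refine coequalizer.hom_ext ?_
  refine (cokernel.π_desc _ _ _).trans ?_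
  have h₁ := (pairSeqMap τ n).comm₂₃
  have h₂ := (pairSeqMap σ n).comm₂₃
  change singularChains.map (τ.app (n + 1)) ≫ cokernel.π _ = cokernel.π _ ≫ _ at h₁
  change singularChains.map (σ.app (n + 1)) ≫ cokernel.π _ = cokernel.π _ ≫ _ at h₂
  rw [NatTrans.comp_app, Functor.map_comp, Category.assoc, h₂, reassoc_of% h₁]

lemma cellChainMap_id (F : ℕ ⥤ TopCat.{u}) (n : ℕ) :
    cellChainMap (𝟙 F) n = 𝟙 _ := by
  rw [cellChainMap, pairSeqMap_id]
  exact HomologicalComplex.homologyMap_id _ _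

lemma cellChainMap_comp {F F' F'' : ℕ ⥤ TopCat.{u}} (τ : F ⟶ F') (σ : F' ⟶ F'') (n : ℕ) :
    cellChainMap (τ ≫ σ) n = cellChainMap τ n ≫ cellChainMap σ n := by
  rw [cellChainMap, pairSeqMap_comp]
  exact HomologicalComplex.homologyMap_comp _ _ _

/-- The cellular boundary map, the composite
`H_{n+1}(F (n + 2), F (n + 1)) ⟶ H_n(F (n + 1)) ⟶ H_n(F (n + 1), F n)` of the connecting
homomorphism of the pair with the map to relative homology. -/
def cellBoundary (F : ℕ ⥤ TopCat.{u}) (hF : ∀ n, Mono (stepMap F n)) (n : ℕ) :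
    cellChain F (n + 1) ⟶ cellChain F n :=
  haveI := hF (n + 1)
  (pairSeq_shortExact (stepMap F (n + 1))).δ (n + 1) n (ComplexShape.down_mk _ _ rfl) ≫
    HomologicalComplex.homologyMap (pairSeq (stepMap F n)).g n

lemma cellBoundary_comp (F : ℕ ⥤ TopCat.{u}) (hF : ∀ n, Mono (stepMap F n)) (n : ℕ) :
    cellBoundary F hF (n + 1) ≫ cellBoundary F hF n = 0 := by
  have := hF (n + 1)
  have h := (pairSeq_shortExact (stepMap F (n + 1))).comp_δ (n + 1) n
    (ComplexShape.down_mk _ _ rfl)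
  unfold cellBoundary
  refine (Category.assoc _ _ _).trans ?_
  refine (congrArg (fun φ => _ ≫ φ) ((Category.assoc _ _ _).symm.trans
    ((congrArg (fun φ => φ ≫ _) h).trans zero_comp))).trans comp_zero

lemma cellBoundary_naturality {F F' : ℕ ⥤ TopCat.{u}} (hF : ∀ n, Mono (stepMap F n))
    (hF' : ∀ n, Mono (stepMap F' n)) (τ : F ⟶ F') (n : ℕ) :
    cellBoundary F hF n ≫ cellChainMap τ n = cellChainMap τ (n + 1) ≫ cellBoundary F' hF' n := by
  have := hF (n + 1)
  have := hF' (n + 1)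
  have h := HomologicalComplex.HomologySequence.δ_naturality (pairSeqMap τ (n + 1))
    (pairSeq_shortExact (stepMap F (n + 1))) (pairSeq_shortExact (stepMap F' (n + 1)))
    (n + 1) n (ComplexShape.down_mk _ _ rfl)
  have h' := congrArg (fun φ => HomologicalComplex.homologyMap φ n) (pairSeqMap τ n).comm₂₃
  simp only [HomologicalComplex.homologyMap_comp] at h'
  unfold cellBoundary cellChainMap
  refine (Category.assoc _ _ _).trans ((congrArg (fun φ => _ ≫ φ) h'.symm).trans ?_)
  refine (Category.assoc _ _ _).symm.trans ((congrArg (fun φ => φ ≫ _) h).trans ?_)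
  exact Category.assoc _ _ _

/-! ### Base change along a group ring -/

section GroupRing

variable {G : Type v} [Group G] {S : Type w} [CommRing S]

/-- The relations `a g ⊗ m = a ⊗ g m`. -/
def balancedRel {M : Type u} [AddCommGroup M] [Module ℤ M] (ψ : G →* S) (ρ : Representation ℤ G M) :
    Submodule S (S ⊗[ℤ] M) :=
  Submodule.span S {x | ∃ (a : S) (g : G) (m : M), x = (a * ψ g) ⊗ₜ[ℤ] m - a ⊗ₜ[ℤ] (ρ g m)}

/-- The `S`-module `S ⊗_{ℤG} M`, where the left `ℤG`-module `M` is given by the representation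
`ρ` and the commutative ring `S` is a right `ℤG`-module via `a · g = a * ψ g`. -/
abbrev GroupTensor {M : Type u} [AddCommGroup M] [Module ℤ M] (ψ : G →* S) (ρ : Representation ℤ G M) :
    Type (max u w) :=
  (S ⊗[ℤ] M) ⧸ balancedRel ψ ρ

lemma balancedRel_le_comap {M N : Type u} [AddCommGroup M] [Module ℤ M] [AddCommGroup N]
    [Module ℤ N] (ψ : G →* S)
    (ρ : Representation ℤ G M) (σ : Representation ℤ G N) (f : M →ₗ[ℤ] N)
    (hf : ∀ g m, f (ρ g m) = σ g (f m)) :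
    balancedRel ψ ρ ≤ (balancedRel ψ σ).comap (f.baseChange S) := by
  rw [balancedRel, Submodule.span_le]
  rintro _ ⟨a, g, m, rfl⟩
  refine Submodule.subset_span ⟨a, g, f m, ?_⟩
  simp [hf]

/-- The map `id ⊗ f : S ⊗_{ℤG} M → S ⊗_{ℤG} N` induced by a `G`-equivariant map `f`. -/
def groupTensorMap {M N : Type u} [AddCommGroup M] [Module ℤ M] [AddCommGroup N]
    [Module ℤ N] (ψ : G →* S)
    (ρ : Representation ℤ G M) (σ : Representation ℤ G N) (f : M →ₗ[ℤ] N)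
    (hf : ∀ g m, f (ρ g m) = σ g (f m)) : GroupTensor ψ ρ →ₗ[S] GroupTensor ψ σ :=
  Submodule.mapQ _ _ (f.baseChange S) (balancedRel_le_comap ψ ρ σ f hf)

lemma groupTensorMap_comp_eq_zero {M N P : Type u} [AddCommGroup M] [Module ℤ M]
    [AddCommGroup N] [Module ℤ N] [AddCommGroup P] [Module ℤ P] (ψ : G →* S)
    (ρ : Representation ℤ G M) (σ : Representation ℤ G N) (θ : Representation ℤ G P)
    (f : M →ₗ[ℤ] N) (hf : ∀ g m, f (ρ g m) = σ g (f m))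
    (f' : N →ₗ[ℤ] P) (hf' : ∀ g m, f' (σ g m) = θ g (f' m)) (h : f' ∘ₗ f = 0) :
    groupTensorMap ψ σ θ f' hf' ∘ₗ groupTensorMap ψ ρ σ f hf = 0 := by
  rw [groupTensorMap, groupTensorMap, ← Submodule.mapQ_comp]
  simp only [← LinearMap.baseChange_comp, h, LinearMap.baseChange_zero]
  exact Submodule.mapQ_zero _ _

end GroupRing

/-! ### The universal cover and its deck transformations -/

section Cover

variable {X : Type u} [TopologicalSpace X] {E : Type u} [TopologicalSpace E]

/-- The group of deck transformations of `p : E → X`. -/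
def deckGroup (p : E → X) : Subgroup (E ≃ₜ E) where
  carrier := {d | ∀ e, p (d e) = p e}
  one_mem' _ := rfl
  mul_mem' {a b} ha hb e := (ha (b e)).trans (hb e)
  inv_mem' {a} ha e := by
    have h := ha (a⁻¹ e)
    rw [← h]
    exact congrArg p (a.apply_symm_apply e)

/-- The class in `π₁(X, p e₀)` of the image under `p` of a path in `E` from `e₀` to `d e₀`.
For `E` simply connected it does not depend on the path. -/
def deckLoop [PathConnectedSpace E] {p : E → X} (hp : Continuous p) (e₀ : E)
    (d : deckGroup p) : FundamentalGroup X (p e₀) :=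
  FundamentalGroup.fromPath (Path.Homotopic.Quotient.mk
    (((PathConnectedSpace.somePath e₀ (d.1 e₀)).map hp).cast rfl (d.2 e₀).symm))

lemma deckLoop_eq [SimplyConnectedSpace E] {p : E → X} (hp : Continuous p) (e₀ : E)
    (d : deckGroup p) (γ : Path e₀ (d.1 e₀)) :
    deckLoop hp e₀ d = FundamentalGroup.fromPath (Path.Homotopic.Quotient.mk
      ((γ.map hp).cast rfl (d.2 e₀).symm)) :=
  congrArg FundamentalGroup.fromPath (Path.Homotopic.Quotient.eq.mpr
    ((SimplyConnectedSpace.paths_homotopic (PathConnectedSpace.somePath e₀ (d.1 e₀)) γ).map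
      ⟨p, hp⟩))

lemma deckLoop_one [SimplyConnectedSpace E] {p : E → X} (hp : Continuous p) (e₀ : E) :
    deckLoop hp e₀ 1 = 1 := by
  rw [deckLoop_eq hp e₀ 1 (Path.refl e₀)]
  rfl

/- The multiplication of `FundamentalGroup` is opposite to the concatenation of loops. -/
lemma deckLoop_mul [SimplyConnectedSpace E] {p : E → X} (hp : Continuous p) (e₀ : E)
    (a b : deckGroup p) : deckLoop hp e₀ (a * b) = deckLoop hp e₀ b * deckLoop hp e₀ a := by
  let γ := PathConnectedSpace.somePath e₀ (a.1 e₀)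
  let γ' := PathConnectedSpace.somePath e₀ (b.1 e₀)
  rw [deckLoop_eq hp e₀ (a * b) (γ.trans (γ'.map a.1.continuous)),
    deckLoop_eq hp e₀ a γ, deckLoop_eq hp e₀ b γ']
  refine congrArg (fun x => FundamentalGroup.fromPath (Path.Homotopic.Quotient.mk x)) ?_
  ext t
  change p ((γ.trans (γ'.map a.1.continuous)) t) = ((γ.map hp).cast rfl (a.2 e₀).symm).trans
    ((γ'.map hp).cast rfl (b.2 e₀).symm) t
  rw [Path.trans_apply, Path.trans_apply]
  split_ifs
  · rfl
  · exact a.2 _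

/-- A character of `π₁(X, p e₀)` with values in a commutative ring (a multiplicative map to `S`),
seen as a character of the deck transformation group. -/
def deckChar [SimplyConnectedSpace E] {p : E → X} (hp : Continuous p) (e₀ : E)
    {S : Type w} [CommRing S] (ψ : FundamentalGroup X (p e₀) →* S) : deckGroup p →* S where
  toFun d := ψ (deckLoop hp e₀ d)
  map_one' := by rw [deckLoop_one, map_one]
  map_mul' a b := by rw [deckLoop_mul, map_mul, mul_comm]

end Cover

/-! ### Cellular chains of the universal cover and twisted homology -/

section Twisted

variable {X : Type u} [TopologicalSpace X] [T2Space X] [CWComplex (Set.univ : Set X)]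
  {E : Type u}

/-- The part of `E` that lies over the cells of `X` of dimension `< n`. -/
def coverSkeleton (p : E → X) (n : ℕ) : Set E :=
  p ⁻¹' (CWComplex.skeletonLT (Set.univ : Set X) (n : ℕ∞) : Set X)

lemma coverSkeleton_mono (p : E → X) {m n : ℕ} (h : m ≤ n) :
    coverSkeleton p m ⊆ coverSkeleton p n :=
  Set.preimage_mono (CWComplex.skeletonLT_mono (by exact_mod_cast h))

variable [TopologicalSpace E]

/-- The filtration of `E` by the preimages of the skeleta of `X`, that is, by the skeleta of
the cell structure on `E` lifted from `X`. -/
abbrev coverFiltration (p : E → X) : ℕ ⥤ TopCat.{u} where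
  obj n := TopCat.of (coverSkeleton p n)
  map {m n} h := TopCat.ofHom
    ⟨Set.inclusion (coverSkeleton_mono p (leOfHom h)), continuous_inclusion _⟩

lemma coverFiltration_mono (p : E → X) (n : ℕ) : Mono (stepMap (coverFiltration p) n) :=
  (TopCat.mono_iff_injective _).mpr
    (Set.inclusion_injective (coverSkeleton_mono p n.le_succ))

lemma deck_mem_coverSkeleton {p : E → X} (d : deckGroup p) {n : ℕ} {e : E}
    (he : e ∈ coverSkeleton p n) : d.1 e ∈ coverSkeleton p n := by
  have h : p (d.1 e) = p e := d.2 e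
  simp only [coverSkeleton, Set.mem_preimage] at he ⊢
  rwa [h]

/-- The action of a deck transformation on the skeletal filtration. -/
def deckFiltration (p : E → X) (d : deckGroup p) : coverFiltration p ⟶ coverFiltration p where
  app _ := TopCat.ofHom ⟨fun e => ⟨d.1 e.1, deck_mem_coverSkeleton d e.2⟩,
    (d.1.continuous.comp continuous_subtype_val).subtype_mk _⟩
  naturality _ _ _ := rfl

/-- The left `ℤ[Deck]`-module structure on the cellular chain group `C_n(E; ℤ)`. -/
def cellRep (p : E → X) (n : ℕ) :
    Representation ℤ (deckGroup p) (cellChain (coverFiltration p) n) where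
  toFun d := (cellChainMap (deckFiltration p d) n).hom
  map_one' := by
    have h : deckFiltration p 1 = 𝟙 _ := rfl
    rw [h, cellChainMap_id]
    rfl
  map_mul' a b := by
    have h : deckFiltration p (a * b) = deckFiltration p b ≫ deckFiltration p a := rfl
    rw [h, cellChainMap_comp]
    rfl

lemma cellBoundary_equivariant (p : E → X) (n : ℕ) (d : deckGroup p)
    (c : cellChain (coverFiltration p) (n + 1)) :
    (cellBoundary (coverFiltration p) (coverFiltration_mono p) n).hom (cellRep p (n + 1) d c) =
      cellRep p n d ((cellBoundary (coverFiltration p) (coverFiltration_mono p) n).hom c) := by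
  have h := cellBoundary_naturality (coverFiltration_mono p) (coverFiltration_mono p)
    (deckFiltration p d) n
  exact (congrArg (fun φ => φ.hom c) h).symm

/-- `S ⊗_{ℤG} C_n(E; ℤ)` for the deck group `G`. -/
abbrev TwistedChain (p : E → X) {S : Type w} [CommRing S] (ψ : deckGroup p →* S) (n : ℕ) :
    Type (max u w) :=
  GroupTensor ψ (cellRep p n)

/-- The boundary `id ⊗ ∂` of `S ⊗_{ℤG} C_•(E; ℤ)`. -/
def twistedBoundary (p : E → X) {S : Type w} [CommRing S] (ψ : deckGroup p →* S) (n : ℕ) :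
    TwistedChain p ψ (n + 1) →ₗ[S] TwistedChain p ψ n :=
  groupTensorMap ψ (cellRep p (n + 1)) (cellRep p n)
    (cellBoundary (coverFiltration p) (coverFiltration_mono p) n).hom
    (cellBoundary_equivariant p n)

lemma twistedBoundary_comp (p : E → X) {S : Type w} [CommRing S] (ψ : deckGroup p →* S)
    (n : ℕ) : twistedBoundary p ψ n ∘ₗ twistedBoundary p ψ (n + 1) = 0 :=
  groupTensorMap_comp_eq_zero ψ _ _ _ _ _ _ _ (congrArg (fun φ => φ.hom)
    (cellBoundary_comp (coverFiltration p) (coverFiltration_mono p) n))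

/-- The chain complex `S ⊗_{ℤG} C_•(E; ℤ)` of `S`-modules. -/
def twistedComplex (p : E → X) {S : Type w} [CommRing S] (ψ : deckGroup p →* S) :
    ChainComplex (ModuleCat.{max u w} S) ℕ :=
  ChainComplex.of (fun n => ModuleCat.of S (TwistedChain p ψ n))
    (fun n => ModuleCat.ofHom (twistedBoundary p ψ n))
    (fun n => by rw [← ModuleCat.ofHom_comp, twistedBoundary_comp]; rfl)

variable [SimplyConnectedSpace E]

/-- The homology `H_i(X, S)` of `X` with coefficients in a commutative ring `S`, viewed as a
module over `ℤ[π₁(X, p e₀)]` via `ψ`, computed from the universal cover `p : E → X`. -/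
abbrev twistedHomology {p : E → X} (hp : Continuous p) (e₀ : E) {S : Type w} [CommRing S]
    (ψ : FundamentalGroup X (p e₀) →* S) (i : ℕ) : ModuleCat.{max u w} S :=
  (twistedComplex p (deckChar hp e₀ ψ)).homology i

/-- The characteristic variety `V^i_d(X, 𝕜)`: the characters `ρ : π₁(X) → 𝕜ˣ` such that
`dim H_i(X, 𝕜_ρ) ≥ d`. -/
def charVariety {p : E → X} (hp : Continuous p) (e₀ : E) (𝕜 : Type w) [Field 𝕜] (i d : ℕ) :
    Set (FundamentalGroup X (p e₀) →* 𝕜ˣ) :=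
  {ρ | (d : Cardinal) ≤
    Module.rank 𝕜 (twistedHomology hp e₀ ((Units.coeHom 𝕜).comp ρ) i)}

end Twisted

/-! ### Exponential tangent cones -/

section ExpCone

variable {G : Type u} [Group G]

/-- The character `exp(z) : G → ℂˣ` of an additive character `z : G → ℂ`. -/
def expChar (z : Additive G →+ ℂ) : G →* ℂˣ where
  toFun g := Units.mk0 (Complex.exp (z (Additive.ofMul g))) (Complex.exp_ne_zero _)
  map_one' := by ext; simp
  map_mul' a b := by ext; simp [Complex.exp_add]

/-- The exponential tangent cone `τ₁(W)` at `1` of a set of characters, as a subset of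
`H¹(G, ℂ) = Hom(G, ℂ)`. -/
def expTangentCone (W : Set (G →* ℂˣ)) : Set (Additive G →+ ℂ) :=
  {z | ∀ t : ℂ, expChar ((AddMonoidHom.mulLeft t).comp z) ∈ W}

/-- The real points `τ₁^ℝ(W) = τ₁(W) ∩ H¹(G, ℝ)`. -/
def realExpTangentCone (W : Set (G →* ℂˣ)) : Set (Additive G →+ ℝ) :=
  {χ | Complex.ofRealHom.toAddMonoidHom.comp χ ∈ expTangentCone W}

end ExpCone

/-! ### The rational Novikov ring -/

section Novikov

variable (Γ : AddSubgroup ℝ)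

/-- `p ∈ ℤΓ` is monic if the greatest element of its support is `0`, with coefficient `1`. -/
def IsNovikovMonic (p : AddMonoidAlgebra ℤ Γ) : Prop :=
  p.coeff 0 = 1 ∧ ∀ γ ∈ p.coeff.support, γ ≤ 0

lemma IsNovikovMonic.mul {p q : AddMonoidAlgebra ℤ Γ} (hp : IsNovikovMonic Γ p)
    (hq : IsNovikovMonic Γ q) : IsNovikovMonic Γ (p * q) := by
  classical
  constructor
  · rw [AddMonoidAlgebra.coeff_mul, Finsupp.sum,
      Finset.sum_eq_single_of_mem 0 (by simp [hp.1]), Finsupp.sum,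
      Finset.sum_eq_single_of_mem 0 (by simp [hq.1])]
    · simp [hp.1, hq.1]
    · intro b hb hb0
      simp [hb0]
    · intro a ha ha0
      refine Finset.sum_eq_zero fun b hb => if_neg fun h => ha0 ?_
      exact le_antisymm (hp.2 a ha) (by have := hq.2 b hb; rw [← h]; exact add_le_of_nonpos_right this)
  · intro γ hγ
    by_contra hlt
    refine Finsupp.mem_support_iff.mp hγ ?_
    rw [AddMonoidAlgebra.coeff_mul]
    refine Finset.sum_eq_zero fun a ha => Finset.sum_eq_zero fun b hb => if_neg ?_
    rintro rfl
    exact hlt (add_nonpos (hp.2 a ha) (hq.2 b hb))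

/-- The multiplicative set of monic elements of `ℤΓ`. -/
def novikovMonic : Submonoid (AddMonoidAlgebra ℤ Γ) where
  carrier := {p | IsNovikovMonic Γ p}
  one_mem' := by
    refine ⟨by simp, fun γ hγ => ?_⟩
    by_contra h
    refine Finsupp.mem_support_iff.mp hγ ?_
    rw [AddMonoidAlgebra.one_def, AddMonoidAlgebra.coeff_single, Finsupp.single_apply,
      if_neg (fun h0 => h h0.symm.le)]
  mul_mem' hp hq := hp.mul Γ hq

/-- The rational Novikov ring of `Γ ⊆ ℝ`. -/
abbrev RationalNovikovRing : Type :=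
  Localization (novikovMonic Γ)

end Novikov

/-- The homomorphism from `G` to the rational Novikov ring of `Γ = im χ` that sends `g` to the
group element `χ g ∈ Γ`. -/
def novikovChar {G : Type u} [Group G] (χ : Additive G →+ ℝ) :
    G →* RationalNovikovRing χ.range where
  toFun g := algebraMap (AddMonoidAlgebra ℤ χ.range) _
    (AddMonoidAlgebra.single (χ.rangeRestrict (Additive.ofMul g)) 1)
  map_one' := by
    rw [ofMul_one, map_zero, ← AddMonoidAlgebra.one_def, map_one]
  map_mul' a b := by
    rw [ofMul_mul, map_add, ← map_mul, AddMonoidAlgebra.single_mul_single, mul_one]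

/-- The Novikov Betti number `b_i(X, χ)`, the rank of `H_i(X, R)` over the rational Novikov
ring `R` of the image of `χ`. -/
def novikovBetti {X : Type u} [TopologicalSpace X] [T2Space X] [CWComplex (Set.univ : Set X)]
    {E : Type u} [TopologicalSpace E] [SimplyConnectedSpace E] {p : E → X} (hp : Continuous p)
    (e₀ : E) (χ : Additive (FundamentalGroup X (p e₀)) →+ ℝ) (i : ℕ) : Cardinal.{u} :=
  Module.rank (RationalNovikovRing χ.range) (twistedHomology hp e₀ (novikovChar χ) i)

end NovikovTau

end

/-!
# Exponential tangent cones and Novikov Betti numbers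

Let `D` be the deck group of the universal cover, `Γ = im χ` and `A = ℤΓ`. Both coefficient systems
of the theorem are obtained from the group ring of `D` through `A`: the Novikov ring `R` is a
localization of `A`, and the character `exp(tχ)` is the composite of `D → Γ` with the evaluation
`expEval Γ t : A → ℂ`, `γ ↦ exp(tγ)`.

In a degree `n` in which `X` has finitely many cells, `C_n(E; ℤ)` is a free `ℤD`-module with one
basis element for each `n`-cell of `X` (`exists_basis_cellChain`). Hence, over a domain `S`, the
rank of `H_n(X, S)` is the number of `n`-cells minus the ranks of the boundary maps from
degrees `n + 1` and `n`, and these ranks are the ranks over `S` of the images of fixed sets of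
vectors with entries in `A`. Such a rank is the largest size of a non-vanishing minor, so it can
only drop when `A → ℂ` replaces the embedding `A → R`, and it does not drop if one
non-zero element `δ` of `A` stays non-zero in `ℂ` (`imageRank_le_of_injective`,
`exists_imageRank_le`). Therefore the Betti numbers over `R` are at most those of `exp(tχ)`,
for every `t`. Conversely, since the functions `t ↦ exp(tγ)` are linearly independent
(`exists_expEval_ne_zero`), there is a `t` with `expEval Γ t δ ≠ 0`, and for this `t` the Betti
numbers agree in all degrees `≤ q`. So the Novikov Betti numbers vanish up to degree `q` exactly
when some `exp(tχ)` avoids the characteristic varieties up to degree `q`.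

The freeness of the cellular chains is a statement about relative singular homology. The preimage
in `E` of the `(n - 1)`-skeleton is a deformation retract of the preimage `U` of the `n`-skeleton
minus the centres of the `n`-cells, because the radial deformation downstairs lifts through the
covering map (`quasiIso_inclTop_puncturedCover`). The interior of each `n`-cell lifts to `E`, as it
is simply connected, and the deck group permutes its lifts simply transitively. Excision
(`bijective_sumHomologyMap_relMap`), which rests on the barycentric subdivision of singular chains
(`SingChain.exists_sub_bd_mem_small`), identifies the homology of the preimage of the `n`-skeleton
relative to `U` with a direct sum of copies of `H_n(V, V ∖ 0)`, where `V` is a real vector space of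
dimension `n`; and `H_n(V, V ∖ 0) ≅ ℤ` (`exists_localHomology`).
-/

noncomputable section

namespace NovikovTau

/-! ### Barycentric subdivision of ordered affine chains -/

/-- Augmented ordered chains on a set `K`: the free abelian group on `n`-tuples of points,
so that a tuple of length `n + 1` is an `n`-simplex and the empty tuple spans the augmentation. -/
abbrev TupleChain (K : Type*) (n : ℕ) : Type _ := (Fin n → K) →₀ ℤ

namespace TupleChain

variable {K K' : Type*} {n : ℕ}

/-- The alternating sum of the faces of a tuple. -/
def bd (n : ℕ) : TupleChain K (n + 1) →ₗ[ℤ] TupleChain K n :=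
  Finsupp.linearCombination ℤ fun v : Fin (n + 1) → K =>
    ∑ i : Fin (n + 1), (-1 : ℤ) ^ (i : ℕ) • Finsupp.single (v ∘ i.succAbove) (1 : ℤ)

/-- The cone with apex `b`: it puts `b` in front of each tuple. -/
def cone (b : K) (n : ℕ) : TupleChain K n →ₗ[ℤ] TupleChain K (n + 1) :=
  Finsupp.lmapDomain ℤ ℤ fun w => (Fin.cons b w : Fin (n + 1) → K)

lemma bd_single (v : Fin (n + 1) → K) :
    bd n (Finsupp.single v 1) =
      ∑ i : Fin (n + 1), (-1 : ℤ) ^ (i : ℕ) • Finsupp.single (v ∘ i.succAbove) (1 : ℤ) := by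
  simp [bd]

lemma cone_single (b : K) (w : Fin n → K) :
    cone b n (Finsupp.single w 1) = Finsupp.single (Fin.cons b w : Fin (n + 1) → K) 1 := by
  simp [cone]

lemma ext_single {M : Type*} [AddCommGroup M] {f g : TupleChain K n →ₗ[ℤ] M}
    (h : ∀ v, f (Finsupp.single v 1) = g (Finsupp.single v 1)) : f = g :=
  Finsupp.lhom_ext' fun v => LinearMap.ext_ring (h v)

lemma bd_cone_zero (b : K) (c : TupleChain K 0) : bd 0 (cone b 0 c) = c := by
  refine DFunLike.congr_fun (f := bd 0 ∘ₗ cone b 0) (g := LinearMap.id) (ext_single fun v => ?_) c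
  simp only [LinearMap.comp_apply, cone_single, bd_single, LinearMap.id_apply]
  simp

lemma bd_cone_succ (b : K) (c : TupleChain K (n + 1)) :
    bd (n + 1) (cone b (n + 1) c) = c - cone b n (bd n c) := by
  refine DFunLike.congr_fun (f := bd (n + 1) ∘ₗ cone b (n + 1))
    (g := LinearMap.id - cone b n ∘ₗ bd n) (ext_single fun v => ?_) c
  simp only [LinearMap.comp_apply, LinearMap.sub_apply, cone_single, bd_single,
    LinearMap.id_apply, map_sum, map_zsmul]
  rw [Fin.sum_univ_succ, sub_eq_add_neg, ← Finset.sum_neg_distrib]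
  congr 1
  · simp
  · refine Finset.sum_congr rfl fun i _ => ?_
    rw [Fin.val_succ, pow_succ, mul_neg_one, neg_smul]
    congr 3
    funext j
    refine Fin.cases ?_ (fun j => ?_) j <;> simp

lemma bd_bd (c : TupleChain K (n + 2)) : bd n (bd (n + 1) c) = 0 := by
  induction n with
  | zero =>
    refine DFunLike.congr_fun (f := bd 0 ∘ₗ bd 1) (g := 0) (ext_single fun v => ?_) c
    rw [← Fin.cons_self_tail v, ← cone_single, LinearMap.comp_apply, bd_cone_succ, map_sub,
      bd_cone_zero, sub_self, LinearMap.zero_apply]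
  | succ n ih =>
    refine DFunLike.congr_fun (f := bd (n + 1) ∘ₗ bd (n + 2)) (g := 0) (ext_single fun v => ?_) c
    rw [← Fin.cons_self_tail v, ← cone_single, LinearMap.comp_apply, bd_cone_succ, map_sub,
      bd_cone_succ, ih, map_zero, sub_zero, sub_self, LinearMap.zero_apply]

/-- The map induced on chains by a map of sets. -/
def map (f : K → K') (n : ℕ) : TupleChain K n →ₗ[ℤ] TupleChain K' n :=
  Finsupp.lmapDomain ℤ ℤ fun v => f ∘ v

lemma map_single (f : K → K') (v : Fin n → K) :
    map f n (Finsupp.single v 1) = Finsupp.single (f ∘ v) 1 := by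
  simp [map]

lemma map_bd (f : K → K') (c : TupleChain K (n + 1)) : map f n (bd n c) = bd n (map f (n + 1) c) :=
  DFunLike.congr_fun (f := map f n ∘ₗ bd n) (g := bd n ∘ₗ map f (n + 1)) (ext_single fun v => by
    simp only [LinearMap.comp_apply, bd_single, map_single, map_sum, map_zsmul]
    rfl) c

lemma map_cone (f : K → K') (b : K) (c : TupleChain K n) :
    map f (n + 1) (cone b n c) = cone (f b) n (map f n c) :=
  DFunLike.congr_fun (f := map f (n + 1) ∘ₗ cone b n) (g := cone (f b) n ∘ₗ map f n)
    (ext_single fun v => by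
      simp only [LinearMap.comp_apply, cone_single, map_single]
      congr 1
      funext j
      refine Fin.cases ?_ (fun j => ?_) j <;> simp) c

variable (β : ∀ n, (Fin (n + 1) → K) → K)

/-- Subdivision with respect to a choice `β` of barycentres. -/
def sd : ∀ n, TupleChain K n →ₗ[ℤ] TupleChain K n
  | 0 => LinearMap.id
  | n + 1 => Finsupp.linearCombination ℤ fun v : Fin (n + 1) → K =>
      cone (β n v) n (sd n (bd n (Finsupp.single v 1)))

/-- The chain homotopy from the identity to subdivision. -/
def sdHomotopy : ∀ n, TupleChain K n →ₗ[ℤ] TupleChain K (n + 1)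
  | 0 => 0
  | n + 1 => Finsupp.linearCombination ℤ fun v : Fin (n + 1) → K =>
      cone (β n v) (n + 1) (Finsupp.single v 1 - sdHomotopy n (bd n (Finsupp.single v 1)))

lemma sd_single (v : Fin (n + 1) → K) : sd β (n + 1) (Finsupp.single v 1) =
    cone (β n v) n (sd β n (bd n (Finsupp.single v 1))) := by
  simp [sd]

lemma sdHomotopy_single (v : Fin (n + 1) → K) : sdHomotopy β (n + 1) (Finsupp.single v 1) =
    cone (β n v) (n + 1)
      (Finsupp.single v 1 - sdHomotopy β n (bd n (Finsupp.single v 1))) := by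
  simp [sdHomotopy]

lemma bd_sd (c : TupleChain K (n + 1)) : bd n (sd β (n + 1) c) = sd β n (bd n c) := by
  induction n with
  | zero =>
    refine DFunLike.congr_fun (f := bd 0 ∘ₗ sd β 1) (g := sd β 0 ∘ₗ bd 0)
      (ext_single fun v => ?_) c
    simp only [LinearMap.comp_apply, sd_single, bd_cone_zero]
  | succ n ih =>
    refine DFunLike.congr_fun (f := bd (n + 1) ∘ₗ sd β (n + 2)) (g := sd β (n + 1) ∘ₗ bd (n + 1))
      (ext_single fun v => ?_) c
    simp only [LinearMap.comp_apply]
    rw [sd_single, bd_cone_succ, ih, bd_bd, map_zero, map_zero, sub_zero]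

lemma bd_sdHomotopy (c : TupleChain K (n + 1)) :
    bd (n + 1) (sdHomotopy β (n + 1) c) + sdHomotopy β n (bd n c) = c - sd β (n + 1) c := by
  induction n with
  | zero =>
    refine DFunLike.congr_fun (f := bd 1 ∘ₗ sdHomotopy β 1 + sdHomotopy β 0 ∘ₗ bd 0)
      (g := LinearMap.id - sd β 1) (ext_single fun v => ?_) c
    simp only [LinearMap.comp_apply, LinearMap.add_apply, LinearMap.sub_apply,
      LinearMap.id_apply, sdHomotopy_single, bd_cone_succ, sd_single]
    simp [sdHomotopy, sd]
  | succ n ih =>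
    refine DFunLike.congr_fun (f := bd (n + 2) ∘ₗ sdHomotopy β (n + 2) +
      sdHomotopy β (n + 1) ∘ₗ bd (n + 1))
      (g := LinearMap.id - sd β (n + 2)) (ext_single fun v => ?_) c
    simp only [LinearMap.comp_apply, LinearMap.add_apply, LinearMap.sub_apply,
      LinearMap.id_apply, sdHomotopy_single, bd_cone_succ]
    have h := ih (bd (n + 1) (Finsupp.single v 1))
    rw [bd_bd, map_zero, add_zero] at h
    rw [map_sub (bd (n + 1)), h, sub_sub_cancel, sd_single]
    abel

variable {β} {β' : ∀ n, (Fin (n + 1) → K') → K'} {f : K → K'}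

lemma map_sd (hf : ∀ n v, f (β n v) = β' n (f ∘ v)) (c : TupleChain K n) :
    map f n (sd β n c) = sd β' n (map f n c) := by
  induction n with
  | zero => rfl
  | succ n ih =>
    refine DFunLike.congr_fun (f := map f (n + 1) ∘ₗ sd β (n + 1))
      (g := sd β' (n + 1) ∘ₗ map f (n + 1)) (ext_single fun v => ?_) c
    simp only [LinearMap.comp_apply, sd_single, map_single]
    rw [map_cone, ih, map_bd, map_single, hf]

lemma map_sdHomotopy (hf : ∀ n v, f (β n v) = β' n (f ∘ v)) (c : TupleChain K n) :
    map f (n + 1) (sdHomotopy β n c) = sdHomotopy β' n (map f n c) := by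
  induction n with
  | zero => simp [sdHomotopy]
  | succ n ih =>
    refine DFunLike.congr_fun (f := map f (n + 2) ∘ₗ sdHomotopy β (n + 1))
      (g := sdHomotopy β' (n + 1) ∘ₗ map f (n + 1)) (ext_single fun v => ?_) c
    simp only [LinearMap.comp_apply, sdHomotopy_single, map_single]
    rw [map_cone, map_sub, ih, map_bd, map_single, hf]

section Mesh

variable [PseudoMetricSpace K]

/-- Tuples contained in every closed ball that contains the tuple `v`. -/
def ballHull (v : Fin n → K) : Set K :=
  {x | ∀ y R, (∀ j, dist (v j) y ≤ R) → dist x y ≤ R}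

/-- A simplex of the subdivision stays within the hull of the original simplex and its diameter
is smaller by the factor `n / (n + 1)`. -/
lemma sd_mem_supported {n : ℕ} (hβ : ∀ n (v : Fin (n + 1) → K) y,
      dist (β n v) y ≤ ∑ i, ((n : ℝ) + 1)⁻¹ * dist (v i) y)
    (v : Fin (n + 1) → K) (D : ℝ) (hD : ∀ i j, dist (v i) (v j) ≤ D) :
    sd β (n + 1) (Finsupp.single v 1) ∈ Finsupp.supported ℤ ℤ
      {w : Fin (n + 1) → K | (∀ i, w i ∈ ballHull v) ∧
        ∀ i j, dist (w i) (w j) ≤ (n : ℝ) / (n + 1) * D} := by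
  have hD0 : 0 ≤ D := dist_nonneg.trans (hD 0 0)
  have hb : β n v ∈ ballHull v := by
    intro y R h
    refine (hβ n v y).trans ((Finset.sum_le_sum fun i _ =>
      mul_le_mul_of_nonneg_left (h i) (by positivity)).trans ?_)
    rw [Finset.sum_const, Finset.card_univ, Fintype.card_fin, nsmul_eq_mul]
    push_cast
    rw [← mul_assoc, mul_inv_cancel₀ (by positivity), one_mul]
  have hbv : ∀ j, dist (v j) (β n v) ≤ (n : ℝ) / (n + 1) * D := by
    intro j
    rw [dist_comm]
    refine (hβ n v (v j)).trans ?_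
    rw [Fin.sum_univ_succAbove _ j, dist_self, mul_zero, zero_add]
    refine (Finset.sum_le_sum fun i _ =>
      mul_le_mul_of_nonneg_left (hD (j.succAbove i) j) (by positivity)).trans ?_
    rw [Finset.sum_const, Finset.card_univ, Fintype.card_fin, nsmul_eq_mul]
    exact le_of_eq (by ring)
  -- the cone over a small simplex in the hull of `v` is small
  have key : sd β n (bd n (Finsupp.single v 1)) ∈ Finsupp.supported ℤ ℤ
      {w : Fin n → K | (∀ i, w i ∈ ballHull v) ∧
        ∀ i j, dist (w i) (w j) ≤ (n : ℝ) / (n + 1) * D} := by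
    cases n with
    | zero =>
      intro w _
      exact ⟨fun i => i.elim0, fun i => i.elim0⟩
    | succ n =>
      rw [bd_single, map_sum]
      refine Submodule.sum_mem _ fun i _ => ?_
      rw [map_zsmul]
      refine Submodule.smul_mem _ _ (Finsupp.supported_mono ?_
        (sd_mem_supported hβ (v ∘ i.succAbove) D fun _ _ => hD _ _))
      rintro w ⟨h1, h2⟩
      refine ⟨fun j y R h => h1 j y R fun _ => h _, fun a b => (h2 a b).trans ?_⟩
      refine mul_le_mul_of_nonneg_right ?_ hD0
      rw [div_le_div_iff₀ (by positivity) (by positivity)]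
      push_cast
      nlinarith
  rw [sd_single]
  have hmap : Finsupp.supported ℤ ℤ {w : Fin n → K | (∀ i, w i ∈ ballHull v) ∧
        ∀ i j, dist (w i) (w j) ≤ (n : ℝ) / (n + 1) * D} ≤
      (Finsupp.supported ℤ ℤ {w : Fin (n + 1) → K | (∀ i, w i ∈ ballHull v) ∧
        ∀ i j, dist (w i) (w j) ≤ (n : ℝ) / (n + 1) * D}).comap (cone (β n v) n) := by
    rw [Finsupp.supported_eq_span_single, Submodule.span_le]
    rintro _ ⟨w, ⟨h1, h2⟩, rfl⟩
    simp only [Submodule.comap_coe, Set.mem_preimage, SetLike.mem_coe, cone_single]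
    refine Finsupp.single_mem_supported ℤ _ ⟨fun i => ?_, fun i j => ?_⟩
    · refine Fin.cases ?_ (fun i => ?_) i
      · simpa using hb
      · simpa using h1 i
    · have h3 : ∀ i, dist (w i) (β n v) ≤ (n : ℝ) / (n + 1) * D := fun i =>
        h1 i _ _ hbv
      refine Fin.cases ?_ (fun i => ?_) i <;> refine Fin.cases ?_ (fun j => ?_) j
      · simp only [dist_self]; positivity
      · simpa [dist_comm] using h3 j
      · simpa using h3 i
      · simpa using h2 i j
  exact hmap key

lemma iterate_sd_mem_supported (hβ : ∀ n (v : Fin (n + 1) → K) y,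
      dist (β n v) y ≤ ∑ i, ((n : ℝ) + 1)⁻¹ * dist (v i) y)
    (v : Fin (n + 1) → K) (D : ℝ) (hD : ∀ i j, dist (v i) (v j) ≤ D) (N : ℕ) :
    (sd β (n + 1) ^ N) (Finsupp.single v 1) ∈ Finsupp.supported ℤ ℤ
      {w : Fin (n + 1) → K | ∀ i j, dist (w i) (w j) ≤ ((n : ℝ) / (n + 1)) ^ N * D} := by
  induction N with
  | zero => exact Finsupp.single_mem_supported ℤ _ (by simpa using hD)
  | succ N ih =>
    rw [pow_succ' (sd β (n + 1)), Module.End.mul_apply]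
    have hmap : Finsupp.supported ℤ ℤ
        {w : Fin (n + 1) → K | ∀ i j, dist (w i) (w j) ≤ ((n : ℝ) / (n + 1)) ^ N * D} ≤
        (Finsupp.supported ℤ ℤ {w : Fin (n + 1) → K |
          ∀ i j, dist (w i) (w j) ≤ ((n : ℝ) / (n + 1)) ^ (N + 1) * D}).comap (sd β (n + 1)) := by
      conv_lhs => rw [Finsupp.supported_eq_span_single]
      rw [Submodule.span_le]
      rintro _ ⟨w, hw, rfl⟩
      refine Finsupp.supported_mono ?_ (sd_mem_supported hβ w _ hw)
      rintro w' ⟨-, h⟩ i j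
      exact (h i j).trans_eq (by ring)
    exact hmap ih

end Mesh

end TupleChain


/-! ### Small singular chains -/

/-- The affine map of simplices that sends the `i`-th vertex to `v i`. -/
def affineSimplex {ι κ : Type*} [Fintype ι] [Fintype κ] (v : ι → stdSimplex ℝ κ) :
    C(stdSimplex ℝ ι, stdSimplex ℝ κ) where
  toFun x := ⟨∑ i, x i • (v i : κ → ℝ), (convex_stdSimplex ℝ κ).sum_mem (fun i _ => x.2.1 i) x.2.2
    fun i _ => (v i).2⟩
  continuous_toFun := by
    refine Continuous.subtype_mk (continuous_finsetSum _ fun i _ => ?_) _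
    exact ((continuous_apply i).comp continuous_subtype_val).smul continuous_const

section AffineSimplex

variable {ι κ μ : Type*} [Fintype ι] [Fintype κ] [Fintype μ]

lemma affineSimplex_coe (v : ι → stdSimplex ℝ κ) (x : stdSimplex ℝ ι) :
    (affineSimplex v x : κ → ℝ) = ∑ i, x i • (v i : κ → ℝ) := rfl

lemma affineSimplex_apply (v : ι → stdSimplex ℝ κ) (x : stdSimplex ℝ ι) (k : κ) :
    affineSimplex v x k = ∑ i, x i * v i k := by
  have h := congrFun (affineSimplex_coe v x) k
  simpa using h

lemma affineSimplex_comp (w : κ → stdSimplex ℝ μ) (v : ι → stdSimplex ℝ κ) (x : stdSimplex ℝ ι) :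
    affineSimplex w (affineSimplex v x) = affineSimplex (affineSimplex w ∘ v) x := by
  ext m
  simp only [affineSimplex_apply, Function.comp_apply, Finset.sum_mul, Finset.mul_sum]
  rw [Finset.sum_comm]
  simp only [mul_assoc]

lemma affineSimplex_vertex [DecidableEq κ] (f : ι → κ) :
    affineSimplex (fun i => stdSimplex.vertex (S := ℝ) (f i)) =
      ⟨stdSimplex.map f, stdSimplex.continuous_map f⟩ := by
  ext x k
  simp only [affineSimplex_apply, ContinuousMap.coe_mk, stdSimplex.map_coe, stdSimplex.vertex_coe,
    FunOnFinite.linearMap_apply_apply]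
  rw [Finset.sum_filter]
  refine Finset.sum_congr rfl fun i _ => ?_
  by_cases h : f i = k
  · subst h; simp
  · simp [h]

lemma affineSimplex_apply_vertex [DecidableEq ι] (v : ι → stdSimplex ℝ κ) (i : ι) :
    affineSimplex v (stdSimplex.vertex i) = v i := by
  ext k
  simp [affineSimplex_apply, stdSimplex.vertex_coe, Pi.single_apply]

lemma dist_affineSimplex_le (v : ι → stdSimplex ℝ κ) (x : stdSimplex ℝ ι) (y : stdSimplex ℝ κ) :
    dist (affineSimplex v x) y ≤ ∑ i, x i * dist (v i) y := by
  have hy : (y : κ → ℝ) = ∑ i, x i • (y : κ → ℝ) := by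
    rw [← Finset.sum_smul, stdSimplex.sum_eq_one, one_smul]
  have h : dist (affineSimplex v x) y =
      ‖∑ i, x i • (v i : κ → ℝ) - ∑ i, x i • (y : κ → ℝ)‖ := by
    rw [← hy]
    exact dist_eq_norm (E := κ → ℝ) _ _
  rw [h, ← Finset.sum_sub_distrib]
  refine (norm_sum_le _ _).trans (Finset.sum_le_sum fun i _ => ?_)
  rw [← smul_sub, norm_smul, Real.norm_of_nonneg (stdSimplex.zero_le x i), ← dist_eq_norm]
  rfl

/-- The barycentre of a tuple of points of a simplex. -/
def tupleBary (n : ℕ) (v : Fin (n + 1) → stdSimplex ℝ κ) : stdSimplex ℝ κ :=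
  affineSimplex v stdSimplex.barycenter

lemma dist_tupleBary_le (n : ℕ) (v : Fin (n + 1) → stdSimplex ℝ κ) (y : stdSimplex ℝ κ) :
    dist (tupleBary n v) y ≤ ∑ i, ((n : ℝ) + 1)⁻¹ * dist (v i) y := by
  refine (dist_affineSimplex_le _ _ _).trans_eq (Finset.sum_congr rfl fun i _ => ?_)
  have h : stdSimplex.barycenter (𝕜 := ℝ) i = ((n : ℝ) + 1)⁻¹ :=
    (stdSimplex.barycenter_apply i).trans (by simp)
  rw [h]

lemma affineSimplex_tupleBary (w : κ → stdSimplex ℝ μ) (n : ℕ)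
    (v : Fin (n + 1) → stdSimplex ℝ κ) :
    affineSimplex w (tupleBary n v) = tupleBary n (affineSimplex w ∘ v) :=
  affineSimplex_comp _ _ _

end AffineSimplex

/-- The standard simplex of dimension `n`. -/
abbrev Simp (n : ℕ) : Type := stdSimplex ℝ (Fin (n + 1))

/-- The `i`-th face inclusion. -/
def faceMap {n : ℕ} (i : Fin (n + 2)) : C(Simp n, Simp (n + 1)) :=
  ⟨stdSimplex.map i.succAbove, stdSimplex.continuous_map _⟩

/-- Singular chains of `X` as formal integral combinations of singular simplices. -/
abbrev SingChain (X : Type*) [TopologicalSpace X] (n : ℕ) : Type _ := C(Simp n, X) →₀ ℤ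

namespace SingChain

variable {X Y Z : Type*} [TopologicalSpace X] [TopologicalSpace Y] [TopologicalSpace Z] {n m : ℕ}

lemma ext_single {M : Type*} [AddCommGroup M] [Module ℤ M] {f g : SingChain X n →ₗ[ℤ] M}
    (h : ∀ v, f (Finsupp.single v 1) = g (Finsupp.single v 1)) : f = g :=
  Finsupp.lhom_ext' fun v => LinearMap.ext_ring (h v)

/-- The boundary of singular chains. -/
def bd (n : ℕ) : SingChain X (n + 1) →ₗ[ℤ] SingChain X n :=
  Finsupp.linearCombination ℤ fun σ : C(Simp (n + 1), X) =>
    ∑ i : Fin (n + 2), (-1 : ℤ) ^ (i : ℕ) • Finsupp.single (σ.comp (faceMap i)) (1 : ℤ)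

lemma bd_single (σ : C(Simp (n + 1), X)) : bd n (Finsupp.single σ 1) =
    ∑ i : Fin (n + 2), (-1 : ℤ) ^ (i : ℕ) • Finsupp.single (σ.comp (faceMap i)) (1 : ℤ) := by
  simp [bd]

/-- Functoriality of singular chains. -/
def map (f : C(X, Y)) (n : ℕ) : SingChain X n →ₗ[ℤ] SingChain Y n :=
  Finsupp.lmapDomain ℤ ℤ fun σ => f.comp σ

lemma map_single (f : C(X, Y)) (σ : C(Simp n, X)) :
    map f n (Finsupp.single σ 1) = Finsupp.single (f.comp σ) 1 := by
  simp [map]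

lemma map_comp (g : C(Y, Z)) (f : C(X, Y)) (c : SingChain X n) :
    map g n (map f n c) = map (g.comp f) n c :=
  DFunLike.congr_fun (f := map g n ∘ₗ map f n) (g := map (g.comp f) n)
    (ext_single fun v => by
      simp only [LinearMap.comp_apply, map_single]
      rfl) c

lemma map_id (c : SingChain X n) : map (ContinuousMap.id X) n c = c :=
  Finsupp.mapDomain_id

lemma map_bd (f : C(X, Y)) (c : SingChain X (n + 1)) : map f n (bd n c) = bd n (map f (n + 1) c) :=
  DFunLike.congr_fun (f := map f n ∘ₗ bd n) (g := bd n ∘ₗ map f (n + 1)) (ext_single fun v => by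
    simp only [LinearMap.comp_apply, bd_single, map_single, map_sum, map_zsmul]
    rfl) c

/-- The singular chain of a chain of tuples of points of a simplex. -/
def ofTuple (m n : ℕ) : TupleChain (Simp m) (n + 1) →ₗ[ℤ] SingChain (Simp m) n :=
  Finsupp.lmapDomain ℤ ℤ affineSimplex

lemma ofTuple_single (v : Fin (n + 1) → Simp m) :
    ofTuple m n (Finsupp.single v 1) = Finsupp.single (affineSimplex v) 1 := by
  simp [ofTuple]

lemma affineSimplex_comp_faceMap (v : Fin (n + 2) → Simp m) (i : Fin (n + 2)) :
    (affineSimplex v).comp (faceMap i) = affineSimplex (v ∘ i.succAbove) := by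
  rw [faceMap, ← affineSimplex_vertex]
  ext1 x
  rw [ContinuousMap.comp_apply, affineSimplex_comp]
  congr 2
  funext j
  exact affineSimplex_apply_vertex _ _

lemma ofTuple_bd (c : TupleChain (Simp m) (n + 2)) :
    ofTuple m n (TupleChain.bd (n + 1) c) = bd n (ofTuple m (n + 1) c) :=
  DFunLike.congr_fun (f := ofTuple m n ∘ₗ TupleChain.bd (n + 1)) (g := bd n ∘ₗ ofTuple m (n + 1))
    (TupleChain.ext_single fun v => by
      simp only [LinearMap.comp_apply, TupleChain.bd_single, ofTuple_single, map_sum, map_zsmul,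
        bd_single, affineSimplex_comp_faceMap]) c

lemma map_ofTuple (w : Fin (m + 1) → Simp n) {k : ℕ} (c : TupleChain (Simp m) (k + 1)) :
    map (affineSimplex w) k (ofTuple m k c) =
      ofTuple n k (TupleChain.map (affineSimplex w) (k + 1) c) :=
  DFunLike.congr_fun (f := map (affineSimplex w) k ∘ₗ ofTuple m k)
    (g := ofTuple n k ∘ₗ TupleChain.map (affineSimplex w) (k + 1))
    (TupleChain.ext_single fun v => by
      simp only [LinearMap.comp_apply, ofTuple_single, map_single, TupleChain.map_single]
      congr 1
      ext1 x
      exact affineSimplex_comp _ _ _) c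

/-- The vertices of the standard simplex. -/
def vertices (n : ℕ) : Fin (n + 1) → Simp n := fun i => stdSimplex.vertex i

lemma affineSimplex_vertices (n : ℕ) : affineSimplex (vertices n) = ContinuousMap.id _ := by
  refine (affineSimplex_vertex id).trans ?_
  ext1 x
  exact stdSimplex.map_id_apply x

lemma affineSimplex_comp_vertices (v : Fin (n + 1) → Simp m) :
    affineSimplex v ∘ vertices n = v :=
  funext fun _ => affineSimplex_apply_vertex _ _

/-- Barycentric subdivision of singular chains. -/
def sd (n : ℕ) : SingChain X n →ₗ[ℤ] SingChain X n :=
  Finsupp.linearCombination ℤ fun σ : C(Simp n, X) =>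
    map σ n (ofTuple n n (TupleChain.sd tupleBary (n + 1) (Finsupp.single (vertices n) 1)))

/-- The chain homotopy from the identity to barycentric subdivision. -/
def sdHomotopy (n : ℕ) : SingChain X n →ₗ[ℤ] SingChain X (n + 1) :=
  Finsupp.linearCombination ℤ fun σ : C(Simp n, X) =>
    map σ (n + 1) (ofTuple n (n + 1)
      (TupleChain.sdHomotopy tupleBary (n + 1) (Finsupp.single (vertices n) 1)))

lemma sd_single (σ : C(Simp n, X)) : sd n (Finsupp.single σ 1) =
    map σ n (ofTuple n n (TupleChain.sd tupleBary (n + 1) (Finsupp.single (vertices n) 1))) := by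
  simp [sd]

lemma sdHomotopy_single (σ : C(Simp n, X)) : sdHomotopy n (Finsupp.single σ 1) =
    map σ (n + 1) (ofTuple n (n + 1)
      (TupleChain.sdHomotopy tupleBary (n + 1) (Finsupp.single (vertices n) 1))) := by
  simp [sdHomotopy]

lemma map_sd (f : C(X, Y)) (c : SingChain X n) : map f n (sd n c) = sd n (map f n c) :=
  DFunLike.congr_fun (f := map f n ∘ₗ sd n) (g := sd n ∘ₗ map f n) (ext_single fun v => by
    simp only [LinearMap.comp_apply, sd_single, map_single, map_comp]) c

lemma map_sdHomotopy (f : C(X, Y)) (c : SingChain X n) :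
    map f (n + 1) (sdHomotopy n c) = sdHomotopy n (map f n c) :=
  DFunLike.congr_fun (f := map f (n + 1) ∘ₗ sdHomotopy n) (g := sdHomotopy n ∘ₗ map f n)
    (ext_single fun v => by
      simp only [LinearMap.comp_apply, sdHomotopy_single, map_single, map_comp]) c

lemma sd_ofTuple (c : TupleChain (Simp m) (n + 1)) :
    sd n (ofTuple m n c) = ofTuple m n (TupleChain.sd tupleBary (n + 1) c) :=
  DFunLike.congr_fun (f := sd n ∘ₗ ofTuple m n)
    (g := ofTuple m n ∘ₗ TupleChain.sd tupleBary (n + 1))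
    (TupleChain.ext_single fun v => by
      simp only [LinearMap.comp_apply, ofTuple_single, sd_single]
      rw [map_ofTuple, TupleChain.map_sd (affineSimplex_tupleBary v), TupleChain.map_single,
        affineSimplex_comp_vertices]) c

lemma sdHomotopy_ofTuple (c : TupleChain (Simp m) (n + 1)) :
    sdHomotopy n (ofTuple m n c) = ofTuple m (n + 1) (TupleChain.sdHomotopy tupleBary (n + 1) c) :=
  DFunLike.congr_fun (f := sdHomotopy n ∘ₗ ofTuple m n)
    (g := ofTuple m (n + 1) ∘ₗ TupleChain.sdHomotopy tupleBary (n + 1))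
    (TupleChain.ext_single fun v => by
      simp only [LinearMap.comp_apply, ofTuple_single, sdHomotopy_single]
      rw [map_ofTuple, TupleChain.map_sdHomotopy (affineSimplex_tupleBary v),
        TupleChain.map_single, affineSimplex_comp_vertices]) c

lemma single_eq_map (σ : C(Simp n, X)) : Finsupp.single σ (1 : ℤ) =
    map σ n (ofTuple n n (Finsupp.single (vertices n) 1)) := by
  rw [ofTuple_single, affineSimplex_vertices, map_single, ContinuousMap.comp_id]

lemma bd_sd (c : SingChain X (n + 1)) : bd n (sd (n + 1) c) = sd n (bd n c) :=
  DFunLike.congr_fun (f := bd n ∘ₗ sd (n + 1)) (g := sd n ∘ₗ bd n) (ext_single fun σ => by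
    simp only [LinearMap.comp_apply]
    rw [single_eq_map σ, ← map_sd, ← map_bd, sd_ofTuple, ← ofTuple_bd, TupleChain.bd_sd,
      ← map_bd, ← map_sd, ← ofTuple_bd, sd_ofTuple]) c

lemma bd_sdHomotopy_succ (c : SingChain X (n + 1)) :
    bd (n + 1) (sdHomotopy (n + 1) c) + sdHomotopy n (bd n c) = c - sd (n + 1) c :=
  DFunLike.congr_fun (f := bd (n + 1) ∘ₗ sdHomotopy (n + 1) + sdHomotopy n ∘ₗ bd n)
    (g := LinearMap.id - sd (n + 1)) (ext_single fun σ => by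
    simp only [LinearMap.comp_apply, LinearMap.add_apply, LinearMap.sub_apply, LinearMap.id_apply]
    rw [single_eq_map σ, ← map_sdHomotopy, ← map_bd, ← map_bd, ← map_sdHomotopy, ← map_sd,
      ← map_add, ← map_sub, sdHomotopy_ofTuple, ← ofTuple_bd, ← ofTuple_bd, sdHomotopy_ofTuple,
      sd_ofTuple, ← map_add, ← map_sub, TupleChain.bd_sdHomotopy]) c

variable {ι : Type*} (U : ι → Set X)

/-- The chains on singular simplices contained in a member of the family `U`. -/
def small (n : ℕ) : Submodule ℤ (SingChain X n) :=
  Finsupp.supported ℤ ℤ {σ : C(Simp n, X) | ∃ i, Set.range σ ⊆ U i}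

variable {U}

lemma map_mem_small {σ : C(Simp m, X)} {i : ι} (h : Set.range σ ⊆ U i)
    (c : SingChain (Simp m) n) : map σ n c ∈ small U n := by
  classical
  intro τ hτ
  obtain ⟨ρ, -, rfl⟩ := Finset.mem_image.mp (Finsupp.mapDomain_support hτ)
  refine ⟨i, ?_⟩
  rintro _ ⟨x, rfl⟩
  exact h ⟨ρ x, rfl⟩

lemma small_le_comap {M : ℕ} {f : SingChain X n →ₗ[ℤ] SingChain X M}
    (h : ∀ σ : C(Simp n, X), ∃ c, f (Finsupp.single σ 1) = map σ M c) :
    small U n ≤ (small U M).comap f := by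
  conv_lhs => rw [small, Finsupp.supported_eq_span_single]
  rw [Submodule.span_le]
  rintro _ ⟨σ, ⟨i, hi⟩, rfl⟩
  obtain ⟨c, hc⟩ := h σ
  simp only [Submodule.comap_coe, Set.mem_preimage, hc]
  exact map_mem_small hi c

lemma sd_mem_small {c : SingChain X n} (hc : c ∈ small U n) : sd n c ∈ small U n :=
  small_le_comap (fun σ => ⟨_, sd_single σ⟩) hc

lemma sdHomotopy_mem_small {c : SingChain X n} (hc : c ∈ small U n) :
    sdHomotopy n c ∈ small U (n + 1) :=
  small_le_comap (fun σ => ⟨_, sdHomotopy_single σ⟩) hc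

lemma iterate_sd_mem_small {c : SingChain X n} (hc : c ∈ small U n) (N : ℕ) :
    (sd n ^ N) c ∈ small U n := by
  induction N with
  | zero => exact hc
  | succ N ih =>
    rw [pow_succ', Module.End.mul_apply]
    exact sd_mem_small ih

lemma map_iterate_sd (f : C(X, Y)) (c : SingChain X n) (N : ℕ) :
    map f n ((sd n ^ N) c) = (sd n ^ N) (map f n c) := by
  induction N with
  | zero => rfl
  | succ N ih => rw [pow_succ', pow_succ', Module.End.mul_apply, Module.End.mul_apply, map_sd, ih]

lemma iterate_sd_ofTuple (c : TupleChain (Simp m) (n + 1)) (N : ℕ) :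
    (sd n ^ N) (ofTuple m n c) = ofTuple m n ((TupleChain.sd tupleBary (n + 1) ^ N) c) := by
  induction N with
  | zero => rfl
  | succ N ih =>
    rw [pow_succ', pow_succ', Module.End.mul_apply, Module.End.mul_apply, ih, sd_ofTuple]

/-- By the Lebesgue number lemma, a singular simplex becomes small after enough subdivisions. -/
lemma exists_iterate_sd_single_mem_small (hU : ∀ i, IsOpen (U i)) (hcov : ⋃ i, U i = Set.univ)
    (σ : C(Simp n, X)) : ∃ N, (sd n ^ N) (Finsupp.single σ 1) ∈ small U n := by
  obtain ⟨δ, hδ, h⟩ := lebesgue_number_lemma_of_metric (s := (Set.univ : Set (Simp n)))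
    (c := fun i => σ ⁻¹' U i) isCompact_univ (fun i => (hU i).preimage σ.continuous)
    (by rw [← Set.preimage_iUnion, hcov, Set.preimage_univ])
  obtain ⟨D, hD⟩ : ∃ D, ∀ i j, dist (vertices n i) (vertices n j) ≤ D := by
    obtain ⟨D, hD⟩ := (Set.finite_range
      fun x : Fin (n + 1) × Fin (n + 1) => dist (vertices n x.1) (vertices n x.2)).bddAbove
    exact ⟨D, fun i j => hD ⟨(i, j), rfl⟩⟩
  have hlim : Filter.Tendsto (fun N : ℕ => ((n : ℝ) / (n + 1)) ^ N * D) Filter.atTop (𝓝 0) := by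
    have h1 : (n : ℝ) / (n + 1) < 1 := by rw [div_lt_one (by positivity)]; linarith
    simpa using (tendsto_pow_atTop_nhds_zero_of_lt_one (by positivity) h1).mul_const D
  obtain ⟨N, hN⟩ := (hlim.eventually (gt_mem_nhds hδ)).exists
  refine ⟨N, ?_⟩
  rw [single_eq_map σ, ← map_iterate_sd, iterate_sd_ofTuple]
  have hs := TupleChain.iterate_sd_mem_supported dist_tupleBary_le (vertices n) D hD N
  have hle : Finsupp.supported ℤ ℤ {w : Fin (n + 1) → Simp n |
      ∀ i j, dist (w i) (w j) ≤ ((n : ℝ) / (n + 1)) ^ N * D} ≤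
      (small U n).comap (map σ n ∘ₗ ofTuple n n) := by
    rw [Finsupp.supported_eq_span_single, Submodule.span_le]
    rintro _ ⟨w, hw, rfl⟩
    obtain ⟨i, hi⟩ := h (w 0) (Set.mem_univ _)
    simp only [Submodule.comap_coe, Set.mem_preimage, LinearMap.comp_apply, ofTuple_single,
      map_single, SetLike.mem_coe]
    refine Finsupp.single_mem_supported ℤ _ ⟨i, ?_⟩
    rintro _ ⟨x, rfl⟩
    refine hi (lt_of_le_of_lt (dist_affineSimplex_le w x (w 0)) ?_)
    refine lt_of_le_of_lt (Finset.sum_le_sum fun j _ =>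
      mul_le_mul_of_nonneg_left (hw j 0) (x.2.1 j)) ?_
    rw [← Finset.sum_mul, stdSimplex.sum_eq_one, one_mul]
    exact hN
  exact hle hs

lemma exists_iterate_sd_mem_small (hU : ∀ i, IsOpen (U i)) (hcov : ⋃ i, U i = Set.univ)
    (c : SingChain X n) : ∃ N, (sd n ^ N) c ∈ small U n := by
  induction c using Finsupp.induction_linear with
  | zero => exact ⟨0, Submodule.zero_mem _⟩
  | add f g hf hg =>
    obtain ⟨N, hN⟩ := hf
    obtain ⟨M, hM⟩ := hg
    refine ⟨N + M, ?_⟩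
    rw [map_add]
    refine Submodule.add_mem _ ?_ ?_
    · rw [add_comm N, pow_add, Module.End.mul_apply]
      exact iterate_sd_mem_small hN M
    · rw [pow_add, Module.End.mul_apply]
      exact iterate_sd_mem_small hM N
  | single σ z =>
    obtain ⟨N, hN⟩ := exists_iterate_sd_single_mem_small hU hcov σ
    refine ⟨N, ?_⟩
    rw [← mul_one z, ← smul_eq_mul, ← Finsupp.smul_single, map_zsmul]
    exact Submodule.smul_mem _ _ hN

lemma single_zero_mem_small (hcov : ⋃ i, U i = Set.univ) (c : SingChain X 0) : c ∈ small U 0 := by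
  intro σ _
  obtain ⟨x, hx⟩ : ∃ x, ∀ y, σ y = x := ⟨σ default, fun y => congrArg σ (Subsingleton.elim _ _)⟩
  obtain ⟨i, hi⟩ := Set.mem_iUnion.mp (hcov.symm ▸ Set.mem_univ x)
  refine ⟨i, ?_⟩
  rintro _ ⟨y, rfl⟩
  rwa [hx]

/-- The complex of singular chains modulo small chains is acyclic. -/
theorem exists_sub_bd_mem_small (hU : ∀ i, IsOpen (U i)) (hcov : ⋃ i, U i = Set.univ)
    (c : SingChain X (n + 1)) (hc : bd n c ∈ small U n) : ∃ d, c - bd (n + 1) d ∈ small U (n + 1) := by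
  obtain ⟨N, hN⟩ := exists_iterate_sd_mem_small hU hcov c
  induction N generalizing c with
  | zero => exact ⟨0, by simpa using hN⟩
  | succ N ih =>
    rw [pow_succ, Module.End.mul_apply] at hN
    obtain ⟨d, hd⟩ := ih (sd (n + 1) c) (by rw [bd_sd]; exact sd_mem_small hc) hN
    refine ⟨sdHomotopy (n + 1) c + d, ?_⟩
    have h := bd_sdHomotopy_succ c
    have h2 : c - bd (n + 1) (sdHomotopy (n + 1) c + d) =
        (sd (n + 1) c - bd (n + 1) d) + sdHomotopy n (bd n c) := by
      rw [map_add, ← sub_eq_zero]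
      rw [← sub_eq_zero] at h
      rw [← neg_eq_zero, ← h]
      abel
    rw [h2]
    exact Submodule.add_mem _ hd (sdHomotopy_mem_small hc)

end SingChain


/-! ### Comparison with the singular chain complex of Mathlib -/

lemma linearCombination_single_one {α M : Type*} [AddCommMonoid M] [Module ℤ M] (f : α → M)
    (a : α) : Finsupp.linearCombination ℤ f (Finsupp.single a 1) = f a := by
  simp

lemma ulift_int_hom_ext {M : Type*} [AddCommMonoid M] [Module ℤ M]
    {f g : ULift.{v} ℤ →ₗ[ℤ] M} (h : f (ULift.up 1) = g (ULift.up 1)) : f = g := by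
  have h' : f ∘ₗ ULift.moduleEquiv.symm.toLinearMap = g ∘ₗ ULift.moduleEquiv.symm.toLinearMap :=
    LinearMap.ext_ring h
  exact LinearMap.ext fun ⟨r⟩ => DFunLike.congr_fun h' r

lemma hom_zsmul_apply {M N : ModuleCat.{v} ℤ} (f : M ⟶ N) (z : ℤ) (x : M) :
    (z • f).hom x = z • f.hom x :=
  rfl

section Compare

variable (X : TopCat.{u}) (n : ℕ)

/-- The generator of the module of singular chains given by a singular simplex. -/
def simplexChain {X : TopCat.{u}} {n : ℕ} (σ : C(Simp n, X)) : (singularChains.obj X).X n :=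
  ((TopCat.toSSet.obj X).ιChainComplex (R := ModuleCat.of ℤ (ULift.{u} ℤ)) (n := n)
    ((X.toSSetObjEquiv (.op (.mk n))).symm σ)).hom (ULift.up 1)

/-- The morphism from the module of singular chains to formal combinations of simplices. -/
def toSingHom : (singularChains.obj X).X n ⟶ ModuleCat.of ℤ (SingChain X n) :=
  Cofan.IsColimit.desc ((TopCat.toSSet.obj X).isColimitChainComplexXCofan
    (ModuleCat.of ℤ (ULift.{u} ℤ)) n) fun x =>
      ModuleCat.ofHom (Finsupp.lsingle (X.toSSetObjEquiv (.op (.mk n)) x) ∘ₗ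
        ULift.moduleEquiv.toLinearMap)

lemma toSingHom_simplexChain (σ : C(Simp n, X)) :
    (toSingHom X n).hom (simplexChain σ) = Finsupp.single σ 1 := by
  have h := Cofan.IsColimit.fac ((TopCat.toSSet.obj X).isColimitChainComplexXCofan
    (ModuleCat.of ℤ (ULift.{u} ℤ)) n) (fun x =>
      ModuleCat.ofHom (Finsupp.lsingle (X.toSSetObjEquiv (.op (.mk n)) x) ∘ₗ
        ULift.moduleEquiv.toLinearMap)) ((X.toSSetObjEquiv (.op (.mk n))).symm σ)
  have h2 := congrArg (fun φ => φ.hom (ULift.up 1)) h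
  refine Eq.trans ?_ (h2.trans ?_)
  · rfl
  · simp

/-- The module of singular chains is free on the singular simplices. -/
def singEquiv : SingChain X n ≃ₗ[ℤ] (singularChains.obj X).X n :=
  LinearEquiv.ofLinearMap
    (Finsupp.linearCombination ℤ fun σ : C(Simp n, X) => simplexChain σ)
    (toSingHom X n).hom
    (by
      have h : toSingHom X n ≫ ModuleCat.ofHom
          (Finsupp.linearCombination ℤ fun σ : C(Simp n, X) => simplexChain σ) = 𝟙 _ := by
        refine Cofan.IsColimit.hom_ext ((TopCat.toSSet.obj X).isColimitChainComplexXCofan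
          (ModuleCat.of ℤ (ULift.{u} ℤ)) n) _ _ fun x => ?_
        refine (Category.assoc _ _ _).symm.trans
          ((congrArg (fun φ => φ ≫ _) (Cofan.IsColimit.fac _ _ x)).trans ?_)
        have h1 : simplexChain (X.toSSetObjEquiv (.op (.mk n)) x) =
            ((TopCat.toSSet.obj X).ιChainComplex (R := ModuleCat.of ℤ (ULift.{u} ℤ)) (n := n)
              x).hom (ULift.up 1) := by
          rw [simplexChain, Equiv.symm_apply_apply]
        refine ModuleCat.hom_ext (ulift_int_hom_ext ?_)
        exact (linearCombination_single_one _ _).trans h1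
      exact congrArg (fun φ => φ.hom) h)
    (SingChain.ext_single fun σ => by
      refine (congrArg (toSingHom X n).hom (linearCombination_single_one _ _)).trans ?_
      exact toSingHom_simplexChain X n σ)

lemma singEquiv_single (σ : C(Simp n, X)) : singEquiv X n (Finsupp.single σ 1) = simplexChain σ :=
  linearCombination_single_one _ _

lemma d_simplexChain (σ : C(Simp (n + 1), X)) :
    ((singularChains.obj X).d (n + 1) n).hom (simplexChain σ) =
      ∑ i : Fin (n + 2), (-1 : ℤ) ^ (i : ℕ) • simplexChain (σ.comp (faceMap i)) := by
  have h := congrArg (fun φ => φ.hom (ULift.up 1)) ((TopCat.toSSet.obj X).ιChainComplex_d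
    (R := ModuleCat.of ℤ (ULift.{u} ℤ)) ((X.toSSetObjEquiv (.op (.mk (n + 1)))).symm σ))
  refine h.trans ?_
  rw [ModuleCat.hom_sum, LinearMap.sum_apply]
  refine Finset.sum_congr rfl fun i _ => ?_
  have h2 : (TopCat.toSSet.obj X).δ i ((X.toSSetObjEquiv (.op (.mk (n + 1)))).symm σ) =
      (X.toSSetObjEquiv (.op (.mk n))).symm (σ.comp (faceMap i)) := rfl
  refine (hom_zsmul_apply _ _ _).trans ?_
  exact congrArg (fun x => (-1 : ℤ) ^ (i : ℕ) • ((TopCat.toSSet.obj X).ιChainComplex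
    (R := ModuleCat.of ℤ (ULift.{u} ℤ)) x).hom (ULift.up 1)) h2

lemma singEquiv_bd (c : SingChain X (n + 1)) :
    ((singularChains.obj X).d (n + 1) n).hom (singEquiv X (n + 1) c) =
      singEquiv X n (SingChain.bd n c) :=
  DFunLike.congr_fun (f := ((singularChains.obj X).d (n + 1) n).hom ∘ₗ
      (singEquiv X (n + 1)).toLinearMap) (g := (singEquiv X n).toLinearMap ∘ₗ SingChain.bd n)
    (SingChain.ext_single fun σ => by
      simp only [LinearMap.comp_apply, LinearEquiv.coe_coe, singEquiv_single, SingChain.bd_single,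
        map_sum, map_zsmul]
      exact d_simplexChain X n σ) c

lemma map_simplexChain {X Y : TopCat.{u}} (f : X ⟶ Y) {n : ℕ} (σ : C(Simp n, X)) :
    ((singularChains.map f).f n).hom (simplexChain σ) = simplexChain (f.hom.comp σ) := by
  have h := congrArg (fun φ => φ.hom (ULift.up 1)) (SSet.ι_chainComplexMap_f
    (TopCat.toSSet.obj X) (TopCat.toSSet.obj Y) (TopCat.toSSet.map f)
    (ModuleCat.of ℤ (ULift.{u} ℤ)) ((X.toSSetObjEquiv (.op (.mk n))).symm σ))
  exact h

lemma singEquiv_map {X Y : TopCat.{u}} (f : X ⟶ Y) (n : ℕ) (c : SingChain X n) :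
    ((singularChains.map f).f n).hom (singEquiv X n c) =
      singEquiv Y n (SingChain.map f.hom n c) :=
  DFunLike.congr_fun (f := ((singularChains.map f).f n).hom ∘ₗ (singEquiv X n).toLinearMap)
    (g := (singEquiv Y n).toLinearMap ∘ₗ SingChain.map f.hom n)
    (SingChain.ext_single fun σ => by
      simp only [LinearMap.comp_apply, LinearEquiv.coe_coe, singEquiv_single,
        SingChain.map_single]
      exact map_simplexChain f σ) c

end Compare


/-! ### Homology classes of complexes of modules -/

section HomologyClass

variable {R : Type v} [Ring R] (K L : ChainComplex (ModuleCat.{u} R) ℕ) (n : ℕ)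

/-- The submodule of cycles of degree `n`. -/
def cycleSubmodule : Submodule R (K.X n) :=
  LinearMap.ker (K.d n ((ComplexShape.down ℕ).next n)).hom

/-- The homology class of a cycle. -/
def homClass : cycleSubmodule K n →ₗ[R] K.homology n :=
  (K.sc n).moduleCatHomologyIso.inv.hom ∘ₗ (K.sc n).moduleCatLeftHomologyData.π.hom

lemma homClass_surjective : Function.Surjective (homClass K n) :=
  ((K.sc n).moduleCatHomologyIso.toLinearEquiv.symm.surjective).comp
    (Submodule.mkQ_surjective _)

variable {K n}

lemma homClass_eq_zero_iff (z : cycleSubmodule K n) :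
    homClass K n z = 0 ↔ ∃ y : K.X (n + 1), (K.d (n + 1) n).hom y = z := by
  have h1 : homClass K n z = 0 ↔ (K.sc n).moduleCatLeftHomologyData.π.hom z = 0 :=
    (K.sc n).moduleCatHomologyIso.toLinearEquiv.symm.map_eq_zero_iff
  have h2 : (K.sc n).moduleCatLeftHomologyData.π.hom z = 0 ↔
      z ∈ LinearMap.range (K.sc n).moduleCatToCycles := Submodule.Quotient.mk_eq_zero _
  have h3 : (z ∈ LinearMap.range (K.sc n).moduleCatToCycles) ↔
      ∃ y : K.X ((ComplexShape.down ℕ).prev n),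
        (K.d ((ComplexShape.down ℕ).prev n) n).hom y = z :=
    ⟨fun ⟨y, hy⟩ => ⟨y, congrArg Subtype.val hy⟩, fun ⟨y, hy⟩ => ⟨y, Subtype.ext hy⟩⟩
  rw [h1, h2, h3]
  have h4 : (ComplexShape.down ℕ).prev n = n + 1 := by simp
  rw [h4]

lemma map_mem_cycleSubmodule {L : ChainComplex (ModuleCat.{u} R) ℕ} (φ : K ⟶ L) {z : K.X n}
    (hz : z ∈ cycleSubmodule K n) : (φ.f n).hom z ∈ cycleSubmodule L n := by
  have h := congrArg (fun ψ => ψ.hom z) (φ.comm n ((ComplexShape.down ℕ).next n))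
  refine Eq.trans h ?_
  refine (congrArg (φ.f _).hom hz).trans (map_zero _)

variable {L}

lemma homologyMap_homClass (φ : K ⟶ L) (z : cycleSubmodule K n) :
    (HomologicalComplex.homologyMap φ n).hom (homClass K n z) =
      homClass L n ⟨(φ.f n).hom z, map_mem_cycleSubmodule φ z.2⟩ := by
  have hi : ∀ (K : ChainComplex (ModuleCat.{u} R) ℕ) (z : cycleSubmodule K n),
      homClass K n z = (K.homologyπ n).hom ((K.sc n).moduleCatCyclesIso.inv.hom z) := fun K z =>
    (congrArg (fun ψ => ψ.hom z) (K.sc n).moduleCatCyclesIso_inv_π).symm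
  rw [hi, hi]
  refine (congrArg (fun ψ => ψ.hom ((K.sc n).moduleCatCyclesIso.inv.hom z))
    (HomologicalComplex.homologyπ_naturality φ n)).trans ?_
  refine congrArg (L.homologyπ n).hom ?_
  refine (ModuleCat.mono_iff_injective (L.iCycles n)).mp inferInstance ?_
  refine (congrArg (fun ψ => ψ.hom ((K.sc n).moduleCatCyclesIso.inv.hom z))
    (HomologicalComplex.cyclesMap_i φ n)).trans ?_
  refine (congrArg (φ.f n).hom (congrArg (fun ψ => ψ.hom z)
    (K.sc n).moduleCatCyclesIso_inv_iCycles)).trans ?_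
  exact (congrArg (fun ψ => ψ.hom (⟨(φ.f n).hom z, map_mem_cycleSubmodule φ z.2⟩ :
    cycleSubmodule L n)) (L.sc n).moduleCatCyclesIso_inv_iCycles).symm

variable {F : Type w} (φ : F → (K ⟶ L))

/-- The sum of a family of chain maps, in degree `n`. -/
def sumChainMap (n : ℕ) : (F →₀ K.X n) →ₗ[R] L.X n :=
  Finsupp.lsum ℕ fun f => ((φ f).f n).hom

/-- The sum of a family of chain maps, on homology. -/
def sumHomologyMap (n : ℕ) : (F →₀ K.homology n) →ₗ[R] L.homology n :=
  Finsupp.lsum ℕ fun f => (HomologicalComplex.homologyMap (φ f) n).hom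

lemma sumChainMap_single (n : ℕ) (f : F) (x : K.X n) :
    sumChainMap φ n (Finsupp.single f x) = ((φ f).f n).hom x := by
  simp [sumChainMap]

lemma sumHomologyMap_single (n : ℕ) (f : F) (x : K.homology n) :
    sumHomologyMap φ n (Finsupp.single f x) =
      (HomologicalComplex.homologyMap (φ f) n).hom x := by
  simp [sumHomologyMap]

lemma d_sumChainMap (i j : ℕ) (a : F →₀ K.X i) :
    (L.d i j).hom (sumChainMap φ i a) =
      sumChainMap φ j (a.mapRange (K.d i j).hom (map_zero _)) := by
  induction a using Finsupp.induction_linear with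
  | zero => simp
  | add a b ha hb =>
    rw [map_add, map_add, ha, hb, Finsupp.mapRange_add (fun x y => map_add _ x y), map_add]
  | single f x =>
    rw [sumChainMap_single, Finsupp.mapRange_single, sumChainMap_single]
    exact congrArg (fun ψ => ψ.hom x) ((φ f).comm i j)

lemma sumChainMap_mem_cycleSubmodule (a : F →₀ cycleSubmodule K n) :
    sumChainMap φ n (a.mapRange Subtype.val rfl) ∈ cycleSubmodule L n := by
  refine (d_sumChainMap φ _ _ _).trans ?_
  have h : (a.mapRange Subtype.val rfl).mapRange
      (K.d n ((ComplexShape.down ℕ).next n)).hom (map_zero _) = 0 := by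
    ext f
    exact (a f).2
  rw [h, map_zero]

lemma sumHomologyMap_homClass (a : F →₀ cycleSubmodule K n) :
    sumHomologyMap φ n (a.mapRange (homClass K n) (map_zero _)) =
      homClass L n ⟨_, sumChainMap_mem_cycleSubmodule φ a⟩ := by
  have h : ∀ x y : cycleSubmodule L n, (x : L.X n) = y → homClass L n x = homClass L n y :=
    fun x y h => congrArg _ (Subtype.ext h)
  induction a using Finsupp.induction_linear with
  | zero =>
    rw [Finsupp.mapRange_zero, map_zero, ← map_zero (homClass L n)]
    exact h _ _ (by simp)
  | add a b ha hb =>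
    rw [Finsupp.mapRange_add (fun x y => map_add _ x y), map_add, ha, hb, ← map_add]
    refine h _ _ ?_
    simp only [Submodule.coe_add]
    rw [← map_add, ← Finsupp.mapRange_add (fun x y => rfl)]
  | single f x =>
    rw [Finsupp.mapRange_single, sumHomologyMap_single, homologyMap_homClass]
    refine h _ _ ?_
    simp only [Finsupp.mapRange_single]
    exact (sumChainMap_single φ n f x.1).symm

/-- A family of chain maps `φ f : K ⟶ L` induces an isomorphism from a direct sum of copies of
the homology of `K` to that of `L`, if it embeds a direct sum of copies of `K` into `L` and
the quotient is acyclic. -/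
theorem bijective_sumHomologyMap
    (hinj : ∀ n, Function.Injective (sumChainMap φ n))
    (hacyc : ∀ i j, (ComplexShape.down ℕ).next i = j → ∀ c : L.X i,
      (∃ a, (L.d i j).hom c = sumChainMap φ j a) →
        ∃ d : L.X (i + 1), ∃ a, c - (L.d (i + 1) i).hom d = sumChainMap φ i a) (n : ℕ) :
    Function.Bijective (sumHomologyMap φ n) := by
  constructor
  · rw [← AddMonoidHom.coe_coe, injective_iff_map_eq_zero]
    intro x hx
    obtain ⟨a, rfl⟩ := Finsupp.mapRange_surjective _ (map_zero _) (homClass_surjective K n) x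
    change sumHomologyMap φ n _ = 0 at hx
    rw [sumHomologyMap_homClass, homClass_eq_zero_iff] at hx
    obtain ⟨y, hy⟩ := hx
    obtain ⟨d, b, hb⟩ := hacyc (n + 1) n (by simp) y ⟨_, hy⟩
    have h1 := congrArg (L.d (n + 1) n).hom hb
    have h2 : (L.d (n + 1) n).hom ((L.d (n + 1 + 1) (n + 1)).hom d) = 0 :=
      congrArg (fun ψ => ψ.hom d) (L.d_comp_d (n + 1 + 1) (n + 1) n)
    rw [map_sub, h2, sub_zero, hy, d_sumChainMap] at h1
    have h3 := hinj n h1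
    ext f
    rw [Finsupp.mapRange_apply, Finsupp.zero_apply, homClass_eq_zero_iff]
    refine ⟨b f, ?_⟩
    have h4 := DFunLike.congr_fun h3 f
    simpa using h4.symm
  · intro y
    obtain ⟨⟨c, hc⟩, rfl⟩ := homClass_surjective L n y
    obtain ⟨d, b, hb⟩ := hacyc n _ rfl c ⟨0, by rw [map_zero]; exact hc⟩
    have h2 : (L.d n ((ComplexShape.down ℕ).next n)).hom ((L.d (n + 1) n).hom d) = 0 :=
      congrArg (fun ψ : L.X (n + 1) ⟶ L.X ((ComplexShape.down ℕ).next n) => ψ.hom d)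
        (L.d_comp_d (n + 1) n _)
    have hb' : ∀ f, b f ∈ cycleSubmodule K n := by
      have h1 := congrArg (L.d n ((ComplexShape.down ℕ).next n)).hom hb
      have hc' : (L.d n ((ComplexShape.down ℕ).next n)).hom c = 0 := hc
      rw [map_sub, h2, hc', sub_zero, d_sumChainMap] at h1
      have h3 := hinj _ ((map_zero _).trans h1)
      intro f
      have h4 := DFunLike.congr_fun h3 f
      exact h4.symm
    obtain ⟨a, ha⟩ : ∃ a : F →₀ cycleSubmodule K n, a.mapRange Subtype.val rfl = b :=
      ⟨⟨b.support, fun f => ⟨b f, hb' f⟩, fun f => by simp [Subtype.ext_iff]⟩, by ext f; rfl⟩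
    refine ⟨a.mapRange (homClass K n) (map_zero _), ?_⟩
    rw [sumHomologyMap_homClass, ← sub_eq_zero, ← map_sub, homClass_eq_zero_iff]
    refine ⟨-d, ?_⟩
    rw [map_neg, Submodule.coe_sub]
    simp only [ha, ← hb]
    abel

end HomologyClass


/-! ### Relative singular chains and excision -/

section Pairs

variable {A B A' B' A'' B'' : TopCat.{u}}

/-- The map of pair sequences induced by a map of pairs. -/
def pairMap {f : A ⟶ B} {f' : A' ⟶ B'} (α : A ⟶ A') (β : B ⟶ B') (h : f ≫ β = α ≫ f') :
    pairSeq f ⟶ pairSeq f' where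
  τ₁ := singularChains.map α
  τ₂ := singularChains.map β
  τ₃ := cokernel.map _ _ (singularChains.map α) (singularChains.map β)
    (by rw [← Functor.map_comp, ← Functor.map_comp, h])
  comm₁₂ := by
    change singularChains.map α ≫ singularChains.map f' = singularChains.map f ≫ _
    rw [← Functor.map_comp, ← Functor.map_comp, h]
  comm₂₃ := (cokernel.π_desc _ _ _).symm

/-- The map of relative singular chains induced by a map of pairs. -/
abbrev relMap {f : A ⟶ B} {f' : A' ⟶ B'} (α : A ⟶ A') (β : B ⟶ B') (h : f ≫ β = α ≫ f') :
    (pairSeq f).X₃ ⟶ (pairSeq f').X₃ :=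
  (pairMap α β h).τ₃

lemma relMap_comp {f : A ⟶ B} {f' : A' ⟶ B'} {f'' : A'' ⟶ B''}
    (α : A ⟶ A') (β : B ⟶ B') (h : f ≫ β = α ≫ f')
    (α' : A' ⟶ A'') (β' : B' ⟶ B'') (h' : f' ≫ β' = α' ≫ f'')
    (h'' : f ≫ (β ≫ β') = (α ≫ α') ≫ f'') :
    relMap α β h ≫ relMap α' β' h' = relMap (α ≫ α') (β ≫ β') h'' := by
  refine coequalizer.hom_ext ?_
  have h₁ := (pairMap α β h).comm₂₃
  have h₂ := (pairMap α' β' h').comm₂₃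
  have h₃ := (pairMap (α ≫ α') (β ≫ β') h'').comm₂₃
  change singularChains.map β ≫ cokernel.π _ = cokernel.π _ ≫ _ at h₁
  change singularChains.map β' ≫ cokernel.π _ = cokernel.π _ ≫ _ at h₂
  change singularChains.map (β ≫ β') ≫ cokernel.π _ = cokernel.π _ ≫ _ at h₃
  refine Eq.trans ?_ h₃
  rw [Functor.map_comp, Category.assoc, h₂, reassoc_of% h₁]

/-- The relative chain represented by a formal combination of singular simplices. -/
def relClass (f : A ⟶ B) (n : ℕ) : SingChain B n →ₗ[ℤ] (pairSeq f).X₃.X n :=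
  ((pairSeq f).g.f n).hom ∘ₗ (singEquiv B n).toLinearMap

lemma pairSeq_degreewise (f : A ⟶ B) [Mono f] (n : ℕ) :
    ((pairSeq f).map (HomologicalComplex.eval _ _ n)).ShortExact :=
  (HomologicalComplex.shortExact_iff_degreewise_shortExact _).mp (pairSeq_shortExact f) n

lemma relClass_surjective (f : A ⟶ B) [Mono f] (n : ℕ) : Function.Surjective (relClass f n) :=
  (pairSeq_degreewise f n).moduleCat_surjective_g.comp (singEquiv B n).surjective

lemma relClass_eq_zero_iff_exists (f : A ⟶ B) [Mono f] {n : ℕ} (c : SingChain B n) :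
    relClass f n c = 0 ↔ ∃ a, SingChain.map f.hom n a = c := by
  have h := (ShortComplex.ShortExact.moduleCat_exact_iff_function_exact _).mp
    (pairSeq_degreewise f n).exact (singEquiv B n c)
  refine h.trans ⟨?_, ?_⟩
  · rintro ⟨(y : (singularChains.obj A).X n), hy⟩
    refine ⟨(singEquiv A n).symm y, (singEquiv B n).injective ?_⟩
    rw [← singEquiv_map, LinearEquiv.apply_symm_apply]
    exact hy
  · rintro ⟨a, rfl⟩
    exact ⟨singEquiv A n a, singEquiv_map f n a⟩

lemma SingChain.exists_map_iff {A B : Type*} [TopologicalSpace A] [TopologicalSpace B]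
    {f : C(A, B)} (hf : IsEmbedding f) {n : ℕ} (c : SingChain B n) :
    (∃ a, SingChain.map f n a = c) ↔
      c ∈ Finsupp.supported ℤ ℤ {σ : C(Simp n, B) | Set.range σ ⊆ Set.range f} := by
  classical
  constructor
  · rintro ⟨a, rfl⟩ τ hτ
    obtain ⟨ρ, -, rfl⟩ := Finset.mem_image.mp (Finsupp.mapDomain_support hτ)
    rintro _ ⟨x, rfl⟩
    exact ⟨ρ x, rfl⟩
  · intro hc
    have hle : Finsupp.supported ℤ ℤ {σ : C(Simp n, B) | Set.range σ ⊆ Set.range f} ≤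
        LinearMap.range (SingChain.map f n) := by
      rw [Finsupp.supported_eq_span_single, Submodule.span_le]
      rintro _ ⟨σ, hσ, rfl⟩
      choose g hg using fun x => hσ ⟨x, rfl⟩
      have hgc : Continuous g := by
        rw [hf.continuous_iff]
        exact σ.continuous.congr fun x => (hg x).symm
      refine ⟨Finsupp.single ⟨g, hgc⟩ 1, ?_⟩
      rw [SingChain.map_single]
      congr 1
      ext x
      exact hg x
    exact hle hc

lemma relClass_eq_zero_iff (f : A ⟶ B) (hf : IsEmbedding f) {n : ℕ} (c : SingChain B n) :
    relClass f n c = 0 ↔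
      c ∈ Finsupp.supported ℤ ℤ {σ : C(Simp n, B) | Set.range σ ⊆ Set.range f} := by
  have : Mono f := (TopCat.mono_iff_injective _).mpr hf.injective
  rw [relClass_eq_zero_iff_exists, SingChain.exists_map_iff hf]

lemma d_relClass (f : A ⟶ B) {n : ℕ} (c : SingChain B (n + 1)) :
    ((pairSeq f).X₃.d (n + 1) n).hom (relClass f (n + 1) c) =
      relClass f n (SingChain.bd n c) := by
  refine (congrArg (fun ψ => ψ.hom (singEquiv B (n + 1) c))
    ((pairSeq f).g.comm (n + 1) n)).trans ?_
  exact congrArg ((pairSeq f).g.f n).hom (singEquiv_bd B n c)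

lemma relMap_relClass {f : A ⟶ B} {f' : A' ⟶ B'} (α : A ⟶ A') (β : B ⟶ B')
    (h : f ≫ β = α ≫ f') {n : ℕ} (c : SingChain B n) :
    ((relMap α β h).f n).hom (relClass f n c) = relClass f' n (SingChain.map β.hom n c) := by
  refine (congrArg (fun ψ => (ψ.f n).hom (singEquiv B n c)) (pairMap α β h).comm₂₃).symm.trans ?_
  exact congrArg ((pairSeq f').g.f n).hom (singEquiv_map β n c)

lemma sumChainMap_relMap {F : Type w} {i : A ⟶ B} {j : A' ⟶ B'} (α : F → (A ⟶ A'))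
    (φ : F → (B ⟶ B')) (h : ∀ f, i ≫ φ f = α f ≫ j) (n : ℕ) (a : F →₀ SingChain B n) :
    sumChainMap (fun f => relMap (α f) (φ f) (h f)) n (a.mapRange (relClass i n) (map_zero _)) =
      relClass j n (a.sum fun f c => SingChain.map (φ f).hom n c) := by
  induction a using Finsupp.induction_linear with
  | zero => simp
  | add a b ha hb =>
    rw [Finsupp.mapRange_add (fun x y => map_add _ x y), map_add, ha, hb, ← map_add,
      Finsupp.sum_add_index' (fun _ => map_zero _) (fun _ _ _ => map_add _ _ _)]
  | single f x =>
    rw [Finsupp.mapRange_single, sumChainMap_single, relMap_relClass]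
    exact congrArg _ (Finsupp.sum_single_index
      (h := fun f c => SingChain.map (φ f).hom n c) (map_zero _)).symm

/-- Small chains are sums of chains of the members of the cover. -/
lemma SingChain.exists_of_mem_small {F : Type*} {A B Y : Type*} [TopologicalSpace A]
    [TopologicalSpace B] [TopologicalSpace Y] (j : C(A, Y)) (hj : IsEmbedding j)
    (φ : F → C(B, Y)) (hφ : ∀ f, IsEmbedding (φ f)) {n : ℕ} (c : SingChain Y n)
    (hc : c ∈ SingChain.small (fun o : Option F => o.elim (Set.range j) fun f => Set.range (φ f))
      n) :
    ∃ (x : SingChain A n) (a : F →₀ SingChain B n),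
      c = SingChain.map j n x + a.sum fun f b => SingChain.map (φ f) n b := by
  classical
  let T : SingChain A n × (F →₀ SingChain B n) →ₗ[ℤ] SingChain Y n :=
    (SingChain.map j n).coprod (Finsupp.lsum ℤ fun f => SingChain.map (φ f) n)
  suffices h : SingChain.small (fun o : Option F => o.elim (Set.range j) fun f =>
      Set.range (φ f)) n ≤ LinearMap.range T by
    obtain ⟨⟨x, a⟩, rfl⟩ := h hc
    exact ⟨x, a, rfl⟩
  rw [SingChain.small, Finsupp.supported_eq_span_single, Submodule.span_le]
  rintro _ ⟨σ, ⟨o, ho⟩, rfl⟩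
  cases o with
  | none =>
    obtain ⟨a, ha⟩ := (SingChain.exists_map_iff hj (Finsupp.single σ 1)).mpr
      (Finsupp.single_mem_supported ℤ _ ho)
    exact ⟨(a, 0), by simp [T, ha]⟩
  | some f =>
    obtain ⟨a, ha⟩ := (SingChain.exists_map_iff (hφ f) (Finsupp.single σ 1)).mpr
      (Finsupp.single_mem_supported ℤ _ ho)
    exact ⟨(0, Finsupp.single f a), by simp [T, ha]⟩

/-- Excision: if `Y` is covered by an open subspace `U` and by disjoint open copies of `V`,
and if `Q` is the part of `V` lying over `U`, then the relative homology of `(Y, U)` is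
a direct sum of copies of that of `(V, Q)`. -/
theorem bijective_sumHomologyMap_relMap {F : Type w} {Q V U Y : TopCat.{u}} (i : Q ⟶ V)
    (hi : IsEmbedding i) (j : U ⟶ Y) (hj : IsOpenEmbedding j)
    (α : F → (Q ⟶ U)) (φ : F → (V ⟶ Y)) (h : ∀ f, i ≫ φ f = α f ≫ j)
    (hφ : ∀ f, IsOpenEmbedding (φ f))
    (hQ : ∀ f, φ f ⁻¹' Set.range j ⊆ Set.range i)
    (hdisj : ∀ f f' x x', φ f x = φ f' x' → f = f')
    (hcov : Set.range j ∪ ⋃ f, Set.range (φ f) = Set.univ) (n : ℕ) :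
    Function.Bijective (sumHomologyMap (fun f => relMap (α f) (φ f) (h f)) n) := by
  classical
  have : Mono i := (TopCat.mono_iff_injective _).mpr hi.injective
  have : Mono j := (TopCat.mono_iff_injective _).mpr hj.injective
  have hcov' : ⋃ o : Option F, (o.elim (Set.range j) fun f => Set.range (φ f)) =
      Set.univ := by
    rw [← hcov]
    ext y
    simp [Option.exists]
  have hop : ∀ o : Option F, IsOpen (o.elim (Set.range j) fun f => Set.range (φ f)) := by
    rintro (_ | f)
    · exact hj.isOpen_range
    · exact (hφ f).isOpen_range
  have hsmall : ∀ {n : ℕ} (c : SingChain Y n),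
      c ∈ SingChain.small (fun o : Option F => o.elim (Set.range j) fun f => Set.range (φ f)) n →
      ∃ a, relClass j n c = sumChainMap (fun f => relMap (α f) (φ f) (h f)) n a := by
    intro n c hc
    obtain ⟨x, a, rfl⟩ := SingChain.exists_of_mem_small j.hom hj.isEmbedding
      (fun f => (φ f).hom) (fun f => (hφ f).isEmbedding) c hc
    refine ⟨a.mapRange (relClass i n) (map_zero _), ?_⟩
    rw [sumChainMap_relMap, map_add, (relClass_eq_zero_iff_exists j _).mpr ⟨x, rfl⟩, zero_add]
  refine bijective_sumHomologyMap _ (fun n => ?_) ?_ n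
  · rw [← AddMonoidHom.coe_coe, injective_iff_map_eq_zero]
    intro x hx
    obtain ⟨a, rfl⟩ := Finsupp.mapRange_surjective _ (map_zero _) (relClass_surjective i n) x
    change sumChainMap _ n _ = 0 at hx
    rw [sumChainMap_relMap, relClass_eq_zero_iff j hj.isEmbedding] at hx
    ext f
    rw [Finsupp.mapRange_apply, Finsupp.zero_apply, relClass_eq_zero_iff i hi]
    intro σ hσ
    -- the coefficient of `φ f ∘ σ` in the sum is that of `σ` in `a f`
    have hcoef : (a.sum fun f c => SingChain.map (φ f).hom n c) ((φ f).hom.comp σ) = a f σ := by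
      rw [Finsupp.sum_apply, Finsupp.sum, Finset.sum_eq_single f]
      · refine Finsupp.mapDomain_apply (fun σ τ hστ => ?_) _ _
        ext x
        exact (hφ f).injective (DFunLike.congr_fun hστ x)
      · intro f' _ hne
        refine Finsupp.mapDomain_of_notMem_range _ _ ?_
        rintro ⟨τ, hτ⟩
        exact hne (hdisj f' f (τ (stdSimplex.vertex 0)) (σ (stdSimplex.vertex 0))
          (DFunLike.congr_fun hτ _))
      · intro hf
        rw [Finsupp.notMem_support_iff.mp hf, map_zero, Finsupp.zero_apply]
    have hmem : (φ f).hom.comp σ ∈ (a.sum fun f c => SingChain.map (φ f).hom n c).support := by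
      rw [Finsupp.mem_support_iff, hcoef]
      exact Finsupp.mem_support_iff.mp hσ
    have hr := hx hmem
    rintro _ ⟨x, rfl⟩
    exact hQ f (hr ⟨x, rfl⟩)
  · intro n m hnm c hc
    obtain ⟨c, rfl⟩ := relClass_surjective j n c
    cases n with
    | zero =>
      obtain ⟨a, ha⟩ := hsmall c (SingChain.single_zero_mem_small hcov' c)
      exact ⟨0, a, by rw [map_zero, sub_zero, ha]⟩
    | succ n =>
      obtain rfl : n = m := by simpa using hnm
      obtain ⟨x, hx⟩ := hc
      obtain ⟨a, rfl⟩ := Finsupp.mapRange_surjective _ (map_zero _) (relClass_surjective i n) x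
      rw [sumChainMap_relMap, d_relClass, ← sub_eq_zero, ← map_sub,
        relClass_eq_zero_iff j hj.isEmbedding] at hx
      have hbd : SingChain.bd n c ∈ SingChain.small
          (fun o : Option F => o.elim (Set.range j) fun f => Set.range (φ f)) n := by
        rw [← sub_add_cancel (SingChain.bd n c) (a.sum fun f c => SingChain.map (φ f).hom n c)]
        refine Submodule.add_mem _ ?_ (Submodule.sum_mem _ fun f _ => ?_)
        · refine Finsupp.supported_mono ?_ hx
          exact fun σ hσ => ⟨none, hσ⟩
        · refine Finsupp.supported_mono ?_
            ((SingChain.exists_map_iff (hφ f).isEmbedding _).mp ⟨_, rfl⟩)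
          exact fun σ hσ => ⟨some f, hσ⟩
      obtain ⟨d, hd⟩ := SingChain.exists_sub_bd_mem_small hop hcov' c hbd
      obtain ⟨b, hb⟩ := hsmall _ hd
      refine ⟨relClass j _ d, b, ?_⟩
      rw [d_relClass, ← map_sub, hb]

end Pairs


/-! ### Homotopy invariance for pairs and the homology of a triple -/

section Invariance

variable {A B A' B' : TopCat.{u}}

lemma quasiIso_singularChains_map (f : A ⟶ B) (g : B ⟶ A)
    (H : TopCat.Homotopy (f ≫ g) (𝟙 A)) (H' : TopCat.Homotopy (g ≫ f) (𝟙 B)) :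
    QuasiIso (singularChains.map f) := by
  let e : HomotopyEquiv (singularChains.obj A) (singularChains.obj B) :=
    { hom := singularChains.map f
      inv := singularChains.map g
      homotopyHomInvId := (Homotopy.ofEq (singularChains.map_comp f g).symm).trans
        ((H.singularChainComplexFunctorObjMap _).trans
          (Homotopy.ofEq (singularChains.map_id A)))
      homotopyInvHomId := (Homotopy.ofEq (singularChains.map_comp g f).symm).trans
        ((H'.singularChainComplexFunctorObjMap _).trans
          (Homotopy.ofEq (singularChains.map_id B))) }
  exact e.quasiIso_hom

/-- A map of pairs that induces isomorphisms on the homology of both members of the pair induces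
isomorphisms on relative homology, by the five lemma. -/
lemma quasiIso_relMap {f : A ⟶ B} {f' : A' ⟶ B'} [Mono f] [Mono f'] (α : A ⟶ A') (β : B ⟶ B')
    (h : f ≫ β = α ≫ f') (hα : QuasiIso (singularChains.map α))
    (hβ : QuasiIso (singularChains.map β)) : QuasiIso (relMap α β h) :=
  HomologicalComplex.HomologySequence.quasiIso_τ₃ (pairMap α β h) (pairSeq_shortExact f)
    (pairSeq_shortExact f') hα hβ

/-- The relative chain complexes of a triple `A ⊆ B ⊆ C`. -/
def tripleSeq {A B C : TopCat.{u}} (a : A ⟶ B) (b : B ⟶ C) [Mono a] :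
    ShortComplex (ChainComplex (ModuleCat.{u} ℤ) ℕ) :=
  ShortComplex.mk (relMap (f := a) (f' := a ≫ b) (𝟙 A) b (Category.id_comp _).symm)
    (relMap (f := a ≫ b) (f' := b) a (𝟙 C) (Category.comp_id _)) (by
      refine coequalizer.hom_ext ?_
      have h₁ := (pairMap (f := a) (f' := a ≫ b) (𝟙 A) b (Category.id_comp _).symm).comm₂₃
      have h₂ := (pairMap (f := a ≫ b) (f' := b) a (𝟙 C) (Category.comp_id _)).comm₂₃
      change singularChains.map b ≫ cokernel.π _ = cokernel.π _ ≫ _ at h₁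
      change singularChains.map (𝟙 C) ≫ cokernel.π _ = cokernel.π _ ≫ _ at h₂
      rw [singularChains.map_id, Category.id_comp] at h₂
      refine (Category.assoc _ _ _).symm.trans ?_
      refine (congrArg (fun ψ => ψ ≫ _) h₁.symm).trans ?_
      refine (Category.assoc _ _ _).trans ((congrArg (fun ψ => _ ≫ ψ) h₂.symm).trans ?_)
      rw [cokernel.condition]
      exact comp_zero.symm)

lemma tripleSeq_shortExact {A B C : TopCat.{u}} (a : A ⟶ B) (b : B ⟶ C) [Mono a] [Mono b] :
    (tripleSeq a b).ShortExact := by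
  refine HomologicalComplex.shortExact_of_degreewise_shortExact _ fun n => ?_
  refine ModuleCat.shortComplex_shortExact _ ?_ ?_ ?_
  · intro x
    constructor
    · intro hx
      obtain ⟨c, rfl⟩ := relClass_surjective (a ≫ b) n x
      have h1 := (relMap_relClass (f := a ≫ b) (f' := b) a (𝟙 C) (Category.comp_id _) c).symm.trans
        hx
      obtain ⟨y, hy⟩ := (relClass_eq_zero_iff_exists b _).mp h1
      refine ⟨relClass a n y, (relMap_relClass (f := a) (f' := a ≫ b) (𝟙 A) b
        (Category.id_comp _).symm y).trans ?_⟩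
      rw [hy]
      exact congrArg (relClass _ n) (SingChain.map_id c)
    · rintro ⟨y, rfl⟩
      exact congrArg (fun ψ => (ψ.f n).hom y) (tripleSeq a b).zero
  · rw [← AddMonoidHom.coe_coe, injective_iff_map_eq_zero]
    intro x hx
    obtain ⟨c, rfl⟩ := relClass_surjective a n x
    have h1 := (relMap_relClass (f := a) (f' := a ≫ b) (𝟙 A) b
      (Category.id_comp _).symm c).symm.trans hx
    obtain ⟨y, hy⟩ := (relClass_eq_zero_iff_exists (a ≫ b) _).mp h1
    refine (relClass_eq_zero_iff_exists a _).mpr ⟨y, ?_⟩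
    have h2 : SingChain.map b.hom n (SingChain.map a.hom n y) = SingChain.map b.hom n c :=
      (SingChain.map_comp _ _ _).trans hy
    refine Finsupp.mapDomain_injective (fun σ τ hστ => ?_) h2
    ext x
    exact (TopCat.mono_iff_injective b).mp inferInstance (DFunLike.congr_fun hστ x)
  · intro x
    obtain ⟨c, rfl⟩ := relClass_surjective b n x
    refine ⟨relClass (a ≫ b) n c, (relMap_relClass (f := a ≫ b) (f' := b) a (𝟙 C)
      (Category.comp_id _) c).trans ?_⟩
    exact congrArg (relClass _ n) (SingChain.map_id c)

/-- If `A → C` is a homology isomorphism, the connecting homomorphism of the triple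
`A ⊆ B ⊆ C` is an isomorphism. -/
lemma nonempty_iso_of_triple {A B C : TopCat.{u}} (a : A ⟶ B) (b : B ⟶ C) [Mono a] [Mono b]
    (h : QuasiIso (singularChains.map (a ≫ b))) (n : ℕ) :
    Nonempty ((pairSeq b).X₃.homology (n + 1) ≅ (pairSeq a).X₃.homology n) := by
  have : Mono (a ≫ b) := mono_comp a b
  have hac : (tripleSeq a b).X₂.Acyclic :=
    (pairSeq_shortExact (a ≫ b)).acyclic_X₃ h
  exact ⟨(tripleSeq_shortExact a b).δIso (n + 1) n (ComplexShape.down_mk _ _ rfl)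
    (hac _).isZero_homology (hac _).isZero_homology⟩

end Invariance

/-! ### The local homology of a real vector space at the origin -/

/-- The inclusion of subspaces of a topological space. -/
def inclTop {X : Type u} [TopologicalSpace X] {s t : Set X} (h : s ⊆ t) :
    TopCat.of s ⟶ TopCat.of t :=
  TopCat.ofHom ⟨Set.inclusion h, continuous_inclusion h⟩

/-- The inclusion of a subspace into a topological space. -/
def valTop {X : Type u} [TopologicalSpace X] (s : Set X) : TopCat.of s ⟶ TopCat.of X :=
  TopCat.ofHom ⟨Subtype.val, continuous_subtype_val⟩

lemma isOpenEmbedding_inclusion_of_isOpen {X : Type u} [TopologicalSpace X] {s t : Set X}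
    (hs : IsOpen s) (h : s ⊆ t) : IsOpenEmbedding (Set.inclusion h) :=
  ⟨IsEmbedding.inclusion h, by
    rw [Set.range_inclusion]
    exact hs.preimage continuous_subtype_val⟩

instance {X : Type u} [TopologicalSpace X] {s t : Set X} (h : s ⊆ t) : Mono (inclTop h) :=
  (TopCat.mono_iff_injective _).mpr (Set.inclusion_injective h)

instance {X : Type u} [TopologicalSpace X] (s : Set X) : Mono (valTop s) :=
  (TopCat.mono_iff_injective _).mpr Subtype.val_injective

/-- The pair `(V, V ∖ 0)`. -/
abbrev punctured (V : Type u) [TopologicalSpace V] [Zero V] :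
    TopCat.of ({0}ᶜ : Set V) ⟶ TopCat.of V :=
  valTop ({0}ᶜ : Set V)

section LocalHomology

lemma isIso_pairSeq_g_of_isEmpty {A B : TopCat.{u}} (f : A ⟶ B) [Mono f] [IsEmpty A] :
    IsIso (pairSeq f).g := by
  rw [(pairSeq_shortExact f).isIso_g_iff, IsZero.iff_id_eq_zero]
  ext n x
  obtain ⟨c, rfl⟩ := (singEquiv A n).surjective x
  have : IsEmpty C(Simp n, A) := ⟨fun σ => isEmptyElim (σ (stdSimplex.vertex 0))⟩
  rw [Subsingleton.elim c 0, map_zero, map_zero, map_zero]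

lemma isIso_singularHomology₀ε (X : TopCat.{u}) (_ : PathConnectedSpace X) :
    IsIso (TopCat.singularHomology₀ε X (ModuleCat.of ℤ (ULift.{u} ℤ))) :=
  inferInstance

/-- In dimension `0` the local homology is the homology of a point. -/
lemma localHomology_zero :
    Nonempty ((pairSeq (punctured PUnit.{u + 1})).X₃.homology 0 ≃ₗ[ℤ] ℤ) := by
  have : IsEmpty (TopCat.of ({0}ᶜ : Set PUnit.{u + 1})) := ⟨fun x => x.2 (Subsingleton.elim _ _)⟩
  have := isIso_pairSeq_g_of_isEmpty (punctured PUnit.{u + 1})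
  have h := isIso_singularHomology₀ε (TopCat.of PUnit.{u + 1})
    (inferInstanceAs (PathConnectedSpace PUnit.{u + 1}))
  have e1 : (pairSeq (punctured PUnit.{u + 1})).X₂.homology 0 ≅
      (pairSeq (punctured PUnit.{u + 1})).X₃.homology 0 :=
    asIso (HomologicalComplex.homologyMap (pairSeq (punctured PUnit.{u + 1})).g 0)
  have e2 : (pairSeq (punctured PUnit.{u + 1})).X₂.homology 0 ≅ ModuleCat.of ℤ (ULift.{u} ℤ) :=
    @asIso _ _ _ _ (TopCat.singularHomology₀ε (TopCat.of PUnit.{u + 1})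
      (ModuleCat.of ℤ (ULift.{u} ℤ))) h
  exact ⟨(e1.symm ≪≫ e2).toLinearEquiv.trans ULift.moduleEquiv⟩

variable (W : Type u) [NormedAddCommGroup W]

/-- The complement of the ray of points `(0, s)` in `W × ℝ` with `s * ε ≤ 0`. -/
def rayCompl (ε : ℝ) : Set (W × ℝ) := {x | x.1 ≠ 0 ∨ 0 < x.2 * ε}

variable {W}

lemma rayCompl_subset (ε : ℝ) : rayCompl W ε ⊆ {0}ᶜ := by
  rintro x hx rfl
  rcases hx with h | h
  · exact h rfl
  · simp at h

lemma isOpen_rayCompl (ε : ℝ) : IsOpen (rayCompl W ε) :=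
  (isOpen_ne_fun continuous_fst continuous_const).union
    (isOpen_lt continuous_const (continuous_snd.mul continuous_const))

/-- The subspace `{x | x.1 ≠ 0}` of `rayCompl W 1`. -/
def offAxis (W : Type u) [NormedAddCommGroup W] : Set (rayCompl W 1) := {x | x.1.1 ≠ 0}

/-- The homotopy that moves the second coordinate linearly to `ε`. -/
def slide (ε : ℝ) : C(unitInterval × (W × ℝ), W × ℝ) where
  toFun x := (x.2.1, (1 - (x.1 : ℝ)) * ε + x.1 * x.2.2)

lemma slide_mem {ε : ℝ} (hε : ε ≠ 0) (t : unitInterval) {x : W × ℝ} (hx : x ∈ rayCompl W ε) :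
    slide ε (t, x) ∈ rayCompl W ε := by
  rcases hx with h | h
  · exact Or.inl h
  · right
    have h0 : 0 < ε * ε := mul_self_pos.mpr hε
    have ht0 := t.2.1
    have ht1 := t.2.2
    change 0 < ((1 - (t : ℝ)) * ε + t * x.2) * ε
    have : ((1 - (t : ℝ)) * ε + t * x.2) * ε = (1 - t) * (ε * ε) + t * (x.2 * ε) := by ring
    rw [this]
    rcases ht0.lt_or_eq with h1 | h1
    · have := mul_pos h1 h
      have := mul_nonneg (sub_nonneg.mpr ht1) h0.le
      linarith
    · rw [← h1]; simpa using h0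

lemma pair_mem_rayCompl {ε : ℝ} (hε : ε ≠ 0) (w : W) : (w, ε) ∈ rayCompl W ε :=
  Or.inr (mul_self_pos.mpr hε)

/-- The map `x ↦ (x.1, ε)` into `rayCompl W ε`. -/
def toRay {ε : ℝ} (hε : ε ≠ 0) {X : Type u} [TopologicalSpace X] (f : C(X, W)) :
    TopCat.of X ⟶ TopCat.of (rayCompl W ε) :=
  TopCat.ofHom ⟨fun x => ⟨(f x, ε), pair_mem_rayCompl hε _⟩, by fun_prop⟩

lemma quasiIso_rayCompl {ε : ℝ} (hε : ε ≠ 0) :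
    QuasiIso (singularChains.map (inclTop (rayCompl_subset (W := W) ε) ≫
      punctured (W × ℝ))) := by
  refine quasiIso_singularChains_map _ (toRay hε ⟨Prod.fst, continuous_fst⟩) ?_ ?_
  · exact
      { toFun := fun x => ⟨slide ε (x.1, x.2.1), slide_mem hε x.1 x.2.2⟩
        continuous_toFun := by fun_prop
        map_zero_left := fun x => Subtype.ext (Prod.ext rfl (by simp [slide, toRay]))
        map_one_left := fun x => Subtype.ext (Prod.ext rfl (by simp [slide])) }
  · exact
      { toFun := fun x => slide ε (x.1, x.2)
        continuous_toFun := (slide ε).continuous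
        map_zero_left := fun x => Prod.ext rfl (by simp [slide, toRay]; rfl)
        map_one_left := fun x => Prod.ext rfl (by simp [slide]) }

/-- The projection of `rayCompl W 1` to `W`. -/
def rayProj (W : Type u) [NormedAddCommGroup W] : TopCat.of (rayCompl W 1) ⟶ TopCat.of W :=
  TopCat.ofHom ⟨fun x => x.1.1, by fun_prop⟩

/-- The projection of `offAxis W` to `W ∖ 0`. -/
def offAxisProj (W : Type u) [NormedAddCommGroup W] :
    TopCat.of (offAxis W) ⟶ TopCat.of ({0}ᶜ : Set W) :=
  TopCat.ofHom ⟨fun x => ⟨x.1.1.1, x.2⟩, by fun_prop⟩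

lemma quasiIso_rayProj : QuasiIso (singularChains.map (rayProj W)) := by
  refine quasiIso_singularChains_map _ (toRay one_ne_zero (ContinuousMap.id W)) ?_ ?_
  · exact
      { toFun := fun x => ⟨slide 1 (x.1, x.2.1), slide_mem one_ne_zero x.1 x.2.2⟩
        continuous_toFun := by fun_prop
        map_zero_left := fun x => Subtype.ext (Prod.ext rfl (by simp [slide, toRay]))
        map_one_left := fun x => Subtype.ext (Prod.ext rfl (by simp [slide])) }
  · exact ContinuousMap.Homotopy.refl _

lemma quasiIso_offAxisProj : QuasiIso (singularChains.map (offAxisProj W)) := by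
  refine quasiIso_singularChains_map _ (TopCat.ofHom ⟨fun x =>
    ⟨⟨(x.1, 1), pair_mem_rayCompl one_ne_zero _⟩, x.2⟩, by fun_prop⟩) ?_ ?_
  · exact
      { toFun := fun x => ⟨⟨slide 1 (x.1, x.2.1.1), slide_mem one_ne_zero x.1 x.2.1.2⟩, x.2.2⟩
        continuous_toFun := by fun_prop
        map_zero_left := fun x => Subtype.ext (Subtype.ext (Prod.ext rfl (by simp [slide])))
        map_one_left := fun x => Subtype.ext (Subtype.ext (Prod.ext rfl (by simp [slide]))) }
  · exact ContinuousMap.Homotopy.refl _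

/-- The inclusion of `offAxis W` into the complement of the positive ray. -/
def offAxisIncl (W : Type u) [NormedAddCommGroup W] :
    TopCat.of (offAxis W) ⟶ TopCat.of (rayCompl W (-1)) :=
  TopCat.ofHom ⟨fun x => ⟨x.1.1, Or.inl x.2⟩, by fun_prop⟩

/-- Excision in `W × ℝ ∖ 0`, covered by the complements of the two halves of the axis. -/
lemma nonempty_rayCompl_equiv (n : ℕ) :
    Nonempty ((pairSeq (valTop (offAxis W))).X₃.homology n ≃ₗ[ℤ]
      (pairSeq (inclTop (rayCompl_subset (W := W) (-1)))).X₃.homology n) := by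
  have hb := bijective_sumHomologyMap_relMap (F := Unit) (valTop (offAxis W))
    IsEmbedding.subtypeVal (inclTop (rayCompl_subset (W := W) (-1)))
    (isOpenEmbedding_inclusion_of_isOpen (isOpen_rayCompl _) (rayCompl_subset _))
    (fun _ => offAxisIncl W) (fun _ => inclTop (rayCompl_subset (W := W) 1)) (fun _ => rfl)
    (fun _ => isOpenEmbedding_inclusion_of_isOpen (isOpen_rayCompl _) (rayCompl_subset _))
    (by
      rintro - x ⟨y, hy⟩
      refine ⟨⟨x, ?_⟩, rfl⟩
      have hxy : y.1 = x.1 := congrArg Subtype.val hy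
      rcases x.2 with h | h
      · exact h
      · rcases y.2 with h' | h'
        · rw [hxy] at h'; exact h'
        · rw [hxy] at h'; linarith)
    (fun _ _ _ _ _ => rfl)
    (by
      refine Set.eq_univ_of_forall fun x => ?_
      by_cases h1 : x.1.1 = 0
      · have h2 : x.1.2 ≠ 0 := fun h => x.2 (Prod.ext h1 h)
        rcases h2.lt_or_gt with h | h
        · exact Or.inl ⟨⟨x.1, Or.inr (by linarith)⟩, rfl⟩
        · exact Or.inr (Set.mem_iUnion.mpr ⟨(), ⟨x.1, Or.inr (by linarith)⟩, rfl⟩)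
      · exact Or.inl ⟨⟨x.1, Or.inl h1⟩, rfl⟩) n
  exact ⟨(Finsupp.uniqueLinearEquiv ℤ _ ()).symm.trans
    (LinearEquiv.ofBijective _ hb)⟩

/-- The local homology of `W × ℝ` in degree `n + 1` is that of `W` in degree `n`. The complement of
a closed half of the axis `0 × ℝ` is contractible, so that the connecting homomorphism of the triple
for the negative half is an isomorphism, and the relative homology of `W × ℝ ∖ 0` modulo the
complement of one half is, by excision and homotopy invariance, that of `(W, W ∖ 0)`. -/
lemma localHomology_succ (n : ℕ) :
    Nonempty ((pairSeq (punctured (W × ℝ))).X₃.homology (n + 1) ≃ₗ[ℤ]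
      (pairSeq (punctured W)).X₃.homology n) := by
  obtain ⟨e1⟩ := nonempty_iso_of_triple (inclTop (rayCompl_subset (W := W) (-1)))
    (punctured (W × ℝ)) (quasiIso_rayCompl (by norm_num)) n
  obtain ⟨e2⟩ := nonempty_rayCompl_equiv (W := W) n
  have h3 : QuasiIso (relMap (f := valTop (offAxis W)) (f' := punctured W) (offAxisProj W)
      (rayProj W) rfl) := quasiIso_relMap _ _ _ quasiIso_offAxisProj quasiIso_rayProj
  have e3 : (pairSeq (valTop (offAxis W))).X₃.homology n ≅
      (pairSeq (punctured W)).X₃.homology n :=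
    asIso (HomologicalComplex.homologyMap (relMap (f := valTop (offAxis W)) (f' := punctured W)
      (offAxisProj W) (rayProj W) rfl) n)
  exact ⟨e1.toLinearEquiv.trans (e2.symm.trans e3.toLinearEquiv)⟩

/-- The local homology of an `n`-dimensional vector space at the origin is infinite cyclic in
degree `n`. -/
theorem exists_localHomology (n : ℕ) :
    ∃ (V : Type u) (_ : NormedAddCommGroup V) (_ : NormedSpace ℝ V) (_ : FiniteDimensional ℝ V),
      Module.finrank ℝ V = n ∧
        Nonempty ((pairSeq (punctured V)).X₃.homology n ≃ₗ[ℤ] ℤ) := by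
  induction n with
  | zero => exact ⟨PUnit, inferInstance, inferInstance, inferInstance,
      Module.finrank_zero_of_subsingleton, localHomology_zero⟩
  | succ n ih =>
    obtain ⟨V, _, _, _, hV, ⟨e⟩⟩ := ih
    obtain ⟨e'⟩ := localHomology_succ (W := V) n
    exact ⟨V × ℝ, inferInstance, inferInstance, inferInstance, by simp [hV], ⟨e'.trans e⟩⟩

end LocalHomology


/-! ### Lifting through the universal cover of a CW complex -/

section Lifting

variable {X : Type u} [TopologicalSpace X] {E : Type u} [TopologicalSpace E]

/-- A CW complex is a quotient of a disjoint union of copies of the spaces `Fin n → ℝ`, each of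
which is mapped to a closed cell after the radial projection to the unit ball. -/
instance locallyPathConnectedSpace_cwComplex [T2Space X] [CWComplex (Set.univ : Set X)] :
    LocallyPathConnectedSpace X := by
  let pr (n : ℕ) (v : Fin n → ℝ) : Fin n → ℝ := (max 1 ‖v‖)⁻¹ • v
  have hpos {n : ℕ} (v : Fin n → ℝ) : 0 < max 1 ‖v‖ := lt_max_of_lt_left one_pos
  have hpr (n : ℕ) : Continuous (pr n) :=
    ((continuous_const.max continuous_norm).inv₀ fun v => (hpos v).ne').smul continuous_id
  have hball (n : ℕ) (v : Fin n → ℝ) : pr n v ∈ Metric.closedBall (0 : Fin n → ℝ) 1 := by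
    rw [mem_closedBall_zero_iff, norm_smul, norm_inv, Real.norm_of_nonneg (hpos v).le,
      inv_mul_le_one₀ (hpos v)]
    exact le_max_right _ _
  have hid (n : ℕ) (v : Fin n → ℝ) (hv : v ∈ Metric.closedBall (0 : Fin n → ℝ) 1) :
      pr n v = v := by
    simp only [pr]
    rw [max_eq_left (mem_closedBall_zero_iff.mp hv), inv_one, one_smul]
  let f : (Σ c : Σ n, RelCWComplex.cell (Set.univ : Set X) n, Fin c.1 → ℝ) → X :=
    fun x => RelCWComplex.map x.1.1 x.1.2 (pr _ x.2)
  have hf : Continuous f := by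
    refine continuous_sigma fun c => ?_
    exact (RelCWComplex.continuousOn c.1 c.2).comp_continuous (hpr _) (hball _)
  have hsurj : Function.Surjective f := by
    intro x
    have hx : x ∈ ⋃ (n : ℕ) (j : RelCWComplex.cell (Set.univ : Set X) n),
        RelCWComplex.closedCell n j := by
      rw [CWComplex.union]; trivial
    simp only [Set.mem_iUnion] at hx
    obtain ⟨n, j, v, hv, rfl⟩ := hx
    exact ⟨⟨⟨n, j⟩, v⟩, congrArg _ (hid n v hv)⟩
  have hq : IsQuotientMap f := by
    refine isQuotientMap_iff_isClosed.mpr ⟨hsurj, fun A => ⟨fun h => h.preimage hf, fun h => ?_⟩⟩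
    rw [CWComplex.closed Set.univ A (Set.subset_univ _)]
    intro n j
    have h₁ : IsClosed {v : Fin n → ℝ | f ⟨⟨n, j⟩, v⟩ ∈ A} :=
      h.preimage (continuous_sigmaMk (σ := fun c : Σ n, RelCWComplex.cell (Set.univ : Set X) n =>
        Fin c.1 → ℝ) (i := ⟨n, j⟩))
    have h₂ := (((isCompact_closedBall (0 : Fin n → ℝ) 1).inter_left h₁).image_of_continuousOn
      ((RelCWComplex.continuousOn n j).mono Set.inter_subset_right)).isClosed
    convert h₂ using 1
    ext x
    constructor
    · rintro ⟨hx, v, hv, rfl⟩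
      refine ⟨v, ⟨?_, hv⟩, rfl⟩
      change RelCWComplex.map n j (pr n v) ∈ A
      rwa [hid n v hv]
    · rintro ⟨v, ⟨hv, hv'⟩, rfl⟩
      refine ⟨?_, v, hv', rfl⟩
      change RelCWComplex.map n j (pr n v) ∈ A at hv
      rwa [hid n v hv'] at hv
  exact hq.locallyPathConnectedSpace

theorem locallyPathConnectedSpace_of_isLocalHomeomorph [LocallyPathConnectedSpace X] {p : E → X}
    (hp : IsLocalHomeomorph p) : LocallyPathConnectedSpace E := by
  choose U hU hU' using isLocalHomeomorph_iff_isOpenEmbedding_restrict.mp hp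
  have (e : E) : LocallyPathConnectedSpace (U e) := (hU' e).locallyPathConnectedSpace
  have hU₀ (e : E) : IsOpen (interior (U e)) := isOpen_interior
  have (e : E) : LocallyPathConnectedSpace (interior (U e)) :=
    (isOpenEmbedding_inclusion_of_isOpen (hU₀ e) interior_subset).locallyPathConnectedSpace
  let f : (Σ e : E, interior (U e)) → E := fun x => x.2.1
  have hf : IsOpenMap f := isOpenMap_sigma.mpr fun e => (hU₀ e).isOpenMap_subtype_val
  have hf' : Continuous f := continuous_sigma fun e => continuous_subtype_val
  have hsurj : Function.Surjective f := fun e =>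
    ⟨⟨e, e, mem_interior_iff_mem_nhds.mpr (hU e)⟩, rfl⟩
  exact (hf.isQuotientMap hf' hsurj).locallyPathConnectedSpace

theorem surjective_of_isCoveringMap {p : E → X} (hp : IsCoveringMap p)
    [LocallyPathConnectedSpace X] [ConnectedSpace X] [Nonempty E] : Function.Surjective p := by
  intro x
  have := PathConnectedSpace.of_locallyPathConnectedSpace (X := X)
  obtain ⟨e⟩ := ‹Nonempty E›
  let γ := PathConnectedSpace.somePath (p e) x
  refine ⟨hp.liftPath γ.toContinuousMap e γ.source 1, ?_⟩
  exact (congrFun (hp.liftPath_lifts γ.toContinuousMap e γ.source) 1).trans γ.target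

theorem eq_of_deckGroup_apply_eq {p : E → X} (hp : IsCoveringMap p) [PreconnectedSpace E]
    {d d' : deckGroup p} {e : E}
    (h : d.1 e = d'.1 e) : d = d' := by
  refine Subtype.ext (Homeomorph.ext fun x => ?_)
  refine congrFun (hp.eq_of_comp_eq d.1.continuous d'.1.continuous ?_ e h) x
  funext y
  exact (d.2 y).trans (d'.2 y).symm

/-- A simply connected covering space is normal. -/
theorem exists_deckGroup_apply_eq {p : E → X} (hp : IsCoveringMap p)
    [LocallyPathConnectedSpace X] [SimplyConnectedSpace E] {e e' : E}
    (h : p e = p e') : ∃ d : deckGroup p, d.1 e = e' := by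
  have := locallyPathConnectedSpace_of_isLocalHomeomorph hp.isLocalHomeomorph
  obtain ⟨f, ⟨hf, hf'⟩, -⟩ :=
    hp.existsUnique_continuousMap_lifts ⟨p, hp.continuous⟩ e e' h.symm
  obtain ⟨g, ⟨hg, hg'⟩, -⟩ :=
    hp.existsUnique_continuousMap_lifts ⟨p, hp.continuous⟩ e' e h
  have hfg : g ∘ f = id := hp.eq_of_comp_eq (g.continuous.comp f.continuous) continuous_id
    (by rw [← Function.comp_assoc, hg']; exact hf') e (by simp [hf, hg])
  have hgf : f ∘ g = id := hp.eq_of_comp_eq (f.continuous.comp g.continuous) continuous_id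
    (by rw [← Function.comp_assoc, hf']; exact hg') e' (by simp [hf, hg])
  exact ⟨⟨⟨⟨f, g, congrFun hfg, congrFun hgf⟩, f.continuous, g.continuous⟩, congrFun hf'⟩, hf⟩

end Lifting


/-! ### The open cells of the universal cover -/

section Cells

variable {X : Type u} [TopologicalSpace X] [CWComplex (Set.univ : Set X)]
  {V : Type u} [TopologicalSpace V] {n : ℕ} (h : V ≃ₜ Metric.ball (0 : Fin n → ℝ) 1)
  (c : RelCWComplex.cell (Set.univ : Set X) n)

/-- The characteristic map of the `n`-cell `c`, on its interior, with the open unit ball replaced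
by a space `V` homeomorphic to it. -/
def cellChart : C(V, X) where
  toFun v := RelCWComplex.map n c (h v).1
  continuous_toFun := (RelCWComplex.continuousOn n c).comp_continuous
    (continuous_subtype_val.comp h.continuous) fun v => Metric.ball_subset_closedBall (h v).2

theorem cellChart_mem_openCell (v : V) : cellChart h c v ∈ RelCWComplex.openCell n c :=
  ⟨(h v).1, (h v).2, rfl⟩

theorem exists_cellChart_eq {x : X} (hx : x ∈ RelCWComplex.openCell n c) :
    ∃ v, cellChart h c v = x := by
  obtain ⟨y, hy, rfl⟩ := hx
  exact ⟨h.symm ⟨y, hy⟩, by simp [cellChart]⟩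

theorem isEmbedding_cellChart : IsEmbedding (cellChart h c) := by
  let f : V → (RelCWComplex.map n c).target := fun v => ⟨cellChart h c v,
    (RelCWComplex.map n c).map_source (by rw [RelCWComplex.source_eq]; exact (h v).2)⟩
  let g : (RelCWComplex.map n c).target → V := fun x => h.symm ⟨(RelCWComplex.map n c).symm x.1, by
    rw [← RelCWComplex.source_eq n c]; exact (RelCWComplex.map n c).map_target x.2⟩
  have hg : Continuous g := h.symm.continuous.comp
    ((RelCWComplex.continuousOn_symm n c).comp_continuous continuous_subtype_val
      (fun x => x.2) |>.subtype_mk _)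
  have hf : Continuous f := (cellChart h c).continuous.subtype_mk _
  have hgf : Function.LeftInverse g f := by
    intro v
    change h.symm ⟨(RelCWComplex.map n c).symm (RelCWComplex.map n c (h v).1), _⟩ = v
    refine (h.symm_apply_eq).mpr (Subtype.ext ?_)
    exact (RelCWComplex.map n c).left_inv (by rw [RelCWComplex.source_eq]; exact (h v).2)
  exact IsEmbedding.subtypeVal.comp (hgf.isEmbedding hg hf)

theorem eq_of_mem_openCell {c c' : RelCWComplex.cell (Set.univ : Set X) n}
    {x : X} (hx : x ∈ RelCWComplex.openCell n c) (hx' : x ∈ RelCWComplex.openCell n c') :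
    c = c' := by
  have := RelCWComplex.eq_of_not_disjoint_openCell (Set.not_disjoint_iff.mpr ⟨x, hx, hx'⟩)
  simpa using this

theorem mem_closedCell_iff {x : X} :
    x ∈ RelCWComplex.closedCell n c ↔
      x ∈ RelCWComplex.cellFrontier n c ∨ x ∈ RelCWComplex.openCell n c := by
  rw [← RelCWComplex.cellFrontier_union_openCell_eq_closedCell]
  rfl

variable [T2Space X]

theorem notMem_skeletonLT_of_mem_openCell {m : ℕ} {c : RelCWComplex.cell (Set.univ : Set X) m}
    {x : X} (hx : x ∈ RelCWComplex.openCell m c) :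
    x ∉ (CWComplex.skeletonLT (Set.univ : Set X) (m : ℕ∞) : Set X) := fun h =>
  Set.disjoint_left.mp (RelCWComplex.disjoint_skeletonLT_openCell le_rfl) h hx

/-- The `n`-skeleton is the union of the `(n - 1)`-skeleton and of the closed `n`-cells. -/
theorem mem_skeletonLT_succ_iff {x : X} :
    x ∈ (CWComplex.skeletonLT (Set.univ : Set X) ((n + 1 : ℕ) : ℕ∞) : Set X) ↔
      x ∈ (CWComplex.skeletonLT (Set.univ : Set X) (n : ℕ∞) : Set X) ∨
        ∃ c : RelCWComplex.cell (Set.univ : Set X) n, x ∈ RelCWComplex.closedCell n c := by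
  have h := RelCWComplex.skeletonLT_union_iUnion_closedCell_eq_skeletonLT_succ
    (C := (Set.univ : Set X)) n
  rw [Nat.cast_succ, ← h, Set.mem_union, Set.mem_iUnion]

/-- If there are finitely many `n`-cells, each of them is open in the `n`-skeleton. -/
theorem isOpen_preimage_openCell [Finite (RelCWComplex.cell (Set.univ : Set X) n)] :
    IsOpen ((Subtype.val : (CWComplex.skeletonLT (Set.univ : Set X) ((n + 1 : ℕ) : ℕ∞) : Set X) → X)
      ⁻¹' RelCWComplex.openCell n c) := by
  have hK : IsClosed ((CWComplex.skeletonLT (Set.univ : Set X) (n : ℕ∞) : Set X) ∪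
      ⋃ c' : {c' // c' ≠ c}, RelCWComplex.closedCell n c'.1) :=
    (CWComplex.skeletonLT (Set.univ : Set X) (n : ℕ∞)).closed.union
      (isClosed_iUnion_of_finite fun _ => RelCWComplex.isClosed_closedCell)
  rw [← isClosed_compl_iff]
  convert hK.preimage continuous_subtype_val using 1
  ext x
  constructor
  · intro hx
    rcases mem_skeletonLT_succ_iff.mp x.2 with h | ⟨c', h⟩
    · exact Or.inl h
    · rcases (mem_closedCell_iff c').mp h with h' | h'
      · exact Or.inl (RelCWComplex.cellFrontier_subset_skeletonLT n c' h')
      · refine Or.inr (Set.mem_iUnion.mpr ⟨⟨c', ?_⟩, h⟩)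
        rintro rfl
        exact hx h'
  · rintro (h | h) hx
    · exact notMem_skeletonLT_of_mem_openCell hx h
    · obtain ⟨c', h⟩ := Set.mem_iUnion.mp h
      rcases (mem_closedCell_iff c'.1).mp h with h' | h'
      · exact notMem_skeletonLT_of_mem_openCell hx
          (RelCWComplex.cellFrontier_subset_skeletonLT n c'.1 h')
      · exact c'.2 (eq_of_mem_openCell h' hx)

/-- The interior of an `n`-cell as an open subspace of the `n`-skeleton. -/
theorem isOpenEmbedding_cellChart [Finite (RelCWComplex.cell (Set.univ : Set X) n)]
    (hc : ∀ v, cellChart h c v ∈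
      (CWComplex.skeletonLT (Set.univ : Set X) ((n + 1 : ℕ) : ℕ∞) : Set X)) :
    IsOpenEmbedding (Set.codRestrict (cellChart h c) _ hc) := by
  refine ⟨(isEmbedding_cellChart h c).codRestrict _ hc, ?_⟩
  convert isOpen_preimage_openCell c using 1
  ext x
  constructor
  · rintro ⟨v, rfl⟩
    exact cellChart_mem_openCell h c v
  · intro hx
    obtain ⟨v, hv⟩ := exists_cellChart_eq h c hx
    exact ⟨v, Subtype.ext hv⟩

end Cells

/-! ### The radial deformation of the `n`-skeleton without the centres of the `n`-cells -/

section Radial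

/-- Continuity can be tested after pulling back along a closed map. -/
theorem continuousOn_inter_range_of_isClosedMap {Z X T : Type*} [TopologicalSpace Z]
    [TopologicalSpace X] [TopologicalSpace T] {f : Z → X} (hf : IsClosedMap f) {g : X → T}
    {s : Set X} (h : ContinuousOn (g ∘ f) (f ⁻¹' s)) : ContinuousOn g (s ∩ Set.range f) := by
  rw [continuousOn_iff_isClosed] at h ⊢
  intro C hC
  obtain ⟨D, hD, hD'⟩ := h C hC
  refine ⟨f '' D, hf D hD, ?_⟩
  ext x
  constructor
  · rintro ⟨hx, hxs, z, rfl⟩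
    exact ⟨⟨z, (hD'.subset ⟨hx, hxs⟩).1, rfl⟩, hxs, z, rfl⟩
  · rintro ⟨⟨z, hz, rfl⟩, hxs, h⟩
    exact ⟨(hD'.symm.subset ⟨hz, hxs⟩).1, hxs, h⟩

theorem continuousOn_of_finite_closed_cover {κ X T : Type*} [Finite κ] [TopologicalSpace X]
    [TopologicalSpace T] {P : κ → Set X} (hP : ∀ k, IsClosed (P k)) {g : X → T} {s : Set X}
    (hs : s ⊆ ⋃ k, P k) (h : ∀ k, ContinuousOn g (s ∩ P k)) : ContinuousOn g s := by
  simp only [continuousOn_iff_isClosed] at h ⊢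
  intro C hC
  choose D hD hD' using fun k => h k C hC
  refine ⟨⋃ k, D k ∩ P k, isClosed_iUnion_of_finite fun k => (hD k).inter (hP k), ?_⟩
  ext x
  constructor
  · rintro ⟨hx, hxs⟩
    obtain ⟨k, hk⟩ := Set.mem_iUnion.mp (hs hxs)
    exact ⟨Set.mem_iUnion.mpr ⟨k, ((hD' k).subset ⟨hx, hxs, hk⟩).1, hk⟩, hxs⟩
  · rintro ⟨hx, hxs⟩
    obtain ⟨k, hk, hk'⟩ := Set.mem_iUnion.mp hx
    exact ⟨((hD' k).symm.subset ⟨hk, hxs, hk'⟩).1, hxs⟩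

/-- The point of the segment from `v` to `‖v‖⁻¹ • v` with parameter `t`. -/
def radialPush {n : ℕ} (t : ℝ) (v : Fin n → ℝ) : Fin n → ℝ := ((1 - t) + t * ‖v‖⁻¹) • v

theorem norm_radialPush {n : ℕ} {t : ℝ} (ht : 0 ≤ t) (ht' : t ≤ 1) {v : Fin n → ℝ} (hv : v ≠ 0) :
    ‖radialPush t v‖ = (1 - t) * ‖v‖ + t := by
  have hv' : 0 < ‖v‖ := norm_pos_iff.mpr hv
  have : 0 ≤ (1 - t) + t * ‖v‖⁻¹ := add_nonneg (by linarith) (mul_nonneg ht (inv_nonneg.mpr hv'.le))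
  rw [radialPush, norm_smul, Real.norm_of_nonneg this]
  field_simp

theorem radialPush_eq_self {n : ℕ} (t : ℝ) {v : Fin n → ℝ} (hv : ‖v‖ = 1) :
    radialPush t v = v := by simp [radialPush, hv]

variable {X : Type u} [TopologicalSpace X] [CWComplex (Set.univ : Set X)] (n : ℕ)

variable (X) in
/-- The centres of the `n`-cells. -/
def cellCentres : Set X :=
  Set.range fun c : RelCWComplex.cell (Set.univ : Set X) n => RelCWComplex.map n c 0

open Classical in
/-- The radial deformation which pushes the points of the open `n`-cells other than their centres
to the boundaries of the cells. It has a junk value at the centres. -/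
def pushOut (x : unitInterval × X) : X :=
  if h : ∃ c : RelCWComplex.cell (Set.univ : Set X) n, x.2 ∈ RelCWComplex.openCell n c then
    RelCWComplex.map n h.choose (radialPush x.1.1 ((RelCWComplex.map n h.choose).symm x.2))
  else x.2

variable {n} [T2Space X]

theorem pushOut_of_mem_skeletonLT (t : unitInterval) {x : X}
    (hx : x ∈ (CWComplex.skeletonLT (Set.univ : Set X) (n : ℕ∞) : Set X)) :
    pushOut n (t, x) = x :=
  dif_neg fun ⟨_, h⟩ => notMem_skeletonLT_of_mem_openCell h hx

theorem map_mem_skeletonLT_of_norm_eq_one (c : RelCWComplex.cell (Set.univ : Set X) n)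
    {v : Fin n → ℝ} (hv : ‖v‖ = 1) :
    RelCWComplex.map n c v ∈ (CWComplex.skeletonLT (Set.univ : Set X) (n : ℕ∞) : Set X) :=
  RelCWComplex.cellFrontier_subset_skeletonLT n c ⟨v, by simpa using hv, rfl⟩

theorem pushOut_map (t : unitInterval) (c : RelCWComplex.cell (Set.univ : Set X) n)
    {v : Fin n → ℝ} (hv : ‖v‖ ≤ 1) :
    pushOut n (t, RelCWComplex.map n c v) = RelCWComplex.map n c (radialPush t.1 v) := by
  rcases hv.lt_or_eq with h | h
  · have hv' : v ∈ Metric.ball (0 : Fin n → ℝ) 1 := mem_ball_zero_iff.mpr h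
    have hc : RelCWComplex.map n c v ∈ RelCWComplex.openCell n c := ⟨v, hv', rfl⟩
    have hex : ∃ c' : RelCWComplex.cell (Set.univ : Set X) n,
        RelCWComplex.map n c v ∈ RelCWComplex.openCell n c' := ⟨c, hc⟩
    have hch : hex.choose = c := eq_of_mem_openCell hex.choose_spec hc
    refine (dif_pos hex).trans ?_
    rw [hch, (RelCWComplex.map n c).left_inv (by rwa [RelCWComplex.source_eq])]
  · rw [pushOut_of_mem_skeletonLT t (map_mem_skeletonLT_of_norm_eq_one c h), radialPush_eq_self _ h]

theorem notMem_cellCentres_of_mem_skeletonLT {x : X}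
    (hx : x ∈ (CWComplex.skeletonLT (Set.univ : Set X) (n : ℕ∞) : Set X)) :
    x ∉ cellCentres X n := by
  rintro ⟨c, rfl⟩
  exact notMem_skeletonLT_of_mem_openCell (RelCWComplex.map_zero_mem_openCell n c) hx

theorem map_notMem_cellCentres (c : RelCWComplex.cell (Set.univ : Set X) n)
    {v : Fin n → ℝ} (hv : ‖v‖ ≤ 1) (hv0 : v ≠ 0) :
    RelCWComplex.map n c v ∉ cellCentres X n := by
  rcases hv.lt_or_eq with h | h
  · rintro ⟨c', hc'⟩
    have hc : RelCWComplex.map n c v ∈ RelCWComplex.openCell n c :=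
      ⟨v, mem_ball_zero_iff.mpr h, rfl⟩
    obtain rfl : c' = c := eq_of_mem_openCell
      (by rw [← hc']; exact RelCWComplex.map_zero_mem_openCell n c') hc
    refine hv0 ((RelCWComplex.map n c').injOn ?_ ?_ hc').symm
    · rw [RelCWComplex.source_eq]; simp
    · rw [RelCWComplex.source_eq]; exact mem_ball_zero_iff.mpr h
  · exact notMem_cellCentres_of_mem_skeletonLT (map_mem_skeletonLT_of_norm_eq_one c h)

variable (X n) in
/-- The `n`-skeleton without the centres of the `n`-cells. -/
def puncturedSkeleton : Set X :=
  (CWComplex.skeletonLT (Set.univ : Set X) ((n + 1 : ℕ) : ℕ∞) : Set X) \ cellCentres X n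

theorem skeletonLT_subset_puncturedSkeleton :
    (CWComplex.skeletonLT (Set.univ : Set X) (n : ℕ∞) : Set X) ⊆ puncturedSkeleton X n :=
  fun _ hx => ⟨mem_skeletonLT_succ_iff.mpr (Or.inl hx), notMem_cellCentres_of_mem_skeletonLT hx⟩

theorem map_mem_puncturedSkeleton (c : RelCWComplex.cell (Set.univ : Set X) n)
    {v : Fin n → ℝ} (hv : ‖v‖ ≤ 1) (hv0 : v ≠ 0) :
    RelCWComplex.map n c v ∈ puncturedSkeleton X n :=
  ⟨mem_skeletonLT_succ_iff.mpr (Or.inr ⟨c, v, mem_closedBall_zero_iff.mpr hv, rfl⟩),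
    map_notMem_cellCentres c hv hv0⟩

theorem mem_puncturedSkeleton_cases {x : X} (hx : x ∈ puncturedSkeleton X n) :
    x ∈ (CWComplex.skeletonLT (Set.univ : Set X) (n : ℕ∞) : Set X) ∨
      ∃ (c : RelCWComplex.cell (Set.univ : Set X) n) (v : Fin n → ℝ), ‖v‖ ≤ 1 ∧ v ≠ 0 ∧
        RelCWComplex.map n c v = x := by
  rcases mem_skeletonLT_succ_iff.mp hx.1 with h | ⟨c, v, hv, rfl⟩
  · exact Or.inl h
  · refine Or.inr ⟨c, v, mem_closedBall_zero_iff.mp hv, ?_, rfl⟩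
    rintro rfl
    exact hx.2 ⟨c, rfl⟩

theorem norm_radialPush_le {t : unitInterval} {v : Fin n → ℝ} (hv : ‖v‖ ≤ 1) (hv0 : v ≠ 0) :
    ‖radialPush t.1 v‖ ≤ 1 := by
  rw [norm_radialPush t.2.1 t.2.2 hv0]
  nlinarith [t.2.1, t.2.2]

theorem radialPush_ne_zero {t : unitInterval} {v : Fin n → ℝ} (hv0 : v ≠ 0) :
    radialPush t.1 v ≠ 0 := by
  rw [← norm_ne_zero_iff, norm_radialPush t.2.1 t.2.2 hv0]
  have hv' : 0 < ‖v‖ := norm_pos_iff.mpr hv0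
  rcases t.2.2.lt_or_eq with h | h
  · have := mul_pos (sub_pos.mpr h) hv'
    linarith [t.2.1]
  · rw [h]; simp

theorem pushOut_mem (t : unitInterval) {x : X} (hx : x ∈ puncturedSkeleton X n) :
    pushOut n (t, x) ∈ puncturedSkeleton X n := by
  rcases mem_puncturedSkeleton_cases hx with h | ⟨c, v, hv, hv0, rfl⟩
  · rw [pushOut_of_mem_skeletonLT t h]
    exact hx
  · rw [pushOut_map t c hv]
    exact map_mem_puncturedSkeleton c (norm_radialPush_le hv hv0) (radialPush_ne_zero hv0)

theorem pushOut_zero {x : X} (hx : x ∈ puncturedSkeleton X n) : pushOut n (0, x) = x := by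
  rcases mem_puncturedSkeleton_cases hx with h | ⟨c, v, hv, hv0, rfl⟩
  · exact pushOut_of_mem_skeletonLT 0 h
  · rw [pushOut_map 0 c hv]
    simp [radialPush]

theorem pushOut_one_mem {x : X} (hx : x ∈ puncturedSkeleton X n) :
    pushOut n (1, x) ∈ (CWComplex.skeletonLT (Set.univ : Set X) (n : ℕ∞) : Set X) := by
  rcases mem_puncturedSkeleton_cases hx with h | ⟨c, v, hv, hv0, rfl⟩
  · rwa [pushOut_of_mem_skeletonLT 1 h]
  · rw [pushOut_map 1 c hv]
    refine map_mem_skeletonLT_of_norm_eq_one c ?_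
    refine (norm_radialPush zero_le_one le_rfl hv0).trans ?_
    ring

theorem continuousOn_pushOut [Finite (RelCWComplex.cell (Set.univ : Set X) n)] :
    ContinuousOn (pushOut (X := X) n) (Set.univ ×ˢ puncturedSkeleton X n) := by
  let P : Option (RelCWComplex.cell (Set.univ : Set X) n) → Set (unitInterval × X) := fun k =>
    k.elim (Set.univ ×ˢ (CWComplex.skeletonLT (Set.univ : Set X) (n : ℕ∞) : Set X))
      fun c => Set.univ ×ˢ RelCWComplex.closedCell n c
  refine continuousOn_of_finite_closed_cover (P := P) ?_ ?_ ?_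
  · rintro (_ | c)
    · exact isClosed_univ.prod (CWComplex.skeletonLT (Set.univ : Set X) (n : ℕ∞)).closed
    · exact isClosed_univ.prod RelCWComplex.isClosed_closedCell
  · rintro ⟨t, x⟩ ⟨-, hx⟩
    rcases mem_skeletonLT_succ_iff.mp hx.1 with h | ⟨c, h⟩
    · exact Set.mem_iUnion.mpr ⟨none, trivial, h⟩
    · exact Set.mem_iUnion.mpr ⟨some c, trivial, h⟩
  · rintro (_ | c)
    · refine continuous_snd.continuousOn.congr ?_
      rintro ⟨t, x⟩ ⟨-, -, hx⟩
      exact pushOut_of_mem_skeletonLT t hx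
    · let f₀ : Metric.closedBall (0 : Fin n → ℝ) 1 → X := fun v => RelCWComplex.map n c v
      have hf₀ : Continuous f₀ := continuousOn_iff_continuous_domRestrict.mp
        (RelCWComplex.continuousOn n c)
      let f : unitInterval × Metric.closedBall (0 : Fin n → ℝ) 1 → unitInterval × X :=
        fun z => (z.1, f₀ z.2)
      have : CompactSpace (Metric.closedBall (0 : Fin n → ℝ) 1) :=
        isCompact_iff_compactSpace.mp (isCompact_closedBall _ _)
      have hf : Continuous f := continuous_fst.prodMk (hf₀.comp continuous_snd)
      have hfc : IsClosedMap f := hf.isClosedMap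
      have hrange : P (some c) = Set.range f := by
        ext ⟨t, x⟩
        constructor
        · rintro ⟨-, v, hv, hx⟩
          exact ⟨(t, ⟨v, hv⟩), Prod.ext rfl hx⟩
        · rintro ⟨⟨t', v⟩, hx⟩
          exact ⟨trivial, v.1, v.2, congrArg Prod.snd hx⟩
      rw [hrange]
      refine continuousOn_inter_range_of_isClosedMap hfc ?_
      have hcont : ContinuousOn (fun z : unitInterval × Metric.closedBall (0 : Fin n → ℝ) 1 =>
          RelCWComplex.map n c (radialPush z.1.1 z.2.1)) {z | z.2.1 ≠ 0} := by
        refine (RelCWComplex.continuousOn n c).comp ?_ ?_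
        · have h₁ : ContinuousOn (fun z : unitInterval × Metric.closedBall (0 : Fin n → ℝ) 1 =>
              ‖z.2.1‖⁻¹) {z | z.2.1 ≠ 0} :=
            ContinuousOn.inv₀ (by fun_prop) fun z hz => norm_ne_zero_iff.mpr hz
          have h₂ : Continuous (fun z : unitInterval × Metric.closedBall (0 : Fin n → ℝ) 1 =>
              z.1.1) := by fun_prop
          have h₃ : Continuous (fun z : unitInterval × Metric.closedBall (0 : Fin n → ℝ) 1 =>
              z.2.1) := by fun_prop
          exact ((continuous_const.sub h₂).continuousOn.add (h₂.continuousOn.mul h₁)).smul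
            h₃.continuousOn
        · intro z hz
          exact mem_closedBall_zero_iff.mpr
            (norm_radialPush_le (mem_closedBall_zero_iff.mp z.2.2) hz)
      refine (hcont.mono ?_).congr ?_
      · rintro ⟨t, v⟩ ⟨-, hz⟩ h0
        refine hz.2 ⟨c, ?_⟩
        change _ = RelCWComplex.map n c v.1
        rw [show v.1 = 0 from h0]
      · rintro ⟨t, v⟩ -
        exact pushOut_map t c (mem_closedBall_zero_iff.mp v.2)

end Radial


/-! ### The cellular chains of the universal cover are free over the deck group -/

section CoverDeformation

variable {X : Type u} [TopologicalSpace X] [T2Space X] [CWComplex (Set.univ : Set X)]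
  {E : Type u}

/-- The part of `E` over the `n`-skeleton of `X` without the centres of the `n`-cells. -/
def puncturedCover (p : E → X) (n : ℕ) : Set E := p ⁻¹' puncturedSkeleton X n

theorem coverSkeleton_subset_puncturedCover (p : E → X) (n : ℕ) :
    coverSkeleton p n ⊆ puncturedCover p n :=
  Set.preimage_mono skeletonLT_subset_puncturedSkeleton

theorem puncturedCover_subset (p : E → X) (n : ℕ) :
    puncturedCover p n ⊆ coverSkeleton p (n + 1) :=
  Set.preimage_mono Set.sdiff_subset

variable [TopologicalSpace E]

/-- The radial deformation of the punctured `n`-skeleton lifts to the covering space. -/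
theorem exists_lift_pushOut {p : E → X} (hp : IsCoveringMap p) (n : ℕ)
    [Finite (RelCWComplex.cell (Set.univ : Set X) n)] :
    ∃ L : C(unitInterval × puncturedCover p n, E),
      (∀ x, p (L x) = pushOut n (x.1, p x.2.1)) ∧ (∀ e, L (0, e) = e.1) ∧
        ∀ t, ∀ e : puncturedCover p n, e.1 ∈ coverSkeleton p n → L (t, e) = e.1 := by
  have hc : Continuous fun x : unitInterval × puncturedCover p n => pushOut n (x.1, p x.2.1) :=
    continuousOn_pushOut.comp_continuous (f := fun x : unitInterval × puncturedCover p n =>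
      (x.1, p x.2.1)) (continuous_fst.prodMk
        (hp.continuous.comp (continuous_subtype_val.comp continuous_snd)))
      fun x => ⟨trivial, x.2.2⟩
  let K : C(unitInterval × puncturedCover p n, X) := ⟨_, hc⟩
  have h0 : ∀ e : puncturedCover p n, K (0, e) = p ((⟨Subtype.val, continuous_subtype_val⟩ :
    C(puncturedCover p n, E)) e) := fun e => pushOut_zero e.2
  refine ⟨hp.liftHomotopy K _ h0, fun x => congrFun (hp.liftHomotopy_lifts K _ h0) x,
    hp.liftHomotopy_zero K _ h0, fun t e he => ?_⟩
  -- over the `(n - 1)`-skeleton the path to be lifted is constant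
  let γ : C(unitInterval, X) := K.comp ((ContinuousMap.id unitInterval).prodMk (.const _ e))
  have hγ : γ = .const _ (p e.1) := by
    ext s
    exact pushOut_of_mem_skeletonLT s he
  have h : ContinuousMap.const unitInterval e.1 = hp.liftPath γ e.1 (h0 e) :=
    (hp.eq_liftPath_iff' _).mpr ⟨by rw [hγ]; rfl, rfl⟩
  exact (DFunLike.congr_fun h t).symm

theorem quasiIso_inclTop_puncturedCover {p : E → X} (hp : IsCoveringMap p) (n : ℕ)
    [Finite (RelCWComplex.cell (Set.univ : Set X) n)] :
    QuasiIso (singularChains.map (inclTop (coverSkeleton_subset_puncturedCover p n))) := by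
  obtain ⟨L, hL, hL0, hL1⟩ := exists_lift_pushOut hp n
  let r : TopCat.of (puncturedCover p n) ⟶ TopCat.of (coverSkeleton p n) :=
    TopCat.ofHom ⟨fun e => ⟨L (1, e), Set.mem_preimage.mpr (by
      rw [hL]
      exact pushOut_one_mem e.2)⟩, by fun_prop⟩
  have hr : inclTop (coverSkeleton_subset_puncturedCover p n) ≫ r = 𝟙 _ := by
    ext e
    exact hL1 1 _ e.2
  refine quasiIso_singularChains_map _ r (hr ▸ ContinuousMap.Homotopy.refl _)
    (ContinuousMap.Homotopy.symm ?_)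
  exact {
    toFun := fun x => (⟨L x, Set.mem_preimage.mpr (by
      rw [hL]
      exact pushOut_mem _ x.2.2)⟩ : puncturedCover p n)
    continuous_toFun := L.continuous.subtype_mk _
    map_zero_left := fun e => Subtype.ext (hL0 e)
    map_one_left := fun e => rfl }

end CoverDeformation

section FreeCells

lemma homologyMap_comp_apply {K L M : ChainComplex (ModuleCat.{u} ℤ) ℕ} (φ : K ⟶ L) (ψ : L ⟶ M)
    {n : ℕ} (x : K.homology n) : (HomologicalComplex.homologyMap (φ ≫ ψ) n).hom x =
      (HomologicalComplex.homologyMap ψ n).hom ((HomologicalComplex.homologyMap φ n).hom x) :=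
  congrArg (fun θ => θ.hom x) (HomologicalComplex.homologyMap_comp φ ψ n)

variable {X : Type u} [TopologicalSpace X] [T2Space X] [CWComplex (Set.univ : Set X)]
  {E : Type u} [TopologicalSpace E]

theorem exists_lift_cellChart [SimplyConnectedSpace E] [ConnectedSpace X] {p : E → X}
    (hp : IsCoveringMap p) {V : Type u} [NormedAddCommGroup V] [NormedSpace ℝ V] {n : ℕ}
    (h : V ≃ₜ Metric.ball (0 : Fin n → ℝ) 1) (c : RelCWComplex.cell (Set.univ : Set X) n) :
    ∃ φ : C(V, E), ∀ v, p (φ v) = cellChart h c v := by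
  obtain ⟨e, he⟩ := surjective_of_isCoveringMap hp (cellChart h c 0)
  obtain ⟨φ, ⟨-, hφ⟩, -⟩ := hp.existsUnique_continuousMap_lifts (cellChart h c) 0 e he
  exact ⟨φ, congrFun hφ⟩

theorem exists_homeomorph_ball {V : Type u} [NormedAddCommGroup V] [NormedSpace ℝ V]
    [FiniteDimensional ℝ V] {n : ℕ} (hV : Module.finrank ℝ V = n) :
    ∃ h : V ≃ₜ Metric.ball (0 : Fin n → ℝ) 1, (h 0).1 = 0 := by
  let e : V ≃L[ℝ] (Fin n → ℝ) := ContinuousLinearEquiv.ofFinrankEq (by simp [hV])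
  exact ⟨e.toHomeomorph.trans Homeomorph.unitBall, by simp⟩

/-- The action of a deck transformation on the punctured `n`-skeleton. -/
def deckPunctured {p : E → X} (d : deckGroup p) (n : ℕ) :
    TopCat.of (puncturedCover p n) ⟶ TopCat.of (puncturedCover p n) :=
  TopCat.ofHom ⟨fun e => ⟨d.1 e.1, Set.mem_preimage.mpr (by
    have h : p (d.1 e.1) = p e.1 := d.2 e.1
    rw [h]
    exact e.2)⟩, (d.1.continuous.comp continuous_subtype_val).subtype_mk _⟩

/-- The homology of the pair `(Y, U)`, where `Y` is the preimage of the `n`-skeleton and `U` is the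
preimage of the `n`-skeleton without the centres of the `n`-cells, is, by excision, a direct sum
of copies of `H_n(V, V ∖ 0) = ℤ`, one for each lift to `E` of an `n`-cell. The deck group permutes
these lifts simply transitively over each cell. -/
theorem exists_basis_punctured [SimplyConnectedSpace E] [ConnectedSpace X] {p : E → X}
    (hp : IsCoveringMap p) (n : ℕ) [Finite (RelCWComplex.cell (Set.univ : Set X) n)] :
    ∃ b : Module.Basis (deckGroup p × RelCWComplex.cell (Set.univ : Set X) n) ℤ
        ((pairSeq (inclTop (puncturedCover_subset p n))).X₃.homology n),
      ∀ d d' c, (HomologicalComplex.homologyMap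
        (relMap (f := inclTop (puncturedCover_subset p n))
          (f' := inclTop (puncturedCover_subset p n)) (deckPunctured d n)
          ((deckFiltration p d).app (n + 1)) rfl) n).hom (b (d', c)) = b (d * d', c) := by
  obtain ⟨V, _, _, _, hV, ⟨g⟩⟩ := exists_localHomology.{u} n
  obtain ⟨h, h0⟩ := exists_homeomorph_ball hV
  -- the lifts of the cell `c` are the maps `d ∘ φ c` for `d` in the deck group
  choose φ hφ using fun c => exists_lift_cellChart hp h c
  have hmem : ∀ c v, cellChart h c v ∈
      (CWComplex.skeletonLT (Set.univ : Set X) ((n + 1 : ℕ) : ℕ∞) : Set X) := fun c v =>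
    mem_skeletonLT_succ_iff.mpr (Or.inr ⟨c, RelCWComplex.openCell_subset_closedCell n c
      (cellChart_mem_openCell h c v)⟩)
  have hdφ (d : deckGroup p) (c) (v) : p (d.1 (φ c v)) = cellChart h c v :=
    (d.2 _).trans (hφ c v)
  let F := deckGroup p × RelCWComplex.cell (Set.univ : Set X) n
  let φ' : F → (TopCat.of V ⟶ TopCat.of (coverSkeleton p (n + 1))) := fun f =>
    TopCat.ofHom ⟨fun v => ⟨f.1.1 (φ f.2 v), Set.mem_preimage.mpr (by
      rw [hdφ]; exact hmem _ v)⟩,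
      (f.1.1.continuous.comp (φ f.2).continuous).subtype_mk _⟩
  have hnc : ∀ (c) (v : V), v ≠ 0 → cellChart h c v ∉ cellCentres X n := by
    intro c v hv
    refine map_notMem_cellCentres c (mem_ball_zero_iff.mp (h v).2).le fun h' => hv ?_
    exact h.injective (Subtype.ext (h'.trans h0.symm))
  let α : F → (TopCat.of ({0}ᶜ : Set V) ⟶ TopCat.of (puncturedCover p n)) := fun f =>
    TopCat.ofHom ⟨fun v => ⟨f.1.1 (φ f.2 v.1), Set.mem_preimage.mpr (by
      rw [hdφ]; exact ⟨hmem _ v.1, hnc _ _ v.2⟩)⟩,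
      (f.1.1.continuous.comp ((φ f.2).continuous.comp continuous_subtype_val)).subtype_mk _⟩
  have hopen (f : F) : IsOpenEmbedding (φ' f) := by
    -- a lift of an open embedding through a local homeomorphism is an open embedding
    have h₁ := (hp.restrictPreimage (CWComplex.skeletonLT (Set.univ : Set X)
      ((n + 1 : ℕ) : ℕ∞) : Set X)).isLocalHomeomorph
    refine h₁.isOpenEmbedding_of_comp ?_ (φ' f).hom.continuous
    convert isOpenEmbedding_cellChart h f.2 (hmem f.2) using 1
    funext v
    exact Subtype.ext (hdφ f.1 f.2 v)
  have hcent (c : RelCWComplex.cell (Set.univ : Set X) n) : cellChart h c 0 = RelCWComplex.map n c 0 := congrArg _ h0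
  have hj : IsOpenEmbedding (inclTop (puncturedCover_subset p n)) := by
    refine ⟨IsEmbedding.inclusion (puncturedCover_subset p n), ?_⟩
    have hcl : IsClosed (cellCentres X n) := (Set.finite_range _).isClosed
    convert hcl.isOpen_compl.preimage
      (hp.continuous.comp (continuous_subtype_val (p := fun e => e ∈ coverSkeleton p (n + 1)))) using 1
    refine (Set.range_inclusion (puncturedCover_subset p n)).trans ?_
    ext e
    exact ⟨fun h => h.2, fun h => ⟨e.2, h⟩⟩
  have hb := bijective_sumHomologyMap_relMap (F := F) (punctured V) IsEmbedding.subtypeVal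
    (inclTop (puncturedCover_subset p n)) hj α φ' (fun _ => rfl) hopen
    (by
      rintro f v ⟨u, hu⟩
      refine ⟨⟨v, ?_⟩, rfl⟩
      rintro rfl
      have hu' : u.1 = f.1.1 (φ f.2 0) := congrArg Subtype.val hu
      refine u.2.2 ?_
      rw [hu', hdφ, hcent]
      exact ⟨f.2, rfl⟩)
    (by
      rintro ⟨d, c⟩ ⟨d', c'⟩ v v' hv
      have hv₁ : d.1 (φ c v) = d'.1 (φ c' v') := congrArg Subtype.val hv
      have hv₂ := congrArg p hv₁
      rw [hdφ, hdφ] at hv₂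
      obtain rfl : c = c' := eq_of_mem_openCell (cellChart_mem_openCell h c v)
        (by rw [hv₂]; exact cellChart_mem_openCell h c' v')
      obtain rfl : v = v' := (isEmbedding_cellChart h c).injective hv₂
      rw [eq_of_deckGroup_apply_eq hp hv₁])
    (by
      refine Set.eq_univ_of_forall fun y => ?_
      by_cases hy : p y.1 ∈ cellCentres X n
      · obtain ⟨c, hc⟩ := hy
        obtain ⟨d, hd⟩ := exists_deckGroup_apply_eq hp (e := φ c 0) (e' := y.1)
          (by rw [hφ, hcent]; exact hc)
        exact Or.inr (Set.mem_iUnion.mpr ⟨(d, c), 0, Subtype.ext hd⟩)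
      · exact Or.inl ⟨⟨y.1, y.2, hy⟩, rfl⟩) n
  let e := (Finsupp.mapRange.linearEquiv (α := F) g.symm).trans (LinearEquiv.ofBijective _ hb)
  have he (f : F) : (Module.Basis.ofRepr e.symm) f = (HomologicalComplex.homologyMap
      (relMap (f := punctured V) (f' := inclTop (puncturedCover_subset p n)) (α f) (φ' f) rfl)
        n).hom (g.symm 1) := by
    refine Eq.trans ?_ (sumHomologyMap_single (fun f => relMap (f := punctured V)
      (f' := inclTop (puncturedCover_subset p n)) (α f) (φ' f) rfl) n f (g.symm 1))
    change sumHomologyMap _ n ((Finsupp.mapRange.linearEquiv (α := F) g.symm)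
      (Finsupp.single f 1)) = _
    rw [Finsupp.mapRange.linearEquiv_apply, Finsupp.mapRange_single]
  refine ⟨Module.Basis.ofRepr e.symm, fun d d' c => ?_⟩
  rw [he, he]
  have h₃ := congrArg (fun ψ : (pairSeq (punctured V)).X₃ ⟶
      (pairSeq (inclTop (puncturedCover_subset p n))).X₃ =>
        (HomologicalComplex.homologyMap ψ n).hom (g.symm 1))
    (relMap_comp (f := punctured V) (f' := inclTop (puncturedCover_subset p n))
      (f'' := inclTop (puncturedCover_subset p n)) (α (d', c)) (φ' (d', c)) rfl
      (deckPunctured d n) ((deckFiltration p d).app (n + 1)) rfl rfl)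
  refine Eq.trans ?_ h₃
  exact (homologyMap_comp_apply _ _ _).symm

/-- The cellular chain group of the universal cover is free over the deck group, with one basis
element for each cell of `X`, in the degrees in which `X` has finitely many cells. -/
theorem exists_basis_cellChain [SimplyConnectedSpace E] [ConnectedSpace X] {p : E → X}
    (hp : IsCoveringMap p) (n : ℕ) [Finite (RelCWComplex.cell (Set.univ : Set X) n)] :
    ∃ b : Module.Basis (deckGroup p × RelCWComplex.cell (Set.univ : Set X) n) ℤ
        (cellChain (coverFiltration p) n),
      ∀ d d' c, cellRep p n d (b (d', c)) = b (d * d', c) := by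
  obtain ⟨b, hb⟩ := exists_basis_punctured hp n
  have := coverFiltration_mono p n
  let ι := relMap (f := stepMap (coverFiltration p) n) (f' := inclTop (puncturedCover_subset p n))
    (inclTop (coverSkeleton_subset_puncturedCover p n)) (𝟙 _) rfl
  have hι : QuasiIso ι := quasiIso_relMap _ _ _ (quasiIso_inclTop_puncturedCover hp n)
    (by rw [singularChains.map_id]; infer_instance)
  let e : cellChain (coverFiltration p) n ≃ₗ[ℤ]
      (pairSeq (inclTop (puncturedCover_subset p n))).X₃.homology n :=
    (asIso (HomologicalComplex.homologyMap ι n)).toLinearEquiv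
  refine ⟨b.map e.symm, fun d d' c => e.injective ?_⟩
  have h₁ : (pairSeqMap (deckFiltration p d) n).τ₃ ≫ ι = ι ≫ relMap
      (f := inclTop (puncturedCover_subset p n)) (f' := inclTop (puncturedCover_subset p n))
      (deckPunctured d n) ((deckFiltration p d).app (n + 1)) rfl :=
    (relMap_comp (f := stepMap (coverFiltration p) n) (f' := stepMap (coverFiltration p) n)
      (f'' := inclTop (puncturedCover_subset p n)) ((deckFiltration p d).app n)
      ((deckFiltration p d).app (n + 1)) rfl
      (inclTop (coverSkeleton_subset_puncturedCover p n)) (𝟙 _) rfl rfl).trans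
    (relMap_comp (f := stepMap (coverFiltration p) n) (f' := inclTop (puncturedCover_subset p n))
      (f'' := inclTop (puncturedCover_subset p n))
      (inclTop (coverSkeleton_subset_puncturedCover p n)) (𝟙 _) rfl
      (deckPunctured d n) ((deckFiltration p d).app (n + 1)) rfl rfl).symm
  have h₂ (x : cellChain (coverFiltration p) n) : e (cellRep p n d x) =
      (HomologicalComplex.homologyMap (relMap
        (f := inclTop (puncturedCover_subset p n)) (f' := inclTop (puncturedCover_subset p n))
        (deckPunctured d n) ((deckFiltration p d).app (n + 1)) rfl) n).hom (e x) := by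
    have h₃ := congrArg (fun ψ : (pairSeq (stepMap (coverFiltration p) n)).X₃ ⟶
      (pairSeq (inclTop (puncturedCover_subset p n))).X₃ =>
        (HomologicalComplex.homologyMap ψ n).hom x) h₁
    refine Eq.trans ?_ (h₃.trans ?_)
    · exact (homologyMap_comp_apply (pairSeqMap (deckFiltration p d) n).τ₃ ι x).symm
    · exact homologyMap_comp_apply ι _ x
  rw [h₂, Module.Basis.map_apply, Module.Basis.map_apply, e.apply_symm_apply, e.apply_symm_apply]
  exact hb d d' c

end FreeCells


/-! ### Minors and specialization of linearly independent vectors -/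

section Minors

variable {ι κ : Type*} [Fintype κ] [DecidableEq κ]

/-- Linearly independent vectors over a field have a non-vanishing maximal minor. -/
theorem exists_minor_ne_zero_of_field {K : Type*} [Field K] [Finite ι] {v : κ → ι → K}
    (hv : LinearIndependent K v) :
    ∃ s : κ → ι, (Matrix.of fun i j => v i (s j)).det ≠ 0 := by
  cases nonempty_fintype ι
  have hr : (Matrix.of v).rank = Fintype.card κ := LinearIndependent.rank_matrix hv
  obtain ⟨κ', a, ha, hspan, hind⟩ := exists_linearIndependent' K (Matrix.of v).col
  have := Fintype.ofInjective a ha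
  have htop : Submodule.span K (Set.range ((Matrix.of v).col ∘ a)) = ⊤ := by
    rw [hspan]
    refine Submodule.eq_top_of_finrank_eq ?_
    rw [← Matrix.rank_eq_finrank_span_cols, hr, Module.finrank_fintype_fun_eq_card]
  let b := Module.Basis.mk hind htop.ge
  have e : κ ≃ κ' := Fintype.equivOfCardEq (by
    rw [← Module.finrank_eq_card_basis b, Module.finrank_fintype_fun_eq_card])
  refine ⟨a ∘ e, ?_⟩
  have h : LinearIndependent K (Matrix.of fun i j => v i ((a ∘ e) j)).col :=
    hind.comp e e.injective
  exact ((Matrix.isUnit_iff_isUnit_det _).mp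
    (Matrix.linearIndependent_cols_iff_isUnit.mp h)).ne_zero

/-- Linearly independent vectors over a domain have a non-vanishing maximal minor. -/
theorem exists_minor_ne_zero {A : Type*} [CommRing A] [IsDomain A] [Finite ι] {v : κ → ι → A}
    (hv : LinearIndependent A v) :
    ∃ s : κ → ι, (Matrix.of fun i j => v i (s j)).det ≠ 0 := by
  -- pass to the field of fractions
  let f : (ι → A) →ₗ[A] (ι → FractionRing A) :=
    (Algebra.linearMap A (FractionRing A)).compLeft ι
  have h : LinearIndependent (FractionRing A) (f ∘ v) := by
    rw [← LinearIndependent.iff_fractionRing A (FractionRing A)]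
    refine hv.map' f (LinearMap.ker_eq_bot.mpr fun x y hxy => funext fun i => ?_)
    exact FaithfulSMul.algebraMap_injective A (FractionRing A) (congrFun hxy i)
  obtain ⟨s, hs⟩ := exists_minor_ne_zero_of_field h
  refine ⟨s, fun h0 => hs ?_⟩
  have := (algebraMap A (FractionRing A)).map_det (Matrix.of fun i j => v i (s j))
  rw [h0, map_zero] at this
  exact this.symm

/-- Vectors over a domain with a non-vanishing maximal minor are linearly independent. -/
theorem linearIndependent_of_minor_ne_zero {A : Type*} [CommRing A] [IsDomain A] {v : κ → ι → A}
    {s : κ → ι} (h : (Matrix.of fun i j => v i (s j)).det ≠ 0) : LinearIndependent A v := by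
  have h₁ := Matrix.linearIndependent_rows_of_det_ne_zero h
  exact LinearIndependent.of_comp (LinearMap.funLeft A A s) h₁

theorem map_minor {A S : Type*} [CommRing A] [CommRing S] (f : A →+* S) (v : κ → ι → A)
    (s : κ → ι) : (Matrix.of fun i j => (f ∘ v i) (s j)).det =
      f (Matrix.of fun i j => v i (s j)).det :=
  (f.map_det _).symm

end Minors

/-! ### The rank of a family of vectors under specialization of the coefficients -/

section Specialization

variable {ι : Type u} {A : Type w} [CommRing A]

/-- The rank of the submodule of `S ^ ι` spanned by the images of the vectors of `N ⊆ A ^ ι`. -/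
def imageRank {S : Type w} [CommRing S] (f : A →+* S) (N : Set (ι → A)) : Cardinal.{max u w} :=
  Module.rank S (Submodule.span S ((f ∘ ·) '' N))

theorem imageRank_lt_aleph0 [Finite ι] {S : Type w} [CommRing S] [IsDomain S] (f : A →+* S)
    (N : Set (ι → A)) : imageRank f N < Cardinal.aleph0 := by
  cases nonempty_fintype ι
  refine (Submodule.rank_le _).trans_lt ?_
  exact Module.rank_lt_aleph0 S (ι → S)

theorem card_le_imageRank {S : Type w} [CommRing S] [Nontrivial S] {f : A →+* S} {N : Set (ι → A)}
    {κ : Type (max u w)} {v : κ → ι → S} (hv : LinearIndependent S v)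
    (hN : ∀ k, v k ∈ Submodule.span S ((f ∘ ·) '' N)) : Cardinal.mk κ ≤ imageRank f N := by
  let v' : κ → Submodule.span S ((f ∘ ·) '' N) := fun k => ⟨v k, hN k⟩
  have h : LinearIndependent S v' :=
    LinearIndependent.of_comp (Submodule.span S ((f ∘ ·) '' N)).subtype hv
  exact h.cardinal_le_rank

/-- The rank does not increase under specialization to a field. -/
theorem imageRank_le_of_injective [Finite ι] {K R : Type w} [Field K] [CommRing R] [IsDomain R]
    (f : A →+* K) (g : A →+* R) (hg : Function.Injective g) (N : Set (ι → A)) :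
    imageRank f N ≤ imageRank g N := by
  classical
  obtain ⟨κ, a, ha, hspan, hind⟩ := exists_linearIndependent' K
    (fun x : N => (f ∘ x.1 : ι → K))
  have himage : Set.range (fun x : N => (f ∘ x.1 : ι → K)) = (f ∘ ·) '' N := by
    rw [Set.image_eq_range]
  have hrank : imageRank f N = Cardinal.mk κ := by
    rw [imageRank, ← himage, ← hspan, rank_span hind, Cardinal.mk_range_eq _ hind.injective]
  have : Finite κ := by
    rw [← Cardinal.lt_aleph0_iff_finite, ← hrank]
    exact imageRank_lt_aleph0 f N
  cases nonempty_fintype κ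
  obtain ⟨s, hs⟩ := exists_minor_ne_zero_of_field hind
  have h₁ : f (Matrix.of fun i j => (a i).1 (s j)).det ≠ 0 := by
    rw [← map_minor]
    exact hs
  have h₂ : (Matrix.of fun i j => (g ∘ (a i).1) (s j)).det ≠ 0 := by
    rw [map_minor]
    exact (map_ne_zero_iff g hg).mpr fun h => h₁ (by rw [h, map_zero])
  rw [hrank]
  exact card_le_imageRank (linearIndependent_of_minor_ne_zero (v := fun i => g ∘ (a i).1) h₂)
    fun k => Submodule.subset_span ⟨(a k).1, (a k).2, rfl⟩

/-- An element of the span of `N` over a localization becomes, after multiplication by a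
denominator, an element of the span of `N` over the base ring. -/
theorem exists_smul_eq_of_mem_span {R : Type w} [CommRing R] [Algebra A R]
    (M : Submonoid A) [IsLocalization M R] {N : Set (ι → A)} {x : ι → R}
    (hx : x ∈ Submodule.span R ((algebraMap A R ∘ ·) '' N)) :
    ∃ a ∈ M, ∃ y ∈ Submodule.span A N, algebraMap A R a • x = algebraMap A R ∘ y := by
  induction hx using Submodule.span_induction with
  | mem x hx =>
    obtain ⟨y, hy, rfl⟩ := hx
    exact ⟨1, M.one_mem, y, Submodule.subset_span hy, by rw [map_one, one_smul]⟩
  | zero => exact ⟨1, M.one_mem, 0, zero_mem _, by ext; simp⟩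
  | add x x' _ _ hx hx' =>
    obtain ⟨a, ha, y, hy, h⟩ := hx
    obtain ⟨a', ha', y', hy', h'⟩ := hx'
    refine ⟨a * a', mul_mem ha ha', a' • y + a • y',
      add_mem (Submodule.smul_mem _ _ hy) (Submodule.smul_mem _ _ hy'), ?_⟩
    ext i
    have h₁ := congrFun h i
    have h₂ := congrFun h' i
    simp only [Pi.smul_apply, Pi.add_apply, Function.comp_apply, smul_eq_mul, map_mul,
      map_add] at h₁ h₂ ⊢
    rw [← h₁, ← h₂]
    ring
  | smul r x _ hx =>
    obtain ⟨a, ha, y, hy, h⟩ := hx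
    obtain ⟨⟨c, b⟩, hb⟩ := IsLocalization.surj M r
    refine ⟨b.1 * a, mul_mem b.2 ha, c • y, Submodule.smul_mem _ _ hy, ?_⟩
    ext i
    have h₁ := congrFun h i
    simp only [Pi.smul_apply, Function.comp_apply, smul_eq_mul, map_mul] at h₁ hb ⊢
    rw [← h₁, ← hb]
    ring

/-- Over a localization `R` of the domain `A`, the rank is detected by a single minor, so
that it does not decrease under a specialization to a field at which a certain non-zero element
of `A` does not vanish. -/
theorem exists_imageRank_le [Finite ι] {R : Type w} [CommRing R] [IsDomain A] [IsDomain R] [Algebra A R]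
    (M : Submonoid A) [IsLocalization M R] (hR : Function.Injective (algebraMap A R))
    (N : Set (ι → A)) : ∃ δ : A, δ ≠ 0 ∧ ∀ (K : Type w) [Field K] (f : A →+* K), f δ ≠ 0 →
      imageRank (algebraMap A R) N ≤ imageRank f N := by
  classical
  obtain ⟨κ, hκ, hind⟩ := exists_set_linearIndependent R
    (Submodule.span R ((algebraMap A R ∘ ·) '' N))
  have : Finite κ := by
    rw [← Cardinal.lt_aleph0_iff_finite, hκ]
    exact imageRank_lt_aleph0 (algebraMap A R) N
  cases nonempty_fintype κ
  -- the denominators `a k` are units of `R`, so the rescaled vectors are still independent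
  choose a ha y hy hay using fun k : κ => exists_smul_eq_of_mem_span M k.1.2
  have h₁ : LinearIndependent R (fun k : κ => k.1.1) :=
    hind.map' (Submodule.subtype _) (Submodule.ker_subtype _)
  have h₂ := h₁.units_smul fun k => (IsLocalization.map_units R ⟨a k, ha k⟩).unit
  have h₃ : LinearIndependent R (fun k : κ => (algebraMap A R ∘ y k : ι → R)) := by
    convert h₂ using 1
    funext k
    exact (hay k).symm
  obtain ⟨s, hs⟩ := exists_minor_ne_zero h₃
  rw [map_minor] at hs
  refine ⟨_, (map_ne_zero_iff _ hR).mp hs, fun K _ f hf => ?_⟩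
  rw [← map_minor] at hf
  have h₄ := card_le_imageRank (N := N) (f := f)
    (linearIndependent_of_minor_ne_zero (v := fun k => f ∘ y k) hf) fun k => by
      refine Submodule.span_induction (p := fun z _ => (f ∘ z) ∈
        Submodule.span K ((f ∘ ·) '' N)) (fun z hz => Submodule.subset_span ⟨z, hz, rfl⟩) ?_ ?_ ?_
        (hy k)
      · rw [show f ∘ (0 : ι → A) = 0 by ext; simp]
        exact zero_mem _
      · intro z z' _ _ hz hz'
        convert add_mem hz hz'
        ext; simp
      · intro c z _ hz
        convert Submodule.smul_mem _ (f c) hz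
        ext; simp
  exact hκ.symm.trans_le h₄

end Specialization

/-! ### Coordinates on `S ⊗_{ℤG} M` for a free `ℤG`-module `M` -/

section Coordinates

variable {G : Type v} [Group G] {M : Type u} [AddCommGroup M] [Module ℤ M]
  {ρ : Representation ℤ G M} {ι : Type u} [DecidableEq ι]
  (b : Module.Basis (G × ι) ℤ M) {S : Type w} [CommRing S] (ψ : G →* S)

/-- The coordinates of `1 ⊗ m` in `S ⊗_{ℤG} M`, for the basis of the `ℤG`-module `M` that
consists of the elements `b (1, i)`. -/
def twistedCoord : M →ₗ[ℤ] (ι → S) :=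
  b.constr ℤ fun x => Pi.single x.2 (ψ x.1)

@[simp]
theorem twistedCoord_basis (g : G) (i : ι) : twistedCoord b ψ (b (g, i)) = Pi.single i (ψ g) :=
  b.constr_basis ℤ _ _

theorem twistedCoord_comp {S' : Type w} [CommRing S'] (f : S →+* S') (m : M) :
    twistedCoord b ((f : S →* S').comp ψ) m = f ∘ twistedCoord b ψ m := by
  let f' : (ι → S) →ₗ[ℤ] (ι → S') := (f.toAddMonoidHom.toIntLinearMap).compLeft ι
  have h : twistedCoord b ((f : S →* S').comp ψ) = f' ∘ₗ twistedCoord b ψ := by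
    refine b.ext fun x => ?_
    obtain ⟨g, i⟩ := x
    rw [LinearMap.comp_apply, twistedCoord_basis, twistedCoord_basis]
    funext j
    change _ = f ((Pi.single i (ψ g) : ι → S) j)
    by_cases hj : j = i
    · subst hj; simp
    · simp [hj]
  exact LinearMap.congr_fun h m

theorem twistedCoord_smul (hb : ∀ g g' i, ρ g (b (g', i)) = b (g * g', i))
    (g : G) (m : M) :
    twistedCoord b ψ (ρ g m) = ψ g • twistedCoord b ψ m := by
  have h : twistedCoord b ψ ∘ₗ ρ g =
      ((LinearMap.lsmul S (ι → S) (ψ g)).restrictScalars ℤ) ∘ₗ twistedCoord b ψ := by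
    refine b.ext fun x => ?_
    obtain ⟨g', i⟩ := x
    rw [LinearMap.comp_apply, LinearMap.comp_apply, hb, twistedCoord_basis, twistedCoord_basis]
    change _ = ψ g • (Pi.single i (ψ g') : ι → S)
    rw [map_mul, ← Pi.single_smul, smul_eq_mul]
  exact LinearMap.congr_fun h m

theorem constr_twistedCoord [Fintype ι] (hb : ∀ g g' i, ρ g (b (g', i)) = b (g * g', i))
    (m : M) :
    ((Pi.basisFun S ι).constr S fun i =>
      (Submodule.Quotient.mk (1 ⊗ₜ[ℤ] b (1, i)) : GroupTensor ψ ρ)) (twistedCoord b ψ m) =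
        Submodule.Quotient.mk (1 ⊗ₜ[ℤ] m) := by
  let T := (Pi.basisFun S ι).constr S fun i =>
    (Submodule.Quotient.mk (1 ⊗ₜ[ℤ] b (1, i)) : GroupTensor ψ ρ)
  have h : (T.restrictScalars ℤ) ∘ₗ twistedCoord b ψ =
      ((balancedRel ψ ρ).mkQ.restrictScalars ℤ) ∘ₗ TensorProduct.mk ℤ S M 1 := by
    refine b.ext fun x => ?_
    obtain ⟨g, i⟩ := x
    change T (twistedCoord b ψ (b (g, i))) = Submodule.Quotient.mk (1 ⊗ₜ[ℤ] b (g, i))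
    have h₁ : (Pi.single i (ψ g) : ι → S) = ψ g • Pi.basisFun S ι i := by
      rw [Pi.basisFun_apply, ← Pi.single_smul, smul_eq_mul, mul_one]
    rw [twistedCoord_basis, h₁, map_smul, Module.Basis.constr_basis, ← Submodule.Quotient.mk_smul,
      TensorProduct.smul_tmul', smul_eq_mul, mul_one]
    refine (Submodule.Quotient.eq _).mpr (Submodule.subset_span ⟨1, g, b (1, i), ?_⟩)
    rw [hb, one_mul, mul_one]
  exact LinearMap.congr_fun h m

/-- For a free `ℤG`-module `M`, the `S`-module `S ⊗_{ℤG} M` is free. -/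
def twistedCoordEquiv [Fintype ι] (hb : ∀ g g' i, ρ g (b (g', i)) = b (g * g', i)) :
    GroupTensor ψ ρ ≃ₗ[S] (ι → S) :=
  LinearEquiv.ofLinearMap
    ((balancedRel ψ ρ).liftQ ((twistedCoord b ψ).liftBaseChange S) (by
      rw [balancedRel, Submodule.span_le]
      rintro _ ⟨a, g, m, rfl⟩
      simp only [SetLike.mem_coe, LinearMap.mem_ker, map_sub, LinearMap.liftBaseChange_tmul]
      rw [twistedCoord_smul b ψ hb, smul_smul, sub_self]))
    ((Pi.basisFun S ι).constr S fun i => Submodule.Quotient.mk (1 ⊗ₜ[ℤ] b (1, i)))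
    (by
      refine (Pi.basisFun S ι).ext fun i => ?_
      rw [LinearMap.comp_apply, Module.Basis.constr_basis]
      simp [Submodule.liftQ_apply])
    (by
      refine Submodule.linearMap_qext _ (TensorProduct.AlgebraTensorModule.ext fun a m => ?_)
      change ((Pi.basisFun S ι).constr S fun i =>
        (Submodule.Quotient.mk (1 ⊗ₜ[ℤ] b (1, i)) : GroupTensor ψ ρ)) (a • twistedCoord b ψ m) =
          Submodule.Quotient.mk (a ⊗ₜ[ℤ] m)
      rw [map_smul, constr_twistedCoord b ψ hb, ← Submodule.Quotient.mk_smul,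
        TensorProduct.smul_tmul', smul_eq_mul, mul_one])

theorem twistedCoordEquiv_mk [Fintype ι] (hb : ∀ g g' i, ρ g (b (g', i)) = b (g * g', i))
    (a : S) (m : M) :
    twistedCoordEquiv b ψ hb (Submodule.Quotient.mk (a ⊗ₜ[ℤ] m)) = a • twistedCoord b ψ m := rfl

end Coordinates


/-! ### Betti numbers and ranks of boundary maps -/

section RankCounting

/-- Rank-nullity for the homology of a chain complex over a domain. -/
theorem rank_homology_add {S : Type w} [CommRing S] [IsDomain S]
    (K : ChainComplex (ModuleCat.{v} S) ℕ) (n : ℕ) :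
    Module.rank S (K.homology n) + Module.rank S (LinearMap.range (K.d (n + 1) n).hom) +
      Module.rank S (LinearMap.range (K.d n ((ComplexShape.down ℕ).next n)).hom) =
        Module.rank S (K.X n) := by
  have h₁ := LinearMap.rank_range_add_rank_ker (K.d n ((ComplexShape.down ℕ).next n)).hom
  have h₂ := LinearMap.rank_range_add_rank_ker (homClass K n)
  rw [rank_range_of_surjective _ (homClass_surjective K n)] at h₂
  have h₃ : (LinearMap.ker (homClass K n)).map (cycleSubmodule K n).subtype =
      LinearMap.range (K.d (n + 1) n).hom := by
    ext x
    constructor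
    · rintro ⟨z, hz, rfl⟩
      exact (homClass_eq_zero_iff z).mp hz
    · rintro ⟨y, rfl⟩
      have hy : (K.d (n + 1) n).hom y ∈ cycleSubmodule K n :=
        congrArg (fun φ : K.X (n + 1) ⟶ K.X ((ComplexShape.down ℕ).next n) => φ.hom y)
          (K.d_comp_d (n + 1) n _)
      exact ⟨⟨_, hy⟩, (homClass_eq_zero_iff _).mpr ⟨y, rfl⟩, rfl⟩
  have h₄ := (Submodule.equivMapOfInjective _ (Submodule.subtype_injective _)
    (LinearMap.ker (homClass K n))).rank_eq
  rw [h₃] at h₄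
  rw [← h₄, h₂, ← h₁, add_comm]
  rfl

/-- The rank of `id ⊗ f` for a map `f` to a free module: in coordinates, its range is spanned by the
vectors of coordinates of the values of `f`. -/
theorem rank_range_groupTensorMap {G : Type v} [Group G] {M P : Type u} [AddCommGroup M]
    [Module ℤ M] [AddCommGroup P] [Module ℤ P] {ρ : Representation ℤ G M}
    {σ : Representation ℤ G P} {ι : Type u} [DecidableEq ι] [Fintype ι]
    (b : Module.Basis (G × ι) ℤ M) (hb : ∀ g g' i, ρ g (b (g', i)) = b (g * g', i))
    {S : Type w} [CommRing S] (ψ : G →* S) (f : P →ₗ[ℤ] M) (hf : ∀ g m, f (σ g m) = ρ g (f m)) :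
    Module.rank S (LinearMap.range (groupTensorMap ψ σ ρ f hf)) =
      Module.rank S (Submodule.span S (Set.range fun x => twistedCoord b ψ (f x))) := by
  have h : (LinearMap.range (groupTensorMap ψ σ ρ f hf)).map
      (twistedCoordEquiv b ψ hb).toLinearMap =
        Submodule.span S (Set.range fun x => twistedCoord b ψ (f x)) := by
    refine le_antisymm ?_ (Submodule.span_le.mpr ?_)
    · rintro _ ⟨_, ⟨y, rfl⟩, rfl⟩
      obtain ⟨y, rfl⟩ := Submodule.mkQ_surjective _ y
      induction y using TensorProduct.induction_on with
      | zero => simp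
      | add y y' hy hy' =>
        rw [map_add, map_add, map_add]
        exact add_mem hy hy'
      | tmul a x =>
        exact Submodule.smul_mem _ a (Submodule.subset_span ⟨x, rfl⟩)
    · rintro _ ⟨x, rfl⟩
      refine ⟨_, ⟨Submodule.Quotient.mk (1 ⊗ₜ[ℤ] x), rfl⟩, ?_⟩
      exact (twistedCoordEquiv_mk b ψ hb 1 (f x)).trans (one_smul _ _)
  rw [← h]
  exact ((twistedCoordEquiv b ψ hb).submoduleMap _).rank_eq

/-- Cancellation in finite cardinals. -/
theorem le_of_add_add_eq {a b c a' b' c' d : Cardinal.{v}} (h : a + b + c = d)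
    (h' : a' + b' + c' = d) (hd : d < Cardinal.aleph0) (hb : b' ≤ b) (hc : c' ≤ c) : a ≤ a' := by
  have hle : a ≤ d ∧ b ≤ d ∧ c ≤ d := by
    rw [← h]
    exact ⟨(self_le_add_right a b).trans (self_le_add_right _ c),
      (self_le_add_left b a).trans (self_le_add_right _ c), self_le_add_left c _⟩
  have hle' : a' ≤ d := by
    rw [← h']
    exact (self_le_add_right a' b').trans (self_le_add_right _ c')
  obtain ⟨a, rfl⟩ := Cardinal.lt_aleph0.mp (hle.1.trans_lt hd)
  obtain ⟨b, rfl⟩ := Cardinal.lt_aleph0.mp (hle.2.1.trans_lt hd)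
  obtain ⟨c, rfl⟩ := Cardinal.lt_aleph0.mp (hle.2.2.trans_lt hd)
  obtain ⟨a', rfl⟩ := Cardinal.lt_aleph0.mp (hle'.trans_lt hd)
  obtain ⟨b', rfl⟩ := Cardinal.lt_aleph0.mp ((hb.trans hle.2.1).trans_lt hd)
  obtain ⟨c', rfl⟩ := Cardinal.lt_aleph0.mp ((hc.trans hle.2.2).trans_lt hd)
  obtain ⟨d, rfl⟩ := Cardinal.lt_aleph0.mp hd
  norm_cast at *
  omega

variable {X : Type u} [TopologicalSpace X] [T2Space X] [CWComplex (Set.univ : Set X)]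
  {E : Type u} [TopologicalSpace E]

/-- The rank of the boundary map from degree `n` of `S ⊗_{ℤG} C_•(E; ℤ)`. -/
def boundaryRank (p : E → X) {S : Type w} [CommRing S] (ψ : deckGroup p →* S) :
    ℕ → Cardinal.{max u w}
  | 0 => 0
  | n + 1 => Module.rank S (LinearMap.range (twistedBoundary p ψ n))

theorem rank_twistedComplex_homology_add (p : E → X) {S : Type w} [CommRing S] [IsDomain S]
    (ψ : deckGroup p →* S) (n : ℕ) :
    Module.rank S ((twistedComplex p ψ).homology n) + boundaryRank p ψ (n + 1) +
      boundaryRank p ψ n = Module.rank S (TwistedChain p ψ n) := by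
  have h := rank_homology_add (twistedComplex p ψ) n
  have hd (n : ℕ) : (twistedComplex p ψ).d (n + 1) n = ModuleCat.ofHom (twistedBoundary p ψ n) :=
    ChainComplex.of_d (V := ModuleCat.{max u w} S) (fun n => ModuleCat.of S (TwistedChain p ψ n))
      (fun n => ModuleCat.ofHom (twistedBoundary p ψ n)) n
  rw [hd] at h
  have h₀ : Module.rank S (LinearMap.range ((twistedComplex p ψ).d n
      ((ComplexShape.down ℕ).next n)).hom) = boundaryRank p ψ n := by
    cases n with
    | zero =>
      rw [(twistedComplex p ψ).shape 0 _ (by simp)]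
      refine (congrArg (fun N : Submodule S _ => Module.rank S N) LinearMap.range_zero).trans ?_
      exact rank_bot S _
    | succ m =>
      rw [ChainComplex.next_nat_succ, hd]
      rfl
  rw [h₀] at h
  exact h

/-- The coordinate vectors of the boundaries `1 ⊗ ∂x` of degree `n`, over a ring `A` of
coefficients. For each ring map `f : A →+* S`, their images span the boundaries over `S`. -/
def boundarySet (p : E → X) {n : ℕ} [DecidableEq (RelCWComplex.cell (Set.univ : Set X) n)]
    (b : Module.Basis (deckGroup p × RelCWComplex.cell (Set.univ : Set X) n) ℤ
      (cellChain (coverFiltration p) n)) {A : Type w} [CommRing A] (φ : deckGroup p →* A) :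
    Set (RelCWComplex.cell (Set.univ : Set X) n → A) :=
  Set.range fun x => twistedCoord b φ
    ((cellBoundary (coverFiltration p) (coverFiltration_mono p) n).hom x)

theorem boundaryRank_succ_eq_imageRank (p : E → X) {n : ℕ}
    [Fintype (RelCWComplex.cell (Set.univ : Set X) n)]
    [DecidableEq (RelCWComplex.cell (Set.univ : Set X) n)]
    (b : Module.Basis (deckGroup p × RelCWComplex.cell (Set.univ : Set X) n) ℤ
      (cellChain (coverFiltration p) n))
    (hb : ∀ d d' c, cellRep p n d (b (d', c)) = b (d * d', c))
    {A S : Type w} [CommRing A] [CommRing S] (φ : deckGroup p →* A) (f : A →+* S) :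
    boundaryRank p ((f : A →* S).comp φ) (n + 1) = imageRank f (boundarySet p b φ) := by
  refine (rank_range_groupTensorMap b hb _ _ _).trans ?_
  have h : (Set.range fun x => twistedCoord b ((f : A →* S).comp φ)
      ((cellBoundary (coverFiltration p) (coverFiltration_mono p) n).hom x)) =
        (f ∘ ·) '' boundarySet p b φ := by
    rw [boundarySet, ← Set.range_comp]
    exact congrArg Set.range (funext fun x => twistedCoord_comp b φ f _)
  rw [h]
  rfl

variable [ConnectedSpace X] [SimplyConnectedSpace E]

theorem rank_twistedChain {p : E → X} (hp : IsCoveringMap p) {S : Type w} [CommRing S]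
    [Nontrivial S] (ψ : deckGroup p →* S) (n : ℕ)
    [Fintype (RelCWComplex.cell (Set.univ : Set X) n)] :
    Module.rank S (TwistedChain p ψ n) =
      Fintype.card (RelCWComplex.cell (Set.univ : Set X) n) := by
  classical
  obtain ⟨b, hb⟩ := exists_basis_cellChain hp n
  exact ((twistedCoordEquiv b ψ hb).rank_eq).trans rank_fun'

/-- The boundary ranks do not increase under a specialization to a field. -/
theorem boundaryRank_le {p : E → X} (hp : IsCoveringMap p) {n : ℕ}
    [Finite (RelCWComplex.cell (Set.univ : Set X) n)] {A K R : Type w} [CommRing A] [Field K]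
    [CommRing R] [IsDomain R] (φ : deckGroup p →* A) (f : A →+* K) (g : A →+* R)
    (hg : Function.Injective g) :
    boundaryRank p ((f : A →* K).comp φ) (n + 1) ≤ boundaryRank p ((g : A →* R).comp φ) (n + 1) := by
  classical
  cases nonempty_fintype (RelCWComplex.cell (Set.univ : Set X) n)
  obtain ⟨b, hb⟩ := exists_basis_cellChain hp n
  rw [boundaryRank_succ_eq_imageRank p b hb, boundaryRank_succ_eq_imageRank p b hb]
  exact imageRank_le_of_injective f g hg _

/-- The boundary ranks over a localization are attained at a generic specialization. -/
theorem exists_boundaryRank_le {p : E → X} (hp : IsCoveringMap p) {n : ℕ}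
    [Finite (RelCWComplex.cell (Set.univ : Set X) n)] {A R : Type w} [CommRing A] [IsDomain A]
    [CommRing R] [IsDomain R] [Algebra A R] (M : Submonoid A) [IsLocalization M R]
    (hR : Function.Injective (algebraMap A R)) (φ : deckGroup p →* A) :
    ∃ δ : A, δ ≠ 0 ∧ ∀ (K : Type w) [Field K] (f : A →+* K), f δ ≠ 0 →
      boundaryRank p ((algebraMap A R : A →* R).comp φ) (n + 1) ≤
        boundaryRank p ((f : A →* K).comp φ) (n + 1) := by
  classical
  cases nonempty_fintype (RelCWComplex.cell (Set.univ : Set X) n)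
  obtain ⟨b, hb⟩ := exists_basis_cellChain hp n
  obtain ⟨δ, hδ, h⟩ := exists_imageRank_le M hR (boundarySet p b φ)
  refine ⟨δ, hδ, fun K _ f hf => ?_⟩
  rw [boundaryRank_succ_eq_imageRank p b hb, boundaryRank_succ_eq_imageRank p b hb]
  exact h K f hf

/-- Larger boundary ranks give smaller Betti numbers. -/
theorem rank_homology_le_of_boundaryRank_le {p : E → X} (hp : IsCoveringMap p) {n : ℕ}
    [Finite (RelCWComplex.cell (Set.univ : Set X) n)] {S T : Type w} [CommRing S] [IsDomain S]
    [CommRing T] [IsDomain T] (ψ : deckGroup p →* S) (θ : deckGroup p →* T)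
    (h : ∀ m, n ≤ m → m ≤ n + 1 → boundaryRank p θ m ≤ boundaryRank p ψ m) :
    Module.rank S ((twistedComplex p ψ).homology n) ≤
      Module.rank T ((twistedComplex p θ).homology n) := by
  cases nonempty_fintype (RelCWComplex.cell (Set.univ : Set X) n)
  have h₁ := rank_twistedComplex_homology_add p ψ n
  have h₂ := rank_twistedComplex_homology_add p θ n
  rw [rank_twistedChain hp] at h₁ h₂
  exact le_of_add_add_eq h₁ h₂ (Cardinal.natCast_lt_aleph0) (h _ n.le_succ le_rfl)
    (h _ le_rfl n.le_succ)

/-- Betti numbers do not increase when passing from a field to a domain into which the ring of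
coefficients embeds. -/
theorem rank_homology_le_of_injective {p : E → X} (hp : IsCoveringMap p) {n : ℕ}
    (hfin : ∀ m ≤ n, Finite (RelCWComplex.cell (Set.univ : Set X) m)) {A K R : Type w}
    [CommRing A] [Field K] [CommRing R] [IsDomain R] (φ : deckGroup p →* A) (f : A →+* K)
    (g : A →+* R) (hg : Function.Injective g) :
    Module.rank R ((twistedComplex p ((g : A →* R).comp φ)).homology n) ≤
      Module.rank K ((twistedComplex p ((f : A →* K).comp φ)).homology n) := by
  have := hfin n le_rfl
  refine rank_homology_le_of_boundaryRank_le hp _ _ fun m _ hm => ?_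
  cases m with
  | zero => exact le_rfl
  | succ m =>
    have := hfin m (by omega)
    exact boundaryRank_le hp φ f g hg

/-- The Betti numbers over a localization agree with those of a generic specialization. -/
theorem exists_rank_homology_le {p : E → X} (hp : IsCoveringMap p) {q : ℕ}
    (hfin : ∀ m ≤ q, Finite (RelCWComplex.cell (Set.univ : Set X) m)) {A R : Type w}
    [CommRing A] [IsDomain A] [CommRing R] [IsDomain R] [Algebra A R] (M : Submonoid A)
    [IsLocalization M R] (hR : Function.Injective (algebraMap A R)) (φ : deckGroup p →* A) :
    ∃ δ : A, δ ≠ 0 ∧ ∀ (K : Type w) [Field K] (f : A →+* K), f δ ≠ 0 → ∀ n ≤ q,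
      Module.rank K ((twistedComplex p ((f : A →* K).comp φ)).homology n) ≤
        Module.rank R ((twistedComplex p ((algebraMap A R : A →* R).comp φ)).homology n) := by
  have h (m : Fin (q + 1)) := by
    have := hfin m (by omega)
    exact exists_boundaryRank_le hp (n := m) M hR φ
  choose δ hδ hδ' using h
  -- the product of the witnesses for the degrees `0, …, q`
  refine ⟨∏ m, δ m, Finset.prod_ne_zero_iff.mpr fun m _ => hδ m, fun K _ f hf n hn => ?_⟩
  rw [map_prod, Finset.prod_ne_zero_iff] at hf
  have := hfin n hn
  refine rank_homology_le_of_boundaryRank_le hp _ _ fun m _ hm => ?_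
  cases m with
  | zero => exact le_rfl
  | succ m => exact hδ' ⟨m, by omega⟩ K f (hf _ (Finset.mem_univ _))

end RankCounting

/-! ### Exponential characters and the rational Novikov ring -/

section Exponential

variable (Γ : AddSubgroup ℝ)

/-- The evaluation `ℤΓ → ℂ` that sends the group element `γ` to `exp(tγ)`. -/
def expEval (t : ℂ) : AddMonoidAlgebra ℤ Γ →+* ℂ :=
  (AddMonoidAlgebra.lift ℤ ℂ Γ
    { toFun := fun γ => Complex.exp (t * ((γ.toAdd : ℝ) : ℂ))
      map_one' := by simp
      map_mul' := fun a b => by simp [mul_add, Complex.exp_add] }).toRingHom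

theorem expEval_apply (t : ℂ) (a : AddMonoidAlgebra ℤ Γ) :
    expEval Γ t a = a.coeff.sum fun γ m => (m : ℂ) * Complex.exp (t * ((γ : ℝ) : ℂ)) := by
  refine (AddMonoidAlgebra.lift_apply _ _).trans ?_
  simp [zsmul_eq_mul]

theorem expEval_single (t : ℂ) (γ : Γ) :
    expEval Γ t (AddMonoidAlgebra.single γ 1) = Complex.exp (t * ((γ : ℝ) : ℂ)) := by
  rw [expEval_apply, AddMonoidAlgebra.coeff_single, Finsupp.sum_single_index] <;> simp

/-- The functions `t ↦ exp(tγ)` for `γ ∈ Γ` are distinct characters of the additive group `ℂ`, hence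
linearly independent. -/
theorem exists_expEval_ne_zero {a : AddMonoidAlgebra ℤ Γ} (ha : a ≠ 0) :
    ∃ t, expEval Γ t a ≠ 0 := by
  by_contra! h
  let F : Γ → (Multiplicative ℂ →* ℂ) := fun γ =>
    { toFun := fun t => Complex.exp (t.toAdd * ((γ : ℝ) : ℂ))
      map_one' := by simp
      map_mul' := fun a b => by simp [add_mul, Complex.exp_add] }
  have hF : Function.Injective F := by
    intro γ γ' hγ
    -- compare the values at `t = 1`, where the exponential is injective on real arguments
    have h₁ : Complex.exp (1 * ((γ : ℝ) : ℂ)) = Complex.exp (1 * ((γ' : ℝ) : ℂ)) :=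
      DFunLike.congr_fun hγ (Multiplicative.ofAdd (1 : ℂ))
    rw [one_mul, one_mul, ← Complex.ofReal_exp, ← Complex.ofReal_exp, Complex.ofReal_inj] at h₁
    exact Subtype.ext (Real.exp_injective h₁)
  have hind := (linearIndependent_monoidHom (Multiplicative ℂ) ℂ).comp F hF
  have h₀ := linearIndependent_iff.mp hind (a.coeff.mapRange (Int.cast : ℤ → ℂ) (by simp)) (by
    funext t
    have ht := h t.toAdd
    rw [expEval_apply] at ht
    rw [Finsupp.linearCombination_apply, Finsupp.sum_mapRange_index (by simp), Finsupp.sum,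
      Finset.sum_apply]
    exact ht)
  refine ha (AddMonoidAlgebra.ext (Finsupp.ext fun γ => ?_))
  have h₁ : ((a.coeff γ : ℤ) : ℂ) = 0 := DFunLike.congr_fun h₀ γ
  exact_mod_cast h₁

theorem novikovMonic_le_nonZeroDivisors :
    novikovMonic Γ ≤ nonZeroDivisors (AddMonoidAlgebra ℤ Γ) := by
  intro a ha
  refine mem_nonZeroDivisors_of_ne_zero ?_
  rintro rfl
  exact zero_ne_one ha.1

instance : IsDomain (RationalNovikovRing Γ) :=
  IsLocalization.isDomain_of_le_nonZeroDivisors _ (novikovMonic_le_nonZeroDivisors Γ)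

/-- The character of `π` with values in `ℤΓ`, for `Γ = im χ`, that sends `g` to `χ g ∈ Γ`. -/
def groupRingChar {π : Type u} [Group π] (χ : Additive π →+ ℝ) :
    π →* AddMonoidAlgebra ℤ χ.range where
  toFun g := AddMonoidAlgebra.single (χ.rangeRestrict (Additive.ofMul g)) 1
  map_one' := by rw [ofMul_one, map_zero, ← AddMonoidAlgebra.one_def]
  map_mul' a b := by rw [ofMul_mul, map_add, AddMonoidAlgebra.single_mul_single, mul_one]

end Exponential

end NovikovTau

end

theorem mainTheorem2 {X : Type u} [TopologicalSpace X] [T2Space X] [ConnectedSpace X]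
    [CWComplex (Set.univ : Set X)] (k : ℕ) (hk : 1 ≤ k)
    (hfin : ∀ n ≤ k, Finite (RelCWComplex.cell (Set.univ : Set X) n))
    {E : Type u} [TopologicalSpace E] [SimplyConnectedSpace E] {p : E → X}
    (hp : IsCoveringMap p) (e₀ : E)
    (χ : Additive (FundamentalGroup X (p e₀)) →+ ℝ) (hχ : χ ≠ 0) (q : ℕ) (hq : q ≤ k) :
    χ ∉ NovikovTau.realExpTangentCone
        (⋃ i ≤ q, NovikovTau.charVariety hp.continuous e₀ ℂ i 1) ↔
      ∀ i ≤ q, NovikovTau.novikovBetti hp.continuous e₀ χ i = 0 := by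
  have hfin' : ∀ m ≤ q, Finite (RelCWComplex.cell (Set.univ : Set X) m) :=
    fun m hm => hfin m (hm.trans hq)
  have hinj : Function.Injective (algebraMap (AddMonoidAlgebra ℤ χ.range)
      (NovikovTau.RationalNovikovRing χ.range)) :=
    IsLocalization.injective _ (NovikovTau.novikovMonic_le_nonZeroDivisors χ.range)
  let φ := NovikovTau.deckChar hp.continuous e₀ (NovikovTau.groupRingChar χ)
  -- `exp(tχ)` on the deck group factors through the group ring of the image of `χ`
  have hmem : χ ∉ NovikovTau.realExpTangentCone
      (⋃ i ≤ q, NovikovTau.charVariety hp.continuous e₀ ℂ i 1) ↔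
        ∃ t : ℂ, ∀ i ≤ q, Module.rank ℂ ((NovikovTau.twistedComplex p
          ((NovikovTau.expEval χ.range t : _ →* ℂ).comp φ)).homology i) = 0 := by
    rw [NovikovTau.realExpTangentCone, Set.mem_ofPred_eq, NovikovTau.expTangentCone,
      Set.mem_ofPred_eq, not_forall]
    refine exists_congr fun t => ?_
    have h : (NovikovTau.expEval χ.range t : _ →* ℂ).comp φ = NovikovTau.deckChar hp.continuous e₀
        ((Units.coeHom ℂ).comp (NovikovTau.expChar ((AddMonoidHom.mulLeft t).comp
          (Complex.ofRealHom.toAddMonoidHom.comp χ)))) := by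
      ext d
      exact NovikovTau.expEval_single χ.range t _
    simp only [Set.mem_iUnion, not_exists, NovikovTau.charVariety, Set.mem_ofPred_eq, Nat.cast_one,
      Cardinal.one_le_iff_ne_zero, not_not]
    rw [h]
  rw [hmem]
  constructor
  · rintro ⟨t, ht⟩ i hi
    exact le_antisymm ((NovikovTau.rank_homology_le_of_injective hp
      (fun m hm => hfin' m (hm.trans hi)) φ (NovikovTau.expEval χ.range t) _ hinj).trans
        (ht i hi).le) zero_le
  · intro h
    -- a parameter `t` that is generic for the boundary maps of degree at most `q + 1`
    obtain ⟨δ, hδ, hδ'⟩ := NovikovTau.exists_rank_homology_le hp hfin'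
      (NovikovTau.novikovMonic χ.range) hinj φ
    obtain ⟨t, ht⟩ := NovikovTau.exists_expEval_ne_zero χ.range hδ
    exact ⟨t, fun i hi => le_antisymm ((hδ' ℂ _ ht i hi).trans (h i hi).le) zero_le⟩
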